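/- Let $n\ge 1$, let $G$ be the simply connected simple algebraic group over $\mathbb C$ of type $B_n$ with Cartan matrix $a_{ij}=\alpha_j(h_i)$, $a_{n,n-1}=-2$ (so $\alpha_n$ is the short simple root), Chevalley generators $e_i,f_i$, fundamental weights $\Lambda_i$, maximal torus $T$, opposite maximal unipotent subgroups $U^{\pm}$, $x_i(t)=\exp(te_i)$, $y_i(t)=\exp(tf_i)$, and simple coroots $\alpha_i^\vee:\mathbb C^\times\to T$. Put $\overline{s}_i=x_i(-1)y_i(1)x_i(-1)$, and $\overline w=\overline s_{i_1}\cdots\overline s_{i_l}$ for a reduced word $i_1\cdots i_l$ of a Weyl group element $w$. For a dominant weight $\mu$ let $\Delta_\mu$ be the regular function on $G$ with $\Delta_\mu(u^-tu^+)=\mu(t)$ for $u^\pm\in U^\pm$, $t\in T$, and for Weyl group elements $u,v$ put $\Delta_{u\mu,v\mu}(g)=\Delta_\mu(\overline u^{\,-1}g\,\overline v)$. Let $w_0$ be the longest element of the Weyl group, $\mathbf i_0=(1\,2\cdots n)^n$, and for $c=(c^{(1)}_1,c^{(1)}_2,\dots,c^{(1)}_n,c^{(2)}_1,\dots,c^{(n)}_n)\in(\mathbb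 C^\times)^{n^2}$ let $$\Theta^-_{\mathbf i_0}(c)=\prod_{p=1}^{n}\ \prod_{i=1}^{n} y_i\big(c^{(p)}_i\big)\,\alpha_i^\vee\big((c^{(p)}_i)^{-1}\big),$$ the factors being multiplied in the order of the entries of $c$. Then for $1\le k\le n-1$ $$\Delta_{w_0\Lambda_k,s_k\Lambda_k}(\Theta^-_{\mathbf i_0}(c))=c^{(k)}_1+\sum_{j=2}^{n-1}\frac{c^{(k)}_j}{c^{(k+1)}_{j-1}}+\frac{(c^{(k)}_n)^2}{c^{(k+1)}_{n-1}}+2\,\frac{c^{(k)}_n}{c^{(k+1)}_n}+\frac{c^{(k+1)}_{n-1}}{(c^{(k+1)}_n)^2}+\sum_{m=k+2}^{n}\frac{c^{(m)}_{n+k-m}}{c^{(m)}_{n+k-m+1}},$$ and for $k=n$ $$\Delta_{w_0\Lambda_n,s_n\Lambda_n}(\Theta^-_{\mathbf i_0}(c))=c^{(n)}_n .$$ -/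

import Mathlib

namespace TypeB

/-! ### Weights and the Weyl group of type `B_n`

The index set `{1, …, n}` is `Fin n`, the index `i` standing for `i + 1`; the last index is the one
with `i + 1 = n`, and its simple root is the short one. -/

/-- The weight lattice, written in the basis of fundamental weights: `μ i = ⟨h_i, μ⟩`. -/
abbrev Weight (n : ℕ) : Type := Fin n → ℤ

/-- The fundamental weight `Λ_i`. -/
def fundWeight {n : ℕ} (i : Fin n) : Weight n := Pi.single i 1

/-- The simple root `α_i`, whose coordinates are `⟨h_j, α_i⟩`. In `CartanMatrix.B` the entry `(i, j)`
is `⟨α_i, h_j⟩`, so that `⟨h_n, α_{n-1}⟩ = -2`. -/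
def simpleRoot {n : ℕ} (i : Fin n) : Weight n := fun j => CartanMatrix.B n i j

theorem proj_simpleRoot {n : ℕ} (i : Fin n) :
    (LinearMap.proj i : Weight n →ₗ[ℤ] ℤ) (simpleRoot i) = 2 := by
  simp [simpleRoot]

/-- The simple reflection `μ ↦ μ - ⟨h_i, μ⟩ α_i`. -/
def reflectionMap {n : ℕ} (i : Fin n) : Weight n ≃ₗ[ℤ] Weight n :=
  Module.reflection (proj_simpleRoot i)

/-- The Weyl group, generated by the simple reflections. -/
abbrev Weyl (n : ℕ) : Type :=
  Subgroup.closure (Set.range (reflectionMap : Fin n → (Weight n ≃ₗ[ℤ] Weight n)))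

/-- The simple reflection `s_i` as an element of the Weyl group. -/
def simpleRefl {n : ℕ} (i : Fin n) : Weyl n :=
  ⟨reflectionMap i, Subgroup.subset_closure ⟨i, rfl⟩⟩

/-- The length of `w`: the least number of simple reflections with product `w`. -/
noncomputable def weylLength {n : ℕ} (w : Weyl n) : ℕ :=
  sInf {m | ∃ l : List (Fin n), (l.map simpleRefl).prod = w ∧ l.length = m}

/-- `l` is a reduced word of `w`. -/
def IsReducedWord {n : ℕ} (l : List (Fin n)) (w : Weyl n) : Prop :=
  (l.map simpleRefl).prod = w ∧ l.length = weylLength w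

/-- `w` is the longest element of the Weyl group. -/
def IsLongest {n : ℕ} (w : Weyl n) : Prop :=
  ∀ w' : Weyl n, weylLength w' ≤ weylLength w

theorem simpleRefl_inv {n : ℕ} (i : Fin n) : (simpleRefl i)⁻¹ = simpleRefl i := rfl

theorem exists_word {n : ℕ} (w : Weyl n) :
    ∃ l : List (Fin n), (l.map simpleRefl).prod = w := by
  obtain ⟨w, hw⟩ := w
  induction hw using Subgroup.closure_induction with
  | mem x hx =>
    obtain ⟨i, rfl⟩ := hx
    exact ⟨[i], by simp [simpleRefl]⟩
  | one => exact ⟨[], rfl⟩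
  | mul x y hx hy ihx ihy =>
    obtain ⟨l, hl⟩ := ihx
    obtain ⟨m, hm⟩ := ihy
    exact ⟨l ++ m, by simp [hl, hm]⟩
  | inv x hx ih =>
    obtain ⟨l, hl⟩ := ih
    refine ⟨l.reverse, ?_⟩
    have h := congrArg (fun g : Weyl n => g⁻¹) hl
    simp only [List.prod_inv_reverse, List.map_map] at h
    rw [List.map_reverse]
    exact h

theorem exists_reducedWord {n : ℕ} (w : Weyl n) : ∃ l : List (Fin n), IsReducedWord l w :=
  Nat.sInf_mem (s := {m | ∃ l : List (Fin n), (l.map simpleRefl).prod = w ∧ l.length = m})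
    (by obtain ⟨l, hl⟩ := exists_word w; exact ⟨_, l, hl, rfl⟩)

/-! ### The vector and the spin representation of the simple Lie algebra of type `B_n` -/

/-- The basis `v_1, …, v_n`, `v_0`, `v_{\bar 1}, …, v_{\bar n}` of the vector representation. -/
abbrev VecIdx (n : ℕ) : Type := Fin n ⊕ Unit ⊕ Fin n

/-- The basis `(ε_1, …, ε_n)` of the spin representation; `true` is `+` and `false` is `-`. -/
abbrev SpinIdx (n : ℕ) : Type := Fin n → Bool

/-- The matrix of `f_i` on the vector representation: for `i < n`, `f_i v_i = v_{i+1}` and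
`f_i v_{\bar{i+1}} = v_{\bar i}`; moreover `f_n v_n = v_0` and `f_n v_0 = 2 v_{\bar n}`.
The entry at `(a, b)` is the coefficient of `v_a` in `f_i v_b`. -/
def vecF {n : ℕ} (i : Fin n) : Matrix (VecIdx n) (VecIdx n) ℂ :=
  Matrix.of fun a b =>
    match a, b with
    | .inl p, .inl q => if q = i ∧ p.val = i.val + 1 then 1 else 0
    | .inr (.inr p), .inr (.inr q) => if p = i ∧ q.val = i.val + 1 then 1 else 0
    | .inr (.inl _), .inl q => if q = i ∧ i.val + 1 = n then 1 else 0
    | .inr (.inr p), .inr (.inl _) => if p = i ∧ i.val + 1 = n then 2 else 0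
    | _, _ => 0

/-- The matrix of `e_i` on the vector representation: for `i < n`, `e_i v_{i+1} = v_i` and
`e_i v_{\bar i} = v_{\bar{i+1}}`; moreover `e_n v_0 = 2 v_n` and `e_n v_{\bar n} = v_0`. -/
def vecE {n : ℕ} (i : Fin n) : Matrix (VecIdx n) (VecIdx n) ℂ :=
  Matrix.of fun a b =>
    match a, b with
    | .inl p, .inl q => if p = i ∧ q.val = i.val + 1 then 1 else 0
    | .inr (.inr p), .inr (.inr q) => if q = i ∧ p.val = i.val + 1 then 1 else 0
    | .inl p, .inr (.inl _) => if p = i ∧ i.val + 1 = n then 2 else 0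
    | .inr (.inl _), .inr (.inr q) => if q = i ∧ i.val + 1 = n then 1 else 0
    | _, _ => 0

/-- The matrix of `f_i` on the spin representation: for `i < n` it sends `(…, +, -, …)`, with these
signs at the places `i`, `i + 1`, to `(…, -, +, …)`; `f_n` sends `(…, +)` to `(…, -)`; all other
basis vectors are sent to `0`. -/
def spinF {n : ℕ} (i : Fin n) : Matrix (SpinIdx n) (SpinIdx n) ℂ :=
  Matrix.of fun a b =>
    if h : i.val + 1 < n then
      if b i = true ∧ b ⟨i.val + 1, h⟩ = false ∧
          a = Function.update (Function.update b i false) ⟨i.val + 1, h⟩ true then 1 else 0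
    else if b i = true ∧ a = Function.update b i false then 1 else 0

/-- The matrix of `e_i` on the spin representation: for `i < n` it sends `(…, -, +, …)`, with these
signs at the places `i`, `i + 1`, to `(…, +, -, …)`; `e_n` sends `(…, -)` to `(…, +)`; all other
basis vectors are sent to `0`. -/
def spinE {n : ℕ} (i : Fin n) : Matrix (SpinIdx n) (SpinIdx n) ℂ :=
  Matrix.of fun a b =>
    if h : i.val + 1 < n then
      if b i = false ∧ b ⟨i.val + 1, h⟩ = true ∧
          a = Function.update (Function.update b i true) ⟨i.val + 1, h⟩ false then 1 else 0
    else if b i = false ∧ a = Function.update b i true then 1 else 0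

/-! ### The simply connected group of type `B_n`

It is the Chevalley group attached to the faithful representation `V(Λ_1) ⊕ V(Λ_n)`, the sum of the
vector and the spin representation: the subgroup of `GL(V(Λ_1)) × GL(V(Λ_n))` generated by all
`exp(t e_i)` and `exp(t f_i)`. The weights of this representation span the weight lattice, so the
group is the simply connected one, isomorphic to `Spin_{2n+1}(ℂ)`. -/

/-- The exponential of a square matrix, as an invertible matrix. -/
noncomputable def expUnit {m : Type} [Fintype m] [DecidableEq m] (A : Matrix m m ℂ) :
    (Matrix m m ℂ)ˣ where
  val := NormedSpace.exp A
  inv := NormedSpace.exp (-A)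
  val_inv := by
    rw [← Matrix.exp_add_of_commute _ _ (Commute.neg_right (Commute.refl A)), add_neg_cancel,
      NormedSpace.exp_zero]
  inv_val := by
    rw [← Matrix.exp_add_of_commute _ _ (Commute.neg_left (Commute.refl A)), neg_add_cancel,
      NormedSpace.exp_zero]

/-- `GL(V(Λ_1)) × GL(V(Λ_n))`. -/
abbrev Ambient (n : ℕ) : Type :=
  (Matrix (VecIdx n) (VecIdx n) ℂ)ˣ × (Matrix (SpinIdx n) (SpinIdx n) ℂ)ˣ

/-- `exp(t e_i)`. -/
noncomputable def expE {n : ℕ} (i : Fin n) (t : ℂ) : Ambient n :=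
  (expUnit (t • vecE i), expUnit (t • spinE i))

/-- `exp(t f_i)`. -/
noncomputable def expF {n : ℕ} (i : Fin n) (t : ℂ) : Ambient n :=
  (expUnit (t • vecF i), expUnit (t • spinF i))

/-- The simply connected simple algebraic group `G` over `ℂ` of type `B_n`. -/
abbrev G (n : ℕ) : Type :=
  Subgroup.closure {g : Ambient n | ∃ (i : Fin n) (t : ℂ), g = expE i t ∨ g = expF i t}

/-- `x_i(t) = exp(t e_i)`. -/
noncomputable def x {n : ℕ} (i : Fin n) (t : ℂ) : G n :=
  ⟨expE i t, Subgroup.subset_closure ⟨i, t, Or.inl rfl⟩⟩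

/-- `y_i(t) = exp(t f_i)`. -/
noncomputable def y {n : ℕ} (i : Fin n) (t : ℂ) : G n :=
  ⟨expF i t, Subgroup.subset_closure ⟨i, t, Or.inr rfl⟩⟩

/-- The representative `\bar s_i = x_i(-1) y_i(1) x_i(-1)` of the simple reflection `s_i`. -/
noncomputable def sBar {n : ℕ} (i : Fin n) : G n := x i (-1) * y i 1 * x i (-1)

/-- `α_i^∨(c)`, the image of `diag(c, c⁻¹)` under the homomorphism `φ_i : SL_2 → G` that sends the
elementary upper and lower unipotent matrices to `x_i(t)` and `y_i(t)`. In `SL_2`,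
`diag(c, c⁻¹) = X(c) Y(-c⁻¹) X(c) · X(-1) Y(1) X(-1)`. -/
noncomputable def coroot {n : ℕ} (i : Fin n) (c : ℂˣ) : G n :=
  x i (c : ℂ) * y i (-(c : ℂ)⁻¹) * x i (c : ℂ) * sBar i

/-- The maximal torus `T`, parametrized by `a ↦ ∏ α_i^∨(a_i)`; this is an isomorphism
`(ℂ^×)^n ≅ T`, as `G` is simply connected. -/
noncomputable def torus {n : ℕ} (a : Fin n → ℂˣ) : G n :=
  (List.ofFn fun i => coroot i (a i)).prod

/-- The maximal unipotent subgroup `U`, generated by the `x_i(t)`. -/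
def UPlus (n : ℕ) : Subgroup (G n) :=
  Subgroup.closure {g | ∃ (i : Fin n) (t : ℂ), g = x i t}

/-- The maximal unipotent subgroup `U^-`, generated by the `y_i(t)`. -/
def UMinus (n : ℕ) : Subgroup (G n) :=
  Subgroup.closure {g | ∃ (i : Fin n) (t : ℂ), g = y i t}

/-! ### Generalized minors -/

/-- The matrix entries of `g`. -/
def coords {n : ℕ} (g : G n) :
    (VecIdx n × VecIdx n) ⊕ (SpinIdx n × SpinIdx n) → ℂ
  | .inl ab => (g.1.1 : Matrix (VecIdx n) (VecIdx n) ℂ) ab.1 ab.2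
  | .inr ab => (g.1.2 : Matrix (SpinIdx n) (SpinIdx n) ℂ) ab.1 ab.2

/-- Regular functions on `G`: the polynomials in the matrix entries (all of `G` has determinant
`1` on both summands). -/
def IsRegular {n : ℕ} (F : G n → ℂ) : Prop :=
  ∃ p : MvPolynomial ((VecIdx n × VecIdx n) ⊕ (SpinIdx n × SpinIdx n)) ℂ,
    ∀ g : G n, F g = MvPolynomial.eval (coords g) p

/-- `F` is the principal minor `Δ_μ`: the regular function on `G` with `F(u⁻ t u⁺) = μ(t)` for
`u⁻ ∈ U⁻`, `t ∈ T`, `u⁺ ∈ U`, where `μ(∏ α_i^∨(a_i)) = ∏ a_i ^ ⟨h_i, μ⟩`. It is determined by these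
values, as `U⁻ T U` is dense in `G`. -/
def IsPrincipalMinor {n : ℕ} (μ : Weight n) (F : G n → ℂ) : Prop :=
  IsRegular F ∧ ∀ u ∈ UMinus n, ∀ a : Fin n → ℂˣ, ∀ v ∈ UPlus n,
    F (u * torus a * v) = ∏ i, (a i : ℂ) ^ μ i

open Classical in
/-- The principal minor `Δ_μ`, for `μ` dominant. -/
noncomputable def principalMinor {n : ℕ} (μ : Weight n) : G n → ℂ :=
  if h : ∃ F : G n → ℂ, IsPrincipalMinor μ F then h.choose else 0

/-- The representative `\bar w = \bar s_{i_1} ⋯ \bar s_{i_l}` of `w` in the group, for a reduced word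
`i_1 ⋯ i_l` of `w`. -/
noncomputable def weylLift {n : ℕ} (w : Weyl n) : G n :=
  ((exists_reducedWord w).choose.map sBar).prod

/-- The generalized minor `Δ_{uμ, vμ}(g) = Δ_μ(\bar u⁻¹ g \bar v)`. -/
noncomputable def genMinor {n : ℕ} (μ : Weight n) (u v : Weyl n) (g : G n) : ℂ :=
  principalMinor μ ((weylLift u)⁻¹ * g * weylLift v)

/-! ### The map `Θ⁻` -/

/-- The boldface `y_i(c) α_i^∨(c⁻¹)`. -/
noncomputable def yBold {n : ℕ} (i : Fin n) (c : ℂˣ) : G n := y i (c : ℂ) * coroot i c⁻¹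

/-- `Θ⁻_{i_1 ⋯ i_N}(c_1, …, c_N) = yBold i_1 c_1 ⋯ yBold i_N c_N`, the letters of the word being
listed together with their parameters. -/
noncomputable def thetaMinus {n : ℕ} (l : List (Fin n × ℂˣ)) : G n :=
  (l.map fun ic => yBold ic.1 ic.2).prod

/-- The word `(1 2 ⋯ n)^n` with the parameters
`c_1^{(1)}, c_2^{(1)}, …, c_n^{(1)}, c_1^{(2)}, …, c_n^{(n)}` at its letters; `c p i` is `c_i^{(p)}`,
both indices running from `1` to `n`. -/
def wordZero (n : ℕ) (c : ℕ → ℕ → ℂˣ) : List (Fin n × ℂˣ) :=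
  (List.ofFn fun p : Fin n =>
    List.ofFn fun i : Fin n => (i, c (p.val + 1) (i.val + 1))).flatten

end TypeB

/-! For `k < n` the principal minor of `Λ_k` is the leading `k × k` minor on the vector
representation, because `v_1 ∧ … ∧ v_k` is a highest weight vector of weight `Λ_k`. For `k = n` that
wedge has weight `2Λ_n`, so the diagonal coefficient at `(+, …, +)` on the spin representation is
used instead. These two functions have the required values on `U⁻ T U`
(`isPrincipalMinor_leadingMinor`, `isPrincipalMinor_spinCorner`), and density of that cell, in the
form `eq_zero_of_bigCell`, leaves no other candidate (`principalMinor_eq`).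

The Weyl group acts by signed permutations in orthonormal coordinates. The length of `w` is the
number of positive roots that are negative on `w(n, …, 1)`; hence every letter of a reduced word is
an ascent, and `w_0` is `-1`. Following basis vectors along such a word gives the lifts with their
signs: the inverse lift of `w_0` reads off the coefficient at `v_{\bar j}` with the sign
`(-1)^(j-1)` (`vecAct_weylLift_inv`), and the coefficient at `(-, …, -)` without sign
(`spinAct_weylLift_inv`).

For `k < n` the minor is therefore a determinant of coefficients at `v_{\bar 1}, …, v_{\bar k}`,
with signs, of the images under `Θ⁻` of `v_1, …, v_{k-1}, v_{k+1}`. Let a row be one factor `p` of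
the outer product. A row moves `v_p` within the upper half at most to `v_{p+1}`, while its
coefficients at the `v_{\bar p}` are, up to scalars, tail sums of one expression (`rowFun`).
Differences of neighbouring coefficients thus recover those from before the row was applied. Rows
`2, …, n` carry `v_1` to `v_n` plus earlier upper vectors, so the same differences turn the first
column into a unit vector, and one row of `Θ⁻` and one column drop out together (`det_row`). After
`k - 1` rounds only the `v_{\bar 1}`-coefficient of rows `k, …, n` applied to `v_{k+1}` is left
(`det_thetaTail`). Rows `k+2, …, n` give `v_n + S v_{n-1} + …`, where `S` is the last sum of the
formula; row `k+1` crosses into the lower half and row `k` collects the remaining terms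
(`vecAct_thetaTail_corner`).

For `k = n` the coefficient of `(-, …, -)` in the image of `(+, …, +, -)` is needed. A row creates
at most one minus sign. Row `n` moves the given one to the front, with coefficient `c^{(n)}_n`, and
each of the other `n - 1` rows has to create one and move it into place, which happens with
coefficient `1` (`spinAct_thetaTail`). -/

namespace TypeB

open Matrix

/-! ### The action on vectors -/

/-- The action of the group on the vector representation, in coordinates. -/
def vecAct {n : ℕ} (g : G n) (f : VecIdx n → ℂ) : VecIdx n → ℂ :=
  (g.1.1 : Matrix (VecIdx n) (VecIdx n) ℂ) *ᵥ f

/-- The action of the group on the spin representation, in coordinates. -/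
def spinAct {n : ℕ} (g : G n) (f : SpinIdx n → ℂ) : SpinIdx n → ℂ :=
  (g.1.2 : Matrix (SpinIdx n) (SpinIdx n) ℂ) *ᵥ f

theorem vecAct_mul {n : ℕ} (g h : G n) (f : VecIdx n → ℂ) :
    vecAct (g * h) f = vecAct g (vecAct h f) := by
  simp [vecAct, Matrix.mulVec_mulVec]

theorem spinAct_mul {n : ℕ} (g h : G n) (f : SpinIdx n → ℂ) :
    spinAct (g * h) f = spinAct g (spinAct h f) := by
  simp [spinAct, Matrix.mulVec_mulVec]

theorem vecAct_one {n : ℕ} (f : VecIdx n → ℂ) : vecAct (1 : G n) f = f := by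
  simp [vecAct]

theorem spinAct_one {n : ℕ} (f : SpinIdx n → ℂ) : spinAct (1 : G n) f = f := by
  simp [spinAct]

theorem ext_act {n : ℕ} {g h : G n} (hv : ∀ f, vecAct g f = vecAct h f)
    (hs : ∀ f, spinAct g f = spinAct h f) : g = h := by
  apply Subtype.ext
  apply Prod.ext
  · apply Units.ext
    exact Matrix.mulVec_injective (funext hv)
  · apply Units.ext
    exact Matrix.mulVec_injective (funext hs)

theorem vecAct_single {n : ℕ} (g : G n) (a b : VecIdx n) :
    vecAct g (Pi.single b 1) a = (g.1.1 : Matrix (VecIdx n) (VecIdx n) ℂ) a b := by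
  simp [vecAct]

theorem spinAct_single {n : ℕ} (g : G n) (a b : SpinIdx n) :
    spinAct g (Pi.single b 1) a = (g.1.2 : Matrix (SpinIdx n) (SpinIdx n) ℂ) a b := by
  simp [spinAct]

/-! ### Exponentials of nilpotent matrices -/

theorem exp_smul_of_cube_eq_zero {m : Type} [Fintype m] [DecidableEq m] {A : Matrix m m ℂ}
    (hA : A ^ 3 = 0) (t : ℂ) :
    NormedSpace.exp (t • A) = 1 + t • A + (t ^ 2 / 2) • A ^ 2 := by
  rw [NormedSpace.exp_eq_tsum ℂ]
  have h0 : ∀ k ∉ Finset.range 3, ((k.factorial : ℂ)⁻¹) • (t • A) ^ k = 0 := by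
    intro k hk
    obtain ⟨j, rfl⟩ : ∃ j, k = 3 + j := ⟨k - 3, by simp at hk; omega⟩
    rw [smul_pow, pow_add A, hA, zero_mul, smul_zero, smul_zero]
  beta_reduce
  rw [tsum_eq_sum h0]
  simp [Finset.sum_range_succ, smul_pow, smul_smul]
  congr 1
  ring

theorem exp_smul_mulVec {m : Type} [Fintype m] [DecidableEq m] {A : Matrix m m ℂ}
    (hA : ∀ f, A *ᵥ (A *ᵥ (A *ᵥ f)) = 0) (t : ℂ) (f : m → ℂ) :
    NormedSpace.exp (t • A) *ᵥ f = f + t • (A *ᵥ f) + (t ^ 2 / 2) • (A *ᵥ (A *ᵥ f)) := by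
  have h3 : A ^ 3 = 0 := by
    apply Matrix.mulVec_injective
    funext f
    simpa [pow_succ, Matrix.mulVec_mulVec, mul_assoc] using hA f
  rw [exp_smul_of_cube_eq_zero h3]
  simp [Matrix.add_mulVec, Matrix.smul_mulVec, pow_two, Matrix.mulVec_mulVec]

/-! ### The vector representation -/

theorem vecE_mulVec {n : ℕ} (i : Fin n) (f : VecIdx n → ℂ) :
    vecE i *ᵥ f = fun a => match a with
      | .inl p => if p = i then (if h : i.val + 1 < n then f (.inl ⟨i.val + 1, h⟩)
          else 2 * f (.inr (.inl ()))) else 0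
      | .inr (.inl _) => if i.val + 1 = n then f (.inr (.inr i)) else 0
      | .inr (.inr p) => if p.val = i.val + 1 then f (.inr (.inr i)) else 0 := by
  have key : ∀ g : Fin n → ℂ, (∑ q : Fin n, if q.val = i.val + 1 then g q else 0) =
      if h : i.val + 1 < n then g ⟨i.val + 1, h⟩ else 0 := by
    intro g
    split_ifs with h
    · rw [Finset.sum_eq_single ⟨i.val + 1, h⟩] <;> simp +contextual [Fin.ext_iff]
    · apply Finset.sum_eq_zero
      intro q _
      rw [if_neg (by omega)]
  funext a
  rcases a with p | _ | p
  · by_cases hp : p = i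
    · have := i.2
      by_cases h : i.val + 1 < n
      · have h' : i.val + 1 ≠ n := by omega
        simp [Matrix.mulVec, dotProduct, vecE, hp, key, h, h']
      · have h' : i.val + 1 = n := by omega
        simp only [Matrix.mulVec, dotProduct, vecE, hp]
        simp [h', fun q : Fin n => (show (q.val = n) = False from eq_false (by omega))]
    · simp [Matrix.mulVec, dotProduct, vecE, hp]
  · by_cases h : i.val + 1 = n <;> simp [Matrix.mulVec, dotProduct, vecE, h]
  · by_cases h : p.val = i.val + 1 <;> simp [Matrix.mulVec, dotProduct, vecE, h]

theorem vecF_mulVec {n : ℕ} (i : Fin n) (f : VecIdx n → ℂ) :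
    vecF i *ᵥ f = fun a => match a with
      | .inr (.inr p) => if p = i then (if h : i.val + 1 < n then f (.inr (.inr ⟨i.val + 1, h⟩))
          else 2 * f (.inr (.inl ()))) else 0
      | .inr (.inl _) => if i.val + 1 = n then f (.inl i) else 0
      | .inl p => if p.val = i.val + 1 then f (.inl i) else 0 := by
  have key : ∀ g : Fin n → ℂ, (∑ q : Fin n, if q.val = i.val + 1 then g q else 0) =
      if h : i.val + 1 < n then g ⟨i.val + 1, h⟩ else 0 := by
    intro g
    split_ifs with h
    · rw [Finset.sum_eq_single ⟨i.val + 1, h⟩] <;> simp +contextual [Fin.ext_iff]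
    · apply Finset.sum_eq_zero
      intro q _
      rw [if_neg (by omega)]
  funext a
  rcases a with p | _ | p
  · by_cases h : p.val = i.val + 1 <;> simp [Matrix.mulVec, dotProduct, vecF, h]
  · by_cases h : i.val + 1 = n <;> simp [Matrix.mulVec, dotProduct, vecF, h]
  · by_cases hp : p = i
    · have := i.2
      by_cases h : i.val + 1 < n
      · have h' : i.val + 1 ≠ n := by omega
        simp [Matrix.mulVec, dotProduct, vecF, hp, key, h, h']
      · have h' : i.val + 1 = n := by omega
        simp only [Matrix.mulVec, dotProduct, vecF, hp]
        simp [h', fun q : Fin n => (show (q.val = n) = False from eq_false (by omega))]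
    · simp [Matrix.mulVec, dotProduct, vecF, hp]

theorem vecE_mulVec_cube {n : ℕ} (i : Fin n) (f : VecIdx n → ℂ) :
    vecE i *ᵥ (vecE i *ᵥ (vecE i *ᵥ f)) = 0 := by
  have := i.2
  funext a
  rcases a with p | _ | p
  · by_cases h : i.val + 1 < n
    · simp [vecE_mulVec, h, Fin.ext_iff]
    · have h' : i.val + 1 = n := by omega
      have h'' : i.val ≠ n := by omega
      simp [vecE_mulVec, h', h'']
  · by_cases h : i.val + 1 < n <;> simp [vecE_mulVec]
  · by_cases h : i.val + 1 < n <;> simp [vecE_mulVec]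

theorem vecF_mulVec_cube {n : ℕ} (i : Fin n) (f : VecIdx n → ℂ) :
    vecF i *ᵥ (vecF i *ᵥ (vecF i *ᵥ f)) = 0 := by
  have := i.2
  funext a
  rcases a with p | _ | p
  · by_cases h : i.val + 1 < n <;> simp [vecF_mulVec]
  · by_cases h : i.val + 1 < n <;> simp [vecF_mulVec]
  · by_cases h : i.val + 1 < n
    · simp [vecF_mulVec, h, Fin.ext_iff]
    · have h' : i.val + 1 = n := by omega
      have h'' : i.val ≠ n := by omega
      simp [vecF_mulVec, h', h'']

theorem vecAct_x_of_lt {n : ℕ} (i : Fin n) (h : i.val + 1 < n) (t : ℂ) (f : VecIdx n → ℂ) :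
    vecAct (x i t) f = fun a => match a with
      | .inl p => if p = i then f (.inl i) + t * f (.inl ⟨i.val + 1, h⟩) else f (.inl p)
      | .inr (.inl _) => f (.inr (.inl ()))
      | .inr (.inr p) => if p.val = i.val + 1 then f (.inr (.inr p)) + t * f (.inr (.inr i))
          else f (.inr (.inr p)) := by
  have h' : i.val + 1 ≠ n := by omega
  change NormedSpace.exp (t • vecE i) *ᵥ f = _
  rw [exp_smul_mulVec (vecE_mulVec_cube i)]
  funext a
  rcases a with p | _ | p
  · by_cases hp : p = i
    · simp [vecE_mulVec, hp, h, Fin.ext_iff]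
    · simp [vecE_mulVec, hp]
  · simp [vecE_mulVec, h']
  · by_cases hp : p.val = i.val + 1 <;> simp [vecE_mulVec, hp]

theorem vecAct_x_of_last {n : ℕ} (i : Fin n) (h : i.val + 1 = n) (t : ℂ) (f : VecIdx n → ℂ) :
    vecAct (x i t) f = fun a => match a with
      | .inl p => if p = i then f (.inl i) + 2 * t * f (.inr (.inl ())) + t ^ 2 * f (.inr (.inr i))
          else f (.inl p)
      | .inr (.inl _) => f (.inr (.inl ())) + t * f (.inr (.inr i))
      | .inr (.inr p) => f (.inr (.inr p)) := by
  change NormedSpace.exp (t • vecE i) *ᵥ f = _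
  rw [exp_smul_mulVec (vecE_mulVec_cube i)]
  funext a
  rcases a with p | _ | p
  · by_cases hp : p = i <;> simp [vecE_mulVec, hp, h]
    ring
  · have h'' : i.val ≠ n := by omega
    simp [vecE_mulVec, h, h'']
  · have hp : p.val ≠ n := by omega
    simp [vecE_mulVec, h, hp]

theorem vecAct_y_of_lt {n : ℕ} (i : Fin n) (h : i.val + 1 < n) (t : ℂ) (f : VecIdx n → ℂ) :
    vecAct (y i t) f = fun a => match a with
      | .inl p => if p.val = i.val + 1 then f (.inl p) + t * f (.inl i) else f (.inl p)
      | .inr (.inl _) => f (.inr (.inl ()))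
      | .inr (.inr p) => if p = i then f (.inr (.inr i)) + t * f (.inr (.inr ⟨i.val + 1, h⟩))
          else f (.inr (.inr p)) := by
  have h' : i.val + 1 ≠ n := by omega
  change NormedSpace.exp (t • vecF i) *ᵥ f = _
  rw [exp_smul_mulVec (vecF_mulVec_cube i)]
  funext a
  rcases a with p | _ | p
  · by_cases hp : p.val = i.val + 1 <;> simp [vecF_mulVec, hp]
  · simp [vecF_mulVec, h']
  · by_cases hp : p = i
    · simp [vecF_mulVec, hp, h, Fin.ext_iff]
    · simp [vecF_mulVec, hp]

theorem vecAct_y_of_last {n : ℕ} (i : Fin n) (h : i.val + 1 = n) (t : ℂ) (f : VecIdx n → ℂ) :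
    vecAct (y i t) f = fun a => match a with
      | .inl p => f (.inl p)
      | .inr (.inl _) => f (.inr (.inl ())) + t * f (.inl i)
      | .inr (.inr p) => if p = i then f (.inr (.inr i)) + 2 * t * f (.inr (.inl ())) +
          t ^ 2 * f (.inl i) else f (.inr (.inr p)) := by
  change NormedSpace.exp (t • vecF i) *ᵥ f = _
  rw [exp_smul_mulVec (vecF_mulVec_cube i)]
  funext a
  rcases a with p | _ | p
  · have hp : p.val ≠ n := by omega
    simp [vecF_mulVec, h, hp]
  · have h'' : i.val ≠ n := by omega
    simp [vecF_mulVec, h, h'']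
  · by_cases hp : p = i <;> simp [vecF_mulVec, hp, h]
    ring

/-! ### The spin representation -/

/-- `s` with the value at the places `i`, `j` replaced. -/
abbrev upd2 {n : ℕ} (s : SpinIdx n) (i j : Fin n) (a b : Bool) : SpinIdx n :=
  Function.update (Function.update s i a) j b

/-- Flipping two signs is an involution. A matrix entry described through its source thus becomes a
condition on the target, and the sum over sources in `mulVec` collapses to one term. -/
theorem upd2_eq_iff {n : ℕ} {i j : Fin n} (hij : i ≠ j) (s u : SpinIdx n) (a b : Bool) :
    (u i = !a ∧ u j = !b ∧ s = upd2 u i j a b) ↔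
      (s i = a ∧ s j = b ∧ u = upd2 s i j (!a) (!b)) := by
  constructor
  · rintro ⟨h1, h2, rfl⟩
    refine ⟨by simp [upd2, hij], by simp [upd2], ?_⟩
    funext k
    by_cases hk : k = j
    · subst hk; simp [upd2, h2]
    · by_cases hk' : k = i
      · subst hk'; simp [upd2, h1, hk]
      · simp [upd2, hk, hk']
  · rintro ⟨h1, h2, rfl⟩
    refine ⟨by simp [upd2, hij], by simp [upd2], ?_⟩
    funext k
    by_cases hk : k = j
    · subst hk; simp [upd2, h2]
    · by_cases hk' : k = i
      · subst hk'; simp [upd2, h1, hk]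
      · simp [upd2, hk, hk']

theorem update_eq_iff_not {n : ℕ} {i : Fin n} (s u : SpinIdx n) (a : Bool) :
    (u i = !a ∧ s = Function.update u i a) ↔ (s i = a ∧ u = Function.update s i (!a)) := by
  constructor
  · rintro ⟨h1, rfl⟩
    exact ⟨by simp, by rw [← h1]; simp⟩
  · rintro ⟨h1, rfl⟩
    exact ⟨by simp, by rw [← h1]; simp⟩

theorem spinE_mulVec_of_lt {n : ℕ} (i : Fin n) (h : i.val + 1 < n) (f : SpinIdx n → ℂ) :
    spinE i *ᵥ f = fun s => if s i = true ∧ s ⟨i.val + 1, h⟩ = false then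
      f (upd2 s i ⟨i.val + 1, h⟩ false true) else 0 := by
  funext s
  have hij : i ≠ ⟨i.val + 1, h⟩ := by simp [Fin.ext_iff]
  have := fun u => upd2_eq_iff hij s u true false
  simp only [Bool.not_true, Bool.not_false, upd2] at this
  simp only [Matrix.mulVec, dotProduct, spinE, h, Matrix.of_apply, dif_pos, this, ite_mul, one_mul,
    zero_mul]
  by_cases hs : s i = true ∧ s ⟨i.val + 1, h⟩ = false
  · simp [hs]
  · rw [if_neg hs]
    exact Finset.sum_eq_zero fun u _ => if_neg fun hu => hs ⟨hu.1, hu.2.1⟩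

theorem spinF_mulVec_of_lt {n : ℕ} (i : Fin n) (h : i.val + 1 < n) (f : SpinIdx n → ℂ) :
    spinF i *ᵥ f = fun s => if s i = false ∧ s ⟨i.val + 1, h⟩ = true then
      f (upd2 s i ⟨i.val + 1, h⟩ true false) else 0 := by
  funext s
  have hij : i ≠ ⟨i.val + 1, h⟩ := by simp [Fin.ext_iff]
  have := fun u => upd2_eq_iff hij s u false true
  simp only [Bool.not_true, Bool.not_false, upd2] at this
  simp only [Matrix.mulVec, dotProduct, spinF, h, Matrix.of_apply, dif_pos, this, ite_mul, one_mul,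
    zero_mul]
  by_cases hs : s i = false ∧ s ⟨i.val + 1, h⟩ = true
  · simp [hs]
  · rw [if_neg hs]
    exact Finset.sum_eq_zero fun u _ => if_neg fun hu => hs ⟨hu.1, hu.2.1⟩

theorem spinE_mulVec_of_last {n : ℕ} (i : Fin n) (h : i.val + 1 = n) (f : SpinIdx n → ℂ) :
    spinE i *ᵥ f = fun s => if s i = true then f (Function.update s i false) else 0 := by
  funext s
  have := fun u => update_eq_iff_not (i := i) s u true
  simp only [Bool.not_true] at this
  have h' : ¬ i.val + 1 < n := by omega
  simp only [Matrix.mulVec, dotProduct, spinE, h', Matrix.of_apply, dif_neg, not_false_eq_true,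
    this, ite_mul, one_mul, zero_mul]
  by_cases hs : s i = true
  · simp [hs]
  · rw [if_neg hs]
    exact Finset.sum_eq_zero fun u _ => if_neg fun hu => hs hu.1

theorem spinF_mulVec_of_last {n : ℕ} (i : Fin n) (h : i.val + 1 = n) (f : SpinIdx n → ℂ) :
    spinF i *ᵥ f = fun s => if s i = false then f (Function.update s i true) else 0 := by
  funext s
  have := fun u => update_eq_iff_not (i := i) s u false
  simp only [Bool.not_false] at this
  have h' : ¬ i.val + 1 < n := by omega
  simp only [Matrix.mulVec, dotProduct, spinF, h', Matrix.of_apply, dif_neg, not_false_eq_true,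
    this, ite_mul, one_mul, zero_mul]
  by_cases hs : s i = false
  · simp [hs]
  · rw [if_neg hs]
    exact Finset.sum_eq_zero fun u _ => if_neg fun hu => hs hu.1

theorem spinE_mulVec_sq {n : ℕ} (i : Fin n) (f : SpinIdx n → ℂ) :
    spinE i *ᵥ (spinE i *ᵥ f) = 0 := by
  have := i.2
  funext s
  by_cases h : i.val + 1 < n
  · have hij : i ≠ ⟨i.val + 1, h⟩ := by simp [Fin.ext_iff]
    simp [spinE_mulVec_of_lt i h, upd2]
  · simp [spinE_mulVec_of_last i (by omega)]

theorem spinF_mulVec_sq {n : ℕ} (i : Fin n) (f : SpinIdx n → ℂ) :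
    spinF i *ᵥ (spinF i *ᵥ f) = 0 := by
  have := i.2
  funext s
  by_cases h : i.val + 1 < n
  · have hij : i ≠ ⟨i.val + 1, h⟩ := by simp [Fin.ext_iff]
    simp [spinF_mulVec_of_lt i h, upd2]
  · simp [spinF_mulVec_of_last i (by omega)]

theorem spinAct_x {n : ℕ} (i : Fin n) (t : ℂ) (f : SpinIdx n → ℂ) :
    spinAct (x i t) f = f + t • (spinE i *ᵥ f) := by
  change NormedSpace.exp (t • spinE i) *ᵥ f = _
  rw [exp_smul_mulVec (fun f => by rw [spinE_mulVec_sq]), spinE_mulVec_sq]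
  simp

theorem spinAct_y {n : ℕ} (i : Fin n) (t : ℂ) (f : SpinIdx n → ℂ) :
    spinAct (y i t) f = f + t • (spinF i *ᵥ f) := by
  change NormedSpace.exp (t • spinF i) *ᵥ f = _
  rw [exp_smul_mulVec (fun f => by rw [spinF_mulVec_sq]), spinF_mulVec_sq]
  simp

end TypeB

namespace TypeB

open Matrix

/-! ### Commutation of `e_j` and `f_i` -/

/-- The operator that flips the sign at the place `p`, where it has to produce `b`. -/
def flipAt {n : ℕ} (p : Fin n) (b : Bool) (f : SpinIdx n → ℂ) : SpinIdx n → ℂ :=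
  fun s => if s p = b then f (Function.update s p (!b)) else 0

theorem flipAt_comm {n : ℕ} {p q : Fin n} (hpq : p ≠ q) (b c : Bool) (f : SpinIdx n → ℂ) :
    flipAt p b (flipAt q c f) = flipAt q c (flipAt p b f) := by
  funext s
  simp only [flipAt, Function.update_of_ne hpq, Function.update_of_ne hpq.symm,
    Function.update_comm hpq]
  split_ifs <;> rfl

theorem flipAt_flipAt {n : ℕ} (p : Fin n) (b : Bool) (f : SpinIdx n → ℂ) :
    flipAt p b (flipAt p b f) = 0 := by
  funext s
  simp [flipAt]

theorem flipAt_zero {n : ℕ} (p : Fin n) (b : Bool) : flipAt p b (0 : SpinIdx n → ℂ) = 0 := by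
  funext s
  simp [flipAt]

theorem spinE_eq_flipAt {n : ℕ} (i : Fin n) (h : i.val + 1 < n) (f : SpinIdx n → ℂ) :
    spinE i *ᵥ f = flipAt i true (flipAt ⟨i.val + 1, h⟩ false f) := by
  have hij : (⟨i.val + 1, h⟩ : Fin n) ≠ i := by simp [Fin.ext_iff]
  funext s
  simp [spinE_mulVec_of_lt i h, flipAt, upd2, Function.update_of_ne hij, ite_and]

theorem spinF_eq_flipAt {n : ℕ} (i : Fin n) (h : i.val + 1 < n) (f : SpinIdx n → ℂ) :
    spinF i *ᵥ f = flipAt i false (flipAt ⟨i.val + 1, h⟩ true f) := by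
  have hij : (⟨i.val + 1, h⟩ : Fin n) ≠ i := by simp [Fin.ext_iff]
  funext s
  simp [spinF_mulVec_of_lt i h, flipAt, upd2, Function.update_of_ne hij, ite_and]

theorem spinE_eq_flipAt_last {n : ℕ} (i : Fin n) (h : i.val + 1 = n) (f : SpinIdx n → ℂ) :
    spinE i *ᵥ f = flipAt i true f := by
  funext s
  simp [spinE_mulVec_of_last i h, flipAt]

theorem spinF_eq_flipAt_last {n : ℕ} (i : Fin n) (h : i.val + 1 = n) (f : SpinIdx n → ℂ) :
    spinF i *ᵥ f = flipAt i false f := by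
  funext s
  simp [spinF_mulVec_of_last i h, flipAt]

/-- If `i` and `j` are neighbours, both products contain the same flip twice and vanish. Otherwise
they flip disjoint sets of places, or at shared distance the flips commute one by one. -/
theorem spinE_spinF_comm {n : ℕ} {i j : Fin n} (hij : i ≠ j) : Commute (spinE j) (spinF i) := by
  apply Matrix.mulVec_injective
  funext f
  simp only [← Matrix.mulVec_mulVec]
  by_cases hi : i.val + 1 < n
  · have hii : i ≠ ⟨i.val + 1, hi⟩ := by simp [Fin.ext_iff]
    by_cases hj : j.val + 1 < n
    · have hjj : j ≠ ⟨j.val + 1, hj⟩ := by simp [Fin.ext_iff]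
      rw [spinE_eq_flipAt j hj, spinE_eq_flipAt j hj, spinF_eq_flipAt i hi, spinF_eq_flipAt i hi]
      by_cases h1 : j = ⟨i.val + 1, hi⟩
      · have h2 : i ≠ ⟨j.val + 1, hj⟩ := by
          intro h
          have := congrArg Fin.val h
          have := congrArg Fin.val h1
          simp at *
          omega
        rw [← h1, flipAt_flipAt j, flipAt_zero, flipAt_comm hij, flipAt_comm hjj.symm,
          flipAt_flipAt]
      · by_cases h2 : i = ⟨j.val + 1, hj⟩
        · rw [← h2, flipAt_flipAt i, flipAt_zero, flipAt_comm hij.symm,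
            flipAt_comm hii.symm, flipAt_flipAt]
        · have h3 : (⟨i.val + 1, hi⟩ : Fin n) ≠ ⟨j.val + 1, hj⟩ := by
            simpa [Fin.ext_iff] using hij
          rw [flipAt_comm (Ne.symm h2), flipAt_comm h3.symm, flipAt_comm hij.symm,
            flipAt_comm h1]
    · have hj' : j.val + 1 = n := by omega
      rw [spinE_eq_flipAt_last j hj', spinE_eq_flipAt_last j hj', spinF_eq_flipAt i hi,
        spinF_eq_flipAt i hi]
      by_cases h1 : j = ⟨i.val + 1, hi⟩
      · rw [← h1, flipAt_flipAt j, flipAt_zero, flipAt_comm hij.symm, flipAt_flipAt, flipAt_zero]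
      · rw [flipAt_comm hij.symm, flipAt_comm h1]
  · have hi' : i.val + 1 = n := by omega
    have hj : j.val + 1 < n := by
      have := Fin.val_ne_of_ne hij
      omega
    rw [spinE_eq_flipAt j hj, spinE_eq_flipAt j hj, spinF_eq_flipAt_last i hi',
      spinF_eq_flipAt_last i hi']
    by_cases h1 : i = ⟨j.val + 1, hj⟩
    · rw [← h1, flipAt_flipAt i, flipAt_zero, flipAt_comm hij, flipAt_flipAt, flipAt_zero]
    · rw [flipAt_comm hij, flipAt_comm h1]

theorem vecE_vecF_comm {n : ℕ} {i j : Fin n} (hij : i ≠ j) : Commute (vecE j) (vecF i) := by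
  have hi' := i.2
  have hj' := j.2
  have hv := Fin.val_ne_of_ne hij
  apply Matrix.mulVec_injective
  funext f
  simp only [← Matrix.mulVec_mulVec]
  funext a
  rcases a with p | _ | p <;> simp only [vecE_mulVec, vecF_mulVec, Fin.ext_iff] <;>
    split_ifs <;> first | rfl | omega | simp_all

theorem x_mul_y_of_ne {n : ℕ} {i j : Fin n} (hij : i ≠ j) (s t : ℂ) :
    x j t * y i s = y i s * x j t := by
  apply Subtype.ext
  apply Prod.ext
  · apply Units.ext
    exact (((vecE_vecF_comm hij).smul_left t).smul_right s).exp
  · apply Units.ext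
    exact (((spinE_spinF_comm hij).smul_left t).smul_right s).exp

/-! ### Diagonal elements -/

/-- `g` is the diagonal element with the eigenvalues `z_p` at `v_p`, and `κ ∏ z_p`, the product over
the places of the sign `+`, on the spin representation. -/
structure IsDiag {n : ℕ} (g : G n) (d : (Fin n → ℂˣ) × ℂˣ) : Prop where
  inl : ∀ f p, vecAct g f (.inl p) = (d.1 p : ℂ) * f (.inl p)
  mid : ∀ f, vecAct g f (.inr (.inl ())) = f (.inr (.inl ()))
  inr : ∀ f p, vecAct g f (.inr (.inr p)) = (d.1 p : ℂ)⁻¹ * f (.inr (.inr p))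
  spin : ∀ f s, spinAct g f s = (d.2 * ∏ p, if s p = true then d.1 p else 1 : ℂˣ) * f s

theorem IsDiag.one {n : ℕ} : IsDiag (1 : G n) 1 := by
  constructor <;> simp [vecAct_one, spinAct_one]

theorem IsDiag.mul {n : ℕ} {g h : G n} {d e : (Fin n → ℂˣ) × ℂˣ} (hg : IsDiag g d)
    (hh : IsDiag h e) : IsDiag (g * h) (d * e) := by
  constructor
  · intro f p
    simp [vecAct_mul, hg.inl, hh.inl, mul_assoc]
  · intro f
    simp [vecAct_mul, hg.mid, hh.mid]
  · intro f p
    simp [vecAct_mul, hg.inr, hh.inr, mul_comm, mul_left_comm]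
  · intro f s
    have : (∏ p, if s p = true then (d * e).1 p else 1) =
        (∏ p, if s p = true then d.1 p else 1) * ∏ p, if s p = true then e.1 p else 1 := by
      rw [← Finset.prod_mul_distrib]
      refine Finset.prod_congr rfl fun p _ => ?_
      split_ifs <;> simp
    rw [spinAct_mul, hg.spin, hh.spin, this]
    push_cast
    simp only [Prod.snd_mul, Units.val_mul]
    ring

/-- Because `G` is given inside a product of two general linear groups, identities in the torus
reduce to identities between eigenvalues. -/
theorem IsDiag.unique {n : ℕ} {g h : G n} {d : (Fin n → ℂˣ) × ℂˣ} (hg : IsDiag g d)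
    (hh : IsDiag h d) : g = h := by
  apply ext_act
  · intro f
    funext a
    rcases a with p | _ | p
    · rw [hg.inl, hh.inl]
    · rw [hg.mid, hh.mid]
    · rw [hg.inr, hh.inr]
  · intro f
    funext s
    rw [hg.spin, hh.spin]

/-- The eigenvalue of the diagonal element `d` at the root vector `e_i`. -/
def rootVal {n : ℕ} (i : Fin n) (d : (Fin n → ℂˣ) × ℂˣ) : ℂˣ :=
  if h : i.val + 1 < n then d.1 i * (d.1 ⟨i.val + 1, h⟩)⁻¹ else d.1 i

theorem prod_update_true {n : ℕ} (z : Fin n → ℂˣ) (s : SpinIdx n) (i : Fin n) (hs : s i = false) :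
    (∏ p, if Function.update s i true p = true then z p else 1) =
      z i * ∏ p, if s p = true then z p else 1 := by
  rw [← Finset.mul_prod_erase _ _ (Finset.mem_univ i),
    ← Finset.mul_prod_erase (a := i) (s := Finset.univ) (f := fun p => if s p = true then z p else 1)
      (Finset.mem_univ i)]
  simp only [Function.update_self, hs]
  congr 1
  simp only [Bool.false_eq_true, if_false, one_mul]
  refine Finset.prod_congr rfl fun p hp => ?_
  rw [Function.update_of_ne (Finset.ne_of_mem_erase hp)]

theorem prod_update_false {n : ℕ} (z : Fin n → ℂˣ) (s : SpinIdx n) (i : Fin n) (hs : s i = true) :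
    (∏ p, if s p = true then z p else 1) =
      z i * ∏ p, if Function.update s i false p = true then z p else 1 := by
  have := prod_update_true z (Function.update s i false) i (by simp)
  rwa [Function.update_idem, Function.update_eq_self_iff.2 hs.symm] at this

theorem IsDiag.mul_x {n : ℕ} {g : G n} {d : (Fin n → ℂˣ) × ℂˣ} (hg : IsDiag g d) (i : Fin n)
    (t : ℂ) : g * x i t = x i (rootVal i d * t) * g := by
  have hin := i.2
  apply ext_act
  · intro f
    rw [vecAct_mul, vecAct_mul]
    by_cases h : i.val + 1 < n
    · have hr : (rootVal i d : ℂ) = d.1 i * (d.1 ⟨i.val + 1, h⟩ : ℂ)⁻¹ := by simp [rootVal, h]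
      have h1 := (d.1 i).ne_zero
      have h2 := (d.1 ⟨i.val + 1, h⟩).ne_zero
      rw [vecAct_x_of_lt i h, vecAct_x_of_lt i h, hr]
      funext a
      rcases a with p | _ | p
      · simp only [hg.inl]
        split_ifs with hp
        · subst hp; field_simp
        · rfl
      · simp only [hg.mid]
      · simp only [hg.inr]
        split_ifs with hp
        · obtain rfl : p = ⟨i.val + 1, h⟩ := Fin.ext hp
          field_simp
        · rfl
    · have h' : i.val + 1 = n := by omega
      have hr : (rootVal i d : ℂ) = d.1 i := by simp [rootVal, h]
      have h1 := (d.1 i).ne_zero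
      rw [vecAct_x_of_last i h', vecAct_x_of_last i h', hr]
      funext a
      rcases a with p | _ | p
      · simp only [hg.inl, hg.mid, hg.inr]
        split_ifs with hp
        · subst hp; field_simp
        · rfl
      · simp only [hg.mid, hg.inr]
        field_simp
      · simp only [hg.inr]
  · intro f
    rw [spinAct_mul, spinAct_mul, spinAct_x, spinAct_x]
    funext s
    simp only [hg.spin, Pi.add_apply, Pi.smul_apply, smul_eq_mul]
    by_cases h : i.val + 1 < n
    · have hij : (⟨i.val + 1, h⟩ : Fin n) ≠ i := by simp [Fin.ext_iff]
      have hr : (rootVal i d : ℂ) = d.1 i * (d.1 ⟨i.val + 1, h⟩ : ℂ)⁻¹ := by simp [rootVal, h]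
      have h2 := (d.1 ⟨i.val + 1, h⟩).ne_zero
      rw [spinE_mulVec_of_lt i h, spinE_mulVec_of_lt i h, hr]
      beta_reduce
      split_ifs with hs
      · rw [hg.spin, prod_update_true _ _ _ (by rw [Function.update_of_ne hij]; exact hs.2),
          prod_update_false _ _ _ hs.1]
        simp only [Units.val_mul]
        field_simp
      · ring
    · have h' : i.val + 1 = n := by omega
      have hr : (rootVal i d : ℂ) = d.1 i := by simp [rootVal, h]
      rw [spinE_mulVec_of_last i h', spinE_mulVec_of_last i h', hr]
      beta_reduce
      split_ifs with hs
      · rw [hg.spin, prod_update_false _ _ _ hs]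
        simp only [Units.val_mul]
        ring
      · ring

theorem IsDiag.mul_y {n : ℕ} {g : G n} {d : (Fin n → ℂˣ) × ℂˣ} (hg : IsDiag g d) (i : Fin n)
    (t : ℂ) : g * y i t = y i ((rootVal i d : ℂ)⁻¹ * t) * g := by
  have hin := i.2
  apply ext_act
  · intro f
    rw [vecAct_mul, vecAct_mul]
    by_cases h : i.val + 1 < n
    · have hr : (rootVal i d : ℂ) = d.1 i * (d.1 ⟨i.val + 1, h⟩ : ℂ)⁻¹ := by simp [rootVal, h]
      have h1 := (d.1 i).ne_zero
      have h2 := (d.1 ⟨i.val + 1, h⟩).ne_zero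
      rw [vecAct_y_of_lt i h, vecAct_y_of_lt i h, hr]
      funext a
      rcases a with p | _ | p
      · simp only [hg.inl]
        split_ifs with hp
        · obtain rfl : p = ⟨i.val + 1, h⟩ := Fin.ext hp
          field_simp
        · rfl
      · simp only [hg.mid]
      · simp only [hg.inr]
        split_ifs with hp
        · subst hp; field_simp
        · rfl
    · have h' : i.val + 1 = n := by omega
      have hr : (rootVal i d : ℂ) = d.1 i := by simp [rootVal, h]
      have h1 := (d.1 i).ne_zero
      rw [vecAct_y_of_last i h', vecAct_y_of_last i h', hr]
      funext a
      rcases a with p | _ | p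
      · simp only [hg.inl]
      · simp only [hg.mid, hg.inl]
        field_simp
      · simp only [hg.inl, hg.mid, hg.inr]
        split_ifs with hp
        · subst hp; field_simp
        · rfl
  · intro f
    rw [spinAct_mul, spinAct_mul, spinAct_y, spinAct_y]
    funext s
    simp only [hg.spin, Pi.add_apply, Pi.smul_apply, smul_eq_mul]
    have h1 := (d.1 i).ne_zero
    by_cases h : i.val + 1 < n
    · have hij : (⟨i.val + 1, h⟩ : Fin n) ≠ i := by simp [Fin.ext_iff]
      have hr : (rootVal i d : ℂ) = d.1 i * (d.1 ⟨i.val + 1, h⟩ : ℂ)⁻¹ := by simp [rootVal, h]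
      have h2 := (d.1 ⟨i.val + 1, h⟩).ne_zero
      rw [spinF_mulVec_of_lt i h, spinF_mulVec_of_lt i h, hr]
      beta_reduce
      split_ifs with hs
      · have h3 := prod_update_false d.1 s ⟨i.val + 1, h⟩ hs.2
        have h4 := prod_update_true d.1 (Function.update s ⟨i.val + 1, h⟩ false) i
          (by rw [Function.update_of_ne hij.symm]; exact hs.1)
        rw [Function.update_comm hij] at h4
        rw [hg.spin, h3, upd2, h4]
        simp only [Units.val_mul]
        field_simp
      · ring
    · have h' : i.val + 1 = n := by omega
      have hr : (rootVal i d : ℂ) = d.1 i := by simp [rootVal, h]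
      rw [spinF_mulVec_of_last i h', spinF_mulVec_of_last i h', hr]
      beta_reduce
      split_ifs with hs
      · rw [hg.spin, prod_update_true _ _ _ hs]
        simp only [Units.val_mul]
        field_simp
      · ring

end TypeB

namespace TypeB

open Matrix

/-! ### The rank one subgroups -/

/-- `x_i(c) y_i(-c⁻¹) x_i(c)`. -/
noncomputable def reflElt {n : ℕ} (i : Fin n) (c : ℂ) : G n := x i c * y i (-c⁻¹) * x i c

theorem sBar_eq_reflElt {n : ℕ} (i : Fin n) : sBar i = reflElt i (-1) := by
  simp [sBar, reflElt]

theorem coroot_eq_reflElt {n : ℕ} (i : Fin n) (c : ℂˣ) :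
    coroot i c = reflElt i c * reflElt i (-1) := by
  rw [← sBar_eq_reflElt]; rfl

theorem vecAct_reflElt_of_lt {n : ℕ} (i : Fin n) (h : i.val + 1 < n) {c : ℂ} (hc : c ≠ 0)
    (f : VecIdx n → ℂ) :
    vecAct (reflElt i c) f = fun a => match a with
      | .inl p => if p = i then c * f (.inl ⟨i.val + 1, h⟩) else
          if p.val = i.val + 1 then -c⁻¹ * f (.inl i) else f (.inl p)
      | .inr (.inl _) => f (.inr (.inl ()))
      | .inr (.inr p) => if p = i then -c⁻¹ * f (.inr (.inr ⟨i.val + 1, h⟩)) else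
          if p.val = i.val + 1 then c * f (.inr (.inr i)) else f (.inr (.inr p)) := by
  have hij : (⟨i.val + 1, h⟩ : Fin n) ≠ i := by simp [Fin.ext_iff]
  simp only [reflElt, vecAct_mul, vecAct_x_of_lt i h, vecAct_y_of_lt i h]
  funext a
  rcases a with p | _ | p
  · by_cases hp : p = i
    · subst hp
      simp [hij]
      field_simp
      ring
    · by_cases hp' : p.val = i.val + 1
      · obtain rfl : p = ⟨i.val + 1, h⟩ := Fin.ext hp'
        simp [hij]
        field_simp
        ring
      · simp [hp, hp']
  · rfl
  · by_cases hp : p = i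
    · subst hp
      simp
      field_simp
      ring
    · by_cases hp' : p.val = i.val + 1
      · obtain rfl : p = ⟨i.val + 1, h⟩ := Fin.ext hp'
        simp [hij]
        field_simp
        ring
      · simp [hp, hp']

theorem vecAct_reflElt_of_last {n : ℕ} (i : Fin n) (h : i.val + 1 = n) {c : ℂ} (hc : c ≠ 0)
    (f : VecIdx n → ℂ) :
    vecAct (reflElt i c) f = fun a => match a with
      | .inl p => if p = i then c ^ 2 * f (.inr (.inr i)) else f (.inl p)
      | .inr (.inl _) => -f (.inr (.inl ()))
      | .inr (.inr p) => if p = i then (c ^ 2)⁻¹ * f (.inl i) else f (.inr (.inr p)) := by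
  simp only [reflElt, vecAct_mul, vecAct_x_of_last i h, vecAct_y_of_last i h]
  funext a
  rcases a with p | _ | p
  · by_cases hp : p = i
    · subst hp
      simp
      field_simp
      ring
    · simp [hp]
  · simp
    field_simp
    ring
  · by_cases hp : p = i
    · subst hp
      simp
      field_simp
      ring
    · simp [hp]

theorem spinAct_x_of_lt {n : ℕ} (i : Fin n) (h : i.val + 1 < n) (t : ℂ) (f : SpinIdx n → ℂ)
    (s : SpinIdx n) : spinAct (x i t) f s = if s i = true ∧ s ⟨i.val + 1, h⟩ = false then
      f s + t * f (upd2 s i ⟨i.val + 1, h⟩ false true) else f s := by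
  rw [spinAct_x, spinE_mulVec_of_lt i h]
  simp only [Pi.add_apply, Pi.smul_apply, smul_eq_mul]
  split_ifs <;> simp

theorem spinAct_y_of_lt {n : ℕ} (i : Fin n) (h : i.val + 1 < n) (t : ℂ) (f : SpinIdx n → ℂ)
    (s : SpinIdx n) : spinAct (y i t) f s = if s i = false ∧ s ⟨i.val + 1, h⟩ = true then
      f s + t * f (upd2 s i ⟨i.val + 1, h⟩ true false) else f s := by
  rw [spinAct_y, spinF_mulVec_of_lt i h]
  simp only [Pi.add_apply, Pi.smul_apply, smul_eq_mul]
  split_ifs <;> simp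

theorem spinAct_x_of_last {n : ℕ} (i : Fin n) (h : i.val + 1 = n) (t : ℂ) (f : SpinIdx n → ℂ)
    (s : SpinIdx n) : spinAct (x i t) f s = if s i = true then
      f s + t * f (Function.update s i false) else f s := by
  rw [spinAct_x, spinE_mulVec_of_last i h]
  simp only [Pi.add_apply, Pi.smul_apply, smul_eq_mul]
  split_ifs <;> simp

theorem spinAct_y_of_last {n : ℕ} (i : Fin n) (h : i.val + 1 = n) (t : ℂ) (f : SpinIdx n → ℂ)
    (s : SpinIdx n) : spinAct (y i t) f s = if s i = false then
      f s + t * f (Function.update s i true) else f s := by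
  rw [spinAct_y, spinF_mulVec_of_last i h]
  simp only [Pi.add_apply, Pi.smul_apply, smul_eq_mul]
  split_ifs <;> simp

theorem upd2_self {n : ℕ} {i j : Fin n} {s : SpinIdx n} {a b : Bool} (hi : s i = a) (hj : s j = b) :
    upd2 s i j a b = s := by
  simp [upd2, ← hi, ← hj]

theorem update_eq_self_of_eq {n : ℕ} {i : Fin n} {s : SpinIdx n} {a : Bool} (hi : s i = a) :
    Function.update s i a = s := by
  simp [← hi]

theorem upd2_upd2 {n : ℕ} {i j : Fin n} (hij : i ≠ j) (s : SpinIdx n) (a b a' b' : Bool) :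
    upd2 (upd2 s i j a b) i j a' b' = upd2 s i j a' b' := by
  simp only [upd2]
  rw [show Function.update (Function.update (Function.update s i a) j b) i a' =
    Function.update (Function.update (Function.update s i a) i a') j b from
      Function.update_comm hij.symm _ _ _, Function.update_idem, Function.update_idem]

theorem upd2_fst {n : ℕ} {i j : Fin n} (hij : i ≠ j) (s : SpinIdx n) (a b : Bool) :
    upd2 s i j a b i = a := by
  simp [upd2, hij]

theorem upd2_snd {n : ℕ} (i j : Fin n) (s : SpinIdx n) (a b : Bool) :
    upd2 s i j a b j = b := by
  simp [upd2]

theorem spinAct_reflElt_of_lt {n : ℕ} (i : Fin n) (h : i.val + 1 < n) {c : ℂ} (hc : c ≠ 0)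
    (f : SpinIdx n → ℂ) (s : SpinIdx n) :
    spinAct (reflElt i c) f s = if s i = true ∧ s ⟨i.val + 1, h⟩ = false then
        c * f (upd2 s i ⟨i.val + 1, h⟩ false true)
      else if s i = false ∧ s ⟨i.val + 1, h⟩ = true then
        -c⁻¹ * f (upd2 s i ⟨i.val + 1, h⟩ true false) else f s := by
  have hij : i ≠ ⟨i.val + 1, h⟩ := by simp [Fin.ext_iff]
  simp only [reflElt, spinAct_mul, spinAct_x_of_lt i h, spinAct_y_of_lt i h, upd2_fst hij, upd2_snd,
    upd2_upd2 hij]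
  cases h1 : s i <;> cases h2 : s ⟨i.val + 1, h⟩ <;> simp [upd2_self h1 h2] <;> field_simp <;> ring

theorem spinAct_reflElt_of_last {n : ℕ} (i : Fin n) (h : i.val + 1 = n) {c : ℂ} (hc : c ≠ 0)
    (f : SpinIdx n → ℂ) (s : SpinIdx n) :
    spinAct (reflElt i c) f s = if s i = true then c * f (Function.update s i false)
      else -c⁻¹ * f (Function.update s i true) := by
  simp only [reflElt, spinAct_mul, spinAct_x_of_last i h, spinAct_y_of_last i h,
    Function.update_self, Function.update_idem]
  cases h1 : s i <;> simp [update_eq_self_of_eq h1] <;> field_simp <;> ring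

/-- The eigenvalues of the diagonal element `α_i^∨(c)`. -/
def cochar {n : ℕ} (i : Fin n) : ℂˣ →* (Fin n → ℂˣ) × ℂˣ where
  toFun c := if h : i.val + 1 < n then
      (Pi.mulSingle i c * Pi.mulSingle ⟨i.val + 1, h⟩ c⁻¹, 1) else (Pi.mulSingle i (c ^ 2), c⁻¹)
  map_one' := by split_ifs <;> simp
  map_mul' c d := by
    split_ifs
    · ext1
      · simp only [Prod.fst_mul, Pi.mulSingle_mul, mul_inv]
        exact mul_mul_mul_comm _ _ _ _
      · simp
    · ext1
      · simp only [Prod.fst_mul, ← Pi.mulSingle_mul, mul_pow]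
      · simp [mul_comm]

theorem cochar_of_lt {n : ℕ} (i : Fin n) (h : i.val + 1 < n) (c : ℂˣ) :
    cochar i c = (Pi.mulSingle i c * Pi.mulSingle ⟨i.val + 1, h⟩ c⁻¹, 1) := by
  simp [cochar, h]

/-- The short root is where the two representations differ: `α_n^∨(c)` has eigenvalue `c ^ 2` at
`v_n`, but on a spin vector `c` or `c⁻¹`. The second component `c⁻¹` makes the product over plus
signs come out so. -/
theorem cochar_of_last {n : ℕ} (i : Fin n) (h : i.val + 1 = n) (c : ℂˣ) :
    cochar i c = (Pi.mulSingle i (c ^ 2), c⁻¹) := by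
  simp [cochar, h]

theorem prod_ite_mulSingle {n : ℕ} (s : SpinIdx n) (i : Fin n) (c : ℂˣ) :
    (∏ p, if s p = true then (Pi.mulSingle i c : Fin n → ℂˣ) p else 1) =
      if s i = true then c else 1 := by
  rw [Finset.prod_eq_single i]
  · simp
  · intro p _ hp
    simp [hp]
  · simp

theorem isDiag_coroot {n : ℕ} (i : Fin n) (c : ℂˣ) : IsDiag (coroot i c) (cochar i c) := by
  have hin := i.2
  have hc := c.ne_zero
  have h1 : (-1 : ℂ) ≠ 0 := by norm_num
  rw [coroot_eq_reflElt]
  by_cases h : i.val + 1 < n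
  · have hij : i ≠ ⟨i.val + 1, h⟩ := by simp [Fin.ext_iff]
    rw [cochar_of_lt i h]
    constructor
    · intro f p
      rw [vecAct_mul, vecAct_reflElt_of_lt i h hc, vecAct_reflElt_of_lt i h h1]
      by_cases hp : p = i
      · subst hp
        simp [hij, hij.symm]
      · by_cases hp' : p.val = i.val + 1
        · obtain rfl : p = ⟨i.val + 1, h⟩ := Fin.ext hp'
          simp [hij.symm]
        · have hp'' : p ≠ ⟨i.val + 1, h⟩ := fun e => hp' (congrArg Fin.val e)
          simp [hp, hp', hp'']
    · intro f
      rw [vecAct_mul, vecAct_reflElt_of_lt i h hc, vecAct_reflElt_of_lt i h h1]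
    · intro f p
      rw [vecAct_mul, vecAct_reflElt_of_lt i h hc, vecAct_reflElt_of_lt i h h1]
      by_cases hp : p = i
      · subst hp
        simp [hij, hij.symm]
      · by_cases hp' : p.val = i.val + 1
        · obtain rfl : p = ⟨i.val + 1, h⟩ := Fin.ext hp'
          simp [hij.symm]
        · have hp'' : p ≠ ⟨i.val + 1, h⟩ := fun e => hp' (congrArg Fin.val e)
          simp [hp, hp', hp'']
    · intro f s
      have key : (∏ p, if s p = true then
          (Pi.mulSingle i c * Pi.mulSingle ⟨i.val + 1, h⟩ c⁻¹ : Fin n → ℂˣ) p else 1) =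
          (if s i = true then c else 1) * (if s ⟨i.val + 1, h⟩ = true then c⁻¹ else 1) := by
        rw [← prod_ite_mulSingle, ← prod_ite_mulSingle, ← Finset.prod_mul_distrib]
        refine Finset.prod_congr rfl fun p _ => ?_
        split_ifs <;> simp
      simp only [spinAct_mul, spinAct_reflElt_of_lt i h hc, spinAct_reflElt_of_lt i h h1,
        upd2_fst hij, upd2_snd, upd2_upd2 hij, key]
      cases h1 : s i <;> cases h2 : s ⟨i.val + 1, h⟩ <;> simp [upd2_self h1 h2]
  · have h' : i.val + 1 = n := by omega
    rw [cochar_of_last i h']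
    constructor
    · intro f p
      rw [vecAct_mul, vecAct_reflElt_of_last i h' hc, vecAct_reflElt_of_last i h' h1]
      by_cases hp : p = i
      · subst hp
        simp
      · simp [hp]
    · intro f
      rw [vecAct_mul, vecAct_reflElt_of_last i h' hc, vecAct_reflElt_of_last i h' h1]
      simp
    · intro f p
      rw [vecAct_mul, vecAct_reflElt_of_last i h' hc, vecAct_reflElt_of_last i h' h1]
      by_cases hp : p = i
      · subst hp
        simp
      · simp [hp]
    · intro f s
      simp only [spinAct_mul, spinAct_reflElt_of_last i h' hc, spinAct_reflElt_of_last i h' h1,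
        Function.update_self, Function.update_idem, prod_ite_mulSingle]
      cases h1 : s i <;> simp [update_eq_self_of_eq h1]
      field_simp
      simp

/-! ### One-parameter subgroups and the factorization of `x_i(t) y_i(s)` -/

theorem coroot_one {n : ℕ} (i : Fin n) : coroot i 1 = 1 :=
  (isDiag_coroot i 1).unique (by rw [map_one]; exact IsDiag.one)

theorem x_add {n : ℕ} (i : Fin n) (s t : ℂ) : x i (s + t) = x i s * x i t := by
  apply Subtype.ext
  apply Prod.ext <;> apply Units.ext
  · change NormedSpace.exp ((s + t) • vecE i) = _
    rw [add_smul, Matrix.exp_add_of_commute _ _ (((Commute.refl _).smul_left _).smul_right _)]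
    rfl
  · change NormedSpace.exp ((s + t) • spinE i) = _
    rw [add_smul, Matrix.exp_add_of_commute _ _ (((Commute.refl _).smul_left _).smul_right _)]
    rfl

theorem y_add {n : ℕ} (i : Fin n) (s t : ℂ) : y i (s + t) = y i s * y i t := by
  apply Subtype.ext
  apply Prod.ext <;> apply Units.ext
  · change NormedSpace.exp ((s + t) • vecF i) = _
    rw [add_smul, Matrix.exp_add_of_commute _ _ (((Commute.refl _).smul_left _).smul_right _)]
    rfl
  · change NormedSpace.exp ((s + t) • spinF i) = _
    rw [add_smul, Matrix.exp_add_of_commute _ _ (((Commute.refl _).smul_left _).smul_right _)]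
    rfl

theorem x_zero {n : ℕ} (i : Fin n) : x i 0 = 1 := by
  have := x_add i 0 0
  rwa [add_zero, left_eq_mul] at this

theorem y_zero {n : ℕ} (i : Fin n) : y i 0 = 1 := by
  have := y_add i 0 0
  rwa [add_zero, left_eq_mul] at this

theorem x_inv {n : ℕ} (i : Fin n) (t : ℂ) : (x i t)⁻¹ = x i (-t) := by
  rw [inv_eq_iff_mul_eq_one, ← x_add, add_neg_cancel, x_zero]

theorem y_inv {n : ℕ} (i : Fin n) (t : ℂ) : (y i t)⁻¹ = y i (-t) := by
  rw [inv_eq_iff_mul_eq_one, ← y_add, add_neg_cancel, y_zero]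

theorem sBar_inv {n : ℕ} (i : Fin n) : (sBar i)⁻¹ = reflElt i 1 := by
  simp [sBar, reflElt, x_inv, y_inv, mul_assoc]

/-- This is the lower-diagonal-upper factorization in `SL_2`, valid where the corner entry `1 + t *
s` is nonzero. -/
theorem x_mul_y {n : ℕ} (i : Fin n) (s t : ℂ) (u : ℂˣ) (hu : (u : ℂ) = 1 + t * s) :
    x i t * y i s = y i (s / u) * coroot i u * x i (t / u) := by
  have hin := i.2
  have hc := u.ne_zero
  have hd := isDiag_coroot i u
  apply ext_act
  · intro f
    simp only [vecAct_mul]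
    by_cases h : i.val + 1 < n
    · have hij : i ≠ ⟨i.val + 1, h⟩ := by simp [Fin.ext_iff]
      rw [cochar_of_lt i h] at hd
      simp only [vecAct_x_of_lt i h, vecAct_y_of_lt i h]
      funext a
      rcases a with p | _ | p
      · simp only [hd.inl]
        by_cases hp : p = i
        · subst hp
          simp [hij]
          field_simp
          rw [hu]
          ring
        · by_cases hp' : p.val = i.val + 1
          · obtain rfl : p = ⟨i.val + 1, h⟩ := Fin.ext hp'
            simp [hij, hij.symm]
            field_simp
            rw [hu]
            ring
          · have hp'' : p ≠ ⟨i.val + 1, h⟩ := fun e => hp' (congrArg Fin.val e)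
            simp [hp, hp', hp'']
      · simp only [hd.mid]
      · simp only [hd.inr]
        by_cases hp : p = i
        · subst hp
          simp [hij]
          field_simp
          rw [hu]
          ring
        · by_cases hp' : p.val = i.val + 1
          · obtain rfl : p = ⟨i.val + 1, h⟩ := Fin.ext hp'
            simp [hij.symm]
            field_simp
            rw [hu]
            ring
          · have hp'' : p ≠ ⟨i.val + 1, h⟩ := fun e => hp' (congrArg Fin.val e)
            simp [hp, hp', hp'']
    · have h' : i.val + 1 = n := by omega
      rw [cochar_of_last i h'] at hd
      simp only [vecAct_x_of_last i h', vecAct_y_of_last i h']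
      funext a
      rcases a with p | _ | p
      · simp only [hd.inl]
        by_cases hp : p = i
        · subst hp
          simp
          field_simp
          rw [hu]
          ring
        · simp [hp]
      · simp only [hd.mid, hd.inl]
        simp
        field_simp
        rw [hu]
        ring
      · simp only [hd.inr, hd.inl, hd.mid]
        by_cases hp : p = i
        · subst hp
          simp
          field_simp
          rw [hu]
          ring
        · simp [hp]
  · intro f
    funext s'
    simp only [spinAct_mul]
    by_cases h : i.val + 1 < n
    · have hij : i ≠ ⟨i.val + 1, h⟩ := by simp [Fin.ext_iff]
      have key : ∀ s : SpinIdx n, (∏ p, if s p = true then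
          (Pi.mulSingle i u * Pi.mulSingle ⟨i.val + 1, h⟩ u⁻¹ : Fin n → ℂˣ) p else 1) =
          (if s i = true then u else 1) * (if s ⟨i.val + 1, h⟩ = true then u⁻¹ else 1) := by
        intro s
        rw [← prod_ite_mulSingle, ← prod_ite_mulSingle, ← Finset.prod_mul_distrib]
        refine Finset.prod_congr rfl fun p _ => ?_
        split_ifs <;> simp
      rw [cochar_of_lt i h] at hd
      simp only [spinAct_x_of_lt i h, spinAct_y_of_lt i h, hd.spin, key, upd2_fst hij, upd2_snd,
        upd2_upd2 hij]
      cases h1 : s' i <;> cases h2 : s' ⟨i.val + 1, h⟩ <;> simp [upd2_self h1 h2] <;> field_simp <;>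
        rw [hu] <;> ring
    · have h' : i.val + 1 = n := by omega
      rw [cochar_of_last i h'] at hd
      simp only [spinAct_x_of_last i h', spinAct_y_of_last i h', hd.spin, prod_ite_mulSingle,
        Function.update_self, Function.update_idem]
      cases h1 : s' i <;> simp [update_eq_self_of_eq h1] <;> field_simp <;>
        rw [hu] <;> ring

end TypeB

/-! ### Density of the open cell and uniqueness of the principal minors -/

namespace TypeB

open Matrix

/-! ### The torus -/

theorem isDiag_torus {n : ℕ} (a : Fin n → ℂˣ) : IsDiag (torus a) (∏ i, cochar i (a i)) := by
  rw [torus, ← List.prod_ofFn]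
  have : ∀ l : List (Fin n), IsDiag (l.map fun i => coroot i (a i)).prod
      (l.map fun i => cochar i (a i)).prod := by
    intro l
    induction l with
    | nil => simpa using IsDiag.one
    | cons i l ih => simpa using (isDiag_coroot i (a i)).mul ih
  rw [List.ofFn_eq_map, List.ofFn_eq_map]
  exact this _

theorem torus_mul_coroot {n : ℕ} (a : Fin n → ℂˣ) (i : Fin n) (c : ℂˣ) :
    torus a * coroot i c = torus (a * Pi.mulSingle i c) := by
  refine ((isDiag_torus a).mul (isDiag_coroot i c)).unique ?_
  have : (∏ j, cochar j ((a * Pi.mulSingle i c : Fin n → ℂˣ) j)) = (∏ j, cochar j (a j)) * cochar i c := by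
    simp only [Pi.mul_apply, map_mul, Finset.prod_mul_distrib]
    congr 1
    rw [Finset.prod_eq_single i]
    · simp
    · intro j _ hj
      simp [hj]
    · simp
  rw [← this]
  exact isDiag_torus _

/-! ### The big cell -/

/-- The open cell `U⁻ T U`. -/
def bigCell (n : ℕ) : Set (G n) :=
  {g | ∃ u ∈ UMinus n, ∃ a : Fin n → ℂˣ, ∃ v ∈ UPlus n, g = u * torus a * v}

theorem x_mem_UPlus {n : ℕ} (i : Fin n) (t : ℂ) : x i t ∈ UPlus n :=
  Subgroup.subset_closure ⟨i, t, rfl⟩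

theorem y_mem_UMinus {n : ℕ} (i : Fin n) (t : ℂ) : y i t ∈ UMinus n :=
  Subgroup.subset_closure ⟨i, t, rfl⟩

theorem one_mem_bigCell {n : ℕ} : (1 : G n) ∈ bigCell n := by
  refine ⟨1, one_mem _, 1, 1, one_mem _, ?_⟩
  have : torus (1 : Fin n → ℂˣ) = 1 :=
    (isDiag_torus 1).unique (by simpa using IsDiag.one)
  simp [this]

/-- Induction on `v`: a new left factor `x_j` commutes with `y_i` if `j ≠ i`, and is absorbed by
`x_mul_y` if `j = i`. The map `φ` is a composite of fractional linear maps; its injectivity is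
carried along only to bound the set of bad parameters. -/
theorem UPlus_mul_y {n : ℕ} (i : Fin n) {v : G n} (hv : v ∈ UPlus n) :
    ∃ B : Set ℂ, B.Finite ∧ ∃ φ : ℂ → ℂ, Set.InjOn φ Bᶜ ∧ ∀ s ∉ B, ∃ (c : ℂˣ) (v' : G n),
      v' ∈ UPlus n ∧ v * y i s = y i (φ s) * coroot i c * v' := by
  have step : ∀ (j : Fin n) (t : ℂ) (v : G n),
      (∃ B : Set ℂ, B.Finite ∧ ∃ φ : ℂ → ℂ, Set.InjOn φ Bᶜ ∧ ∀ s ∉ B, ∃ (c : ℂˣ) (v' : G n),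
        v' ∈ UPlus n ∧ v * y i s = y i (φ s) * coroot i c * v') →
      (∃ B : Set ℂ, B.Finite ∧ ∃ φ : ℂ → ℂ, Set.InjOn φ Bᶜ ∧ ∀ s ∉ B, ∃ (c : ℂˣ) (v' : G n),
        v' ∈ UPlus n ∧ (x j t * v) * y i s = y i (φ s) * coroot i c * v') := by
    rintro j t v ⟨B, hB, φ, hφ, H⟩
    have hconj : ∀ (c : ℂˣ) (t : ℂ), x j t * coroot i c =
        coroot i c * x j ((rootVal j (cochar i c) : ℂ)⁻¹ * t) := by
      intro c t
      rw [(isDiag_coroot i c).mul_x, mul_inv_cancel_left₀ (Units.ne_zero _)]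
    by_cases hij : i = j
    · subst hij
      -- The factorization of `x_i(t) y_i(φ s)` fails where `1 + t * φ s = 0`. As `φ` is injective
      -- off `B`, that excludes at most one further parameter.
      refine ⟨B ∪ {s | s ∉ B ∧ 1 + t * φ s = 0}, hB.union ?_, fun s => φ s / (1 + t * φ s), ?_, ?_⟩
      · apply Set.Subsingleton.finite
        rintro s ⟨hs, hs'⟩ r ⟨hr, hr'⟩
        apply hφ hs hr
        have ht : t ≠ 0 := by rintro rfl; simp at hs'
        exact mul_left_cancel₀ ht (add_left_cancel (hs'.trans hr'.symm))
      · intro s hs r hr h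
        simp only [Set.mem_compl_iff, Set.mem_union, Set.mem_ofPred_eq, not_or, not_and] at hs hr
        apply hφ hs.1 hr.1
        have h1 := hs.2 hs.1
        have h2 := hr.2 hr.1
        beta_reduce at h
        rw [div_eq_div_iff h1 h2] at h
        linear_combination h
      · intro s hs
        simp only [Set.mem_union, Set.mem_ofPred_eq, not_or, not_and] at hs
        obtain ⟨c, v', hv', e⟩ := H s hs.1
        have hu := hs.2 hs.1
        refine ⟨Units.mk0 _ hu * c, x i ((rootVal i (cochar i c) : ℂ)⁻¹ *
          (t / (1 + t * φ s))) * v', mul_mem (x_mem_UPlus _ _) hv', ?_⟩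
        have hcc : coroot i (Units.mk0 _ hu * c) = coroot i (Units.mk0 _ hu) * coroot i c :=
          (isDiag_coroot i _).unique (by
            rw [map_mul]; exact (isDiag_coroot i _).mul (isDiag_coroot i _))
        rw [mul_assoc, e, hcc]
        have := x_mul_y i (φ s) t (Units.mk0 _ hu) rfl
        simp only [Units.val_mk0] at this
        rw [← mul_assoc, ← mul_assoc, this, mul_assoc _ _ (coroot i c), hconj]
        simp only [mul_assoc]
    · refine ⟨B, hB, φ, hφ, fun s hs => ?_⟩
      obtain ⟨c, v', hv', e⟩ := H s hs
      refine ⟨c, x j ((rootVal j (cochar i c) : ℂ)⁻¹ * t) * v', mul_mem (x_mem_UPlus _ _) hv', ?_⟩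
      rw [mul_assoc, e, ← mul_assoc, ← mul_assoc, x_mul_y_of_ne hij, mul_assoc _ _ (coroot i c),
        hconj]
      simp only [mul_assoc]
  induction hv using Subgroup.closure_induction_left with
  | one =>
    exact ⟨∅, Set.finite_empty, id, Set.injOn_id _, fun s _ =>
      ⟨1, 1, one_mem _, by simp [coroot_one]⟩⟩
  | mul_left g hg v hv ih =>
    obtain ⟨j, t, rfl⟩ := hg
    exact step j t v ih
  | inv_mul_cancel g hg v hv ih =>
    obtain ⟨j, t, rfl⟩ := hg
    rw [x_inv]
    exact step j (-t) v ih

theorem bigCell_mul_x {n : ℕ} {g : G n} (hg : g ∈ bigCell n) (i : Fin n) (t : ℂ) :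
    g * x i t ∈ bigCell n := by
  obtain ⟨u, hu, a, v, hv, rfl⟩ := hg
  exact ⟨u, hu, a, v * x i t, mul_mem hv (x_mem_UPlus i t), by simp only [mul_assoc]⟩

theorem bigCell_mul_y {n : ℕ} {g : G n} (hg : g ∈ bigCell n) (i : Fin n) :
    {s : ℂ | g * y i s ∉ bigCell n}.Finite := by
  obtain ⟨u, hu, a, v, hv, rfl⟩ := hg
  obtain ⟨B, hB, φ, -, H⟩ := UPlus_mul_y i hv
  refine hB.subset fun s hs => ?_
  by_contra hsB
  apply hs
  obtain ⟨c, v', hv', e⟩ := H s hsB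
  refine ⟨u * y i ((rootVal i (∏ i, cochar i (a i)) : ℂ)⁻¹ * φ s),
    mul_mem hu (y_mem_UMinus _ _), a * Pi.mulSingle i c, v', hv', ?_⟩
  rw [← torus_mul_coroot a i c, mul_assoc (u * torus a), e]
  simp only [← mul_assoc]
  rw [mul_assoc u (torus a), (isDiag_torus a).mul_y]
  simp only [mul_assoc]

/-! ### Regular functions -/

theorem IsRegular.mul_right {n : ℕ} {F : G n → ℂ} (hF : IsRegular F) (h : G n) :
    IsRegular fun g => F (g * h) := by
  obtain ⟨p, hp⟩ := hF
  refine ⟨MvPolynomial.bind₁ (fun ι => match ι with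
    | .inl ab => ∑ c, MvPolynomial.X (.inl (ab.1, c)) *
        MvPolynomial.C ((h.1.1 : Matrix (VecIdx n) (VecIdx n) ℂ) c ab.2)
    | .inr ab => ∑ c, MvPolynomial.X (.inr (ab.1, c)) *
        MvPolynomial.C ((h.1.2 : Matrix (SpinIdx n) (SpinIdx n) ℂ) c ab.2)) p, fun g => ?_⟩
  beta_reduce
  rw [hp, ← MvPolynomial.coe_aeval_eq_eval, ← MvPolynomial.coe_aeval_eq_eval, RingHom.coe_coe,
    RingHom.coe_coe, MvPolynomial.aeval_bind₁]
  congr 1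
  congr 1
  funext ι
  rcases ι with ab | ab
  · simp [coords, Matrix.mul_apply]
  · simp [coords, Matrix.mul_apply]

theorem IsRegular.sub {n : ℕ} {E F : G n → ℂ} (hE : IsRegular E) (hF : IsRegular F) :
    IsRegular fun g => E g - F g := by
  obtain ⟨p, hp⟩ := hE
  obtain ⟨q, hq⟩ := hF
  exact ⟨p - q, fun g => by simp [hp, hq]⟩

/-- The cube of `f_i` is zero in both representations, so the entries of `exp(s f_i)` are
polynomials of degree at most two in `s`. -/
theorem exists_polynomial_mul_y {n : ℕ} {F : G n → ℂ} (hF : IsRegular F) (g : G n) (i : Fin n) :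
    ∃ q : Polynomial ℂ, ∀ s, F (g * y i s) = q.eval s := by
  obtain ⟨p, hp⟩ := hF
  have hcoord : ∀ ι, ∃ q : Polynomial ℂ, ∀ s, coords (g * y i s) ι = q.eval s := by
    rintro (ab | ab)
    · refine ⟨.C (((g.1.1 : Matrix (VecIdx n) (VecIdx n) ℂ)) ab.1 ab.2) +
        .C (((g.1.1 : Matrix (VecIdx n) (VecIdx n) ℂ) * vecF i) ab.1 ab.2) * .X +
        .C (((g.1.1 : Matrix (VecIdx n) (VecIdx n) ℂ) * vecF i ^ 2) ab.1 ab.2 / 2) * .X ^ 2,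
        fun s => ?_⟩
      have h3 : (vecF i) ^ 3 = 0 := by
        apply Matrix.mulVec_injective
        funext f
        simpa [pow_succ, Matrix.mulVec_mulVec, mul_assoc] using vecF_mulVec_cube i f
      change ((g.1.1 : Matrix (VecIdx n) (VecIdx n) ℂ) * NormedSpace.exp (s • vecF i)) ab.1 ab.2 = _
      rw [exp_smul_of_cube_eq_zero h3]
      simp [mul_add]
      ring
    · refine ⟨.C (((g.1.2 : Matrix (SpinIdx n) (SpinIdx n) ℂ)) ab.1 ab.2) +
        .C (((g.1.2 : Matrix (SpinIdx n) (SpinIdx n) ℂ) * spinF i) ab.1 ab.2) * .X +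
        .C (((g.1.2 : Matrix (SpinIdx n) (SpinIdx n) ℂ) * spinF i ^ 2) ab.1 ab.2 / 2) * .X ^ 2,
        fun s => ?_⟩
      have h3 : (spinF i) ^ 3 = 0 := by
        apply Matrix.mulVec_injective
        funext f
        have := spinF_mulVec_sq i (spinF i *ᵥ f)
        simpa [pow_succ, Matrix.mulVec_mulVec, mul_assoc] using this
      change ((g.1.2 : Matrix (SpinIdx n) (SpinIdx n) ℂ) * NormedSpace.exp (s • spinF i)) ab.1 ab.2
        = _
      rw [exp_smul_of_cube_eq_zero h3]
      simp [mul_add]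
      ring
  choose q hq using hcoord
  refine ⟨MvPolynomial.aeval q p, fun s => ?_⟩
  rw [hp, ← Polynomial.coe_aeval_eq_eval, ← MvPolynomial.coe_aeval_eq_eval, RingHom.coe_coe]
  have := MvPolynomial.comp_aeval_apply q (Polynomial.aeval (R := ℂ) s) p
  rw [this]
  congr 1
  congr 1
  funext ι
  simp [hq]

/-- Vanishing on the cell survives right translation of the function by generators. For `x_i(t)` the
cell itself is stable. For `y_i(t)` the function is a polynomial in the parameter, and all but
finitely many parameters stay in the cell, so the polynomial is zero. -/
theorem eq_zero_of_bigCell {n : ℕ} (g : G n) : ∀ {F : G n → ℂ}, IsRegular F →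
    (∀ h ∈ bigCell n, F h = 0) → F g = 0 := by
  have hx : ∀ {F : G n → ℂ}, (∀ h ∈ bigCell n, F h = 0) → ∀ i t, ∀ h ∈ bigCell n,
      F (h * x i t) = 0 := fun hF i t h hh => hF _ (bigCell_mul_x hh i t)
  have hy : ∀ {F : G n → ℂ}, IsRegular F → (∀ h ∈ bigCell n, F h = 0) → ∀ i t, ∀ h ∈ bigCell n,
      F (h * y i t) = 0 := by
    intro F hr hF i t h hh
    obtain ⟨q, hq⟩ := exists_polynomial_mul_y hr h i
    have : q = 0 := by
      apply Polynomial.eq_zero_of_infinite_isRoot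
      refine ((bigCell_mul_y hh i).infinite_compl).mono fun s hs => ?_
      rw [Set.mem_compl_iff, Set.mem_ofPred_eq, not_not] at hs
      rw [Set.mem_ofPred_eq, Polynomial.IsRoot, ← hq]
      exact hF _ hs
    rw [hq, this, Polynomial.eval_zero]
  -- The function must remain universally quantified, since the induction over the generators of `g`
  -- replaces it by its translates.
  suffices H : ∀ {F : G n → ℂ}, IsRegular F → (∀ h ∈ bigCell n, F h = 0) →
      ∀ h ∈ bigCell n, F (h * g) = 0 by
    intro F hr hF
    simpa using H hr hF 1 one_mem_bigCell
  obtain ⟨g, hg⟩ := g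
  induction hg using Subgroup.closure_induction_right with
  | one =>
    intro F _ hF h hh
    have := hF h hh
    rwa [← mul_one h] at this
  | mul_right g hg k hk ih =>
    intro F hr hF h hh
    obtain ⟨i, t, rfl | rfl⟩ := hk
    · have := ih (hr.mul_right (x i t)) (hx hF i t) h hh
      rwa [mul_assoc] at this
    · have := ih (hr.mul_right (y i t)) (hy hr hF i t) h hh
      rwa [mul_assoc] at this
  | mul_inv_cancel g hg k hk ih =>
    intro F hr hF h hh
    obtain ⟨i, t, rfl | rfl⟩ := hk
    · have := ih (hr.mul_right (x i t)⁻¹) (by rw [x_inv]; exact hx hF i _) h hh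
      rwa [mul_assoc] at this
    · have := ih (hr.mul_right (y i t)⁻¹) (by rw [y_inv]; exact hy hr hF i _) h hh
      rwa [mul_assoc] at this

/-- The difference of two candidates is regular and vanishes on the open cell, so the choice made in
`principalMinor` is immaterial. -/
theorem principalMinor_eq {n : ℕ} {μ : Weight n} {F : G n → ℂ} (hF : IsPrincipalMinor μ F) :
    principalMinor μ = F := by
  have h : ∃ F : G n → ℂ, IsPrincipalMinor μ F := ⟨F, hF⟩
  rw [principalMinor, dif_pos h]
  funext g
  rw [← sub_eq_zero]
  refine eq_zero_of_bigCell (F := fun g => h.choose g - F g) g (h.choose_spec.1.sub hF.1) ?_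
  rintro _ ⟨u, hu, a, v, hv, rfl⟩
  rw [h.choose_spec.2 u hu a v hv, hF.2 u hu a v hv, sub_self]

end TypeB

namespace TypeB

open Matrix

/-! ### The principal minors of the fundamental weights -/

theorem vecAct_add {n : ℕ} (g : G n) (f f' : VecIdx n → ℂ) :
    vecAct g (f + f') = vecAct g f + vecAct g f' := Matrix.mulVec_add _ _ _

theorem vecAct_smul {n : ℕ} (g : G n) (t : ℂ) (f : VecIdx n → ℂ) :
    vecAct g (t • f) = t • vecAct g f := Matrix.mulVec_smul _ _ _

/-- The inclusion of the first `i + 1` indices. -/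
abbrev lead {n : ℕ} (i : Fin n) (j : Fin (i.val + 1)) : Fin n := ⟨j.val, by omega⟩

/-- The entry of `g` on the vector representation at `(v_p, v_q)`. -/
noncomputable def vecEntry {n : ℕ} (g : G n) (p q : Fin n) : ℂ :=
  vecAct g (Pi.single (.inl q) 1) (.inl p)

/-- The leading minor of size `i + 1` of the vector representation. -/
noncomputable def leadingMinor {n : ℕ} (i : Fin n) (g : G n) : ℂ :=
  Matrix.det (Matrix.of fun p q : Fin (i.val + 1) => vecEntry g (lead i p) (lead i q))

/-- The diagonal entry of the spin representation at the highest weight. -/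
noncomputable def spinCorner {n : ℕ} (g : G n) : ℂ :=
  spinAct g (Pi.single (fun _ => true) 1) fun _ => true

theorem isRegular_leadingMinor {n : ℕ} (i : Fin n) : IsRegular (leadingMinor i) := by
  refine ⟨Matrix.det (Matrix.of fun p q : Fin (i.val + 1) =>
    MvPolynomial.X (.inl (.inl (lead i p), .inl (lead i q)))), fun g => ?_⟩
  rw [RingHom.map_det, leadingMinor]
  congr 1
  funext p q
  simp [vecEntry, vecAct_single, coords]

theorem isRegular_spinCorner {n : ℕ} : IsRegular (spinCorner (n := n)) := by
  refine ⟨MvPolynomial.X (.inr (fun _ => true, fun _ => true)), fun g => ?_⟩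
  simp [spinCorner, spinAct_single, coords]

theorem vecEntry_y_mul {n : ℕ} (i : Fin n) (t : ℂ) (g : G n) (p q : Fin n) :
    vecEntry (y i t * g) p q = if p.val = i.val + 1 then vecEntry g p q + t * vecEntry g i q
      else vecEntry g p q := by
  have := i.2
  rw [vecEntry, vecAct_mul]
  by_cases h : i.val + 1 < n
  · rw [vecAct_y_of_lt i h]; rfl
  · rw [vecAct_y_of_last i (by omega), if_neg (by omega)]; rfl

theorem vecEntry_mul_x {n : ℕ} (i : Fin n) (t : ℂ) (g : G n) (p q : Fin n) :
    vecEntry (g * x i t) p q = if q.val = i.val + 1 then vecEntry g p q + t * vecEntry g p i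
      else vecEntry g p q := by
  have hin := i.2
  rw [vecEntry, vecAct_mul]
  have : vecAct (x i t) (Pi.single (.inl q) 1) = if q.val = i.val + 1 then
      Pi.single (.inl q) 1 + t • Pi.single (.inl i) 1 else Pi.single (.inl q) (1 : ℂ) := by
    by_cases h : i.val + 1 < n
    · rw [vecAct_x_of_lt i h]
      funext a
      rcases a with r | _ | r
      · by_cases hq : q.val = i.val + 1
        · obtain rfl : q = ⟨i.val + 1, h⟩ := Fin.ext hq
          by_cases hr : r = i
          · subst hr
            simp [Fin.ext_iff]
          · simp [Pi.single_apply, hr]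
        · by_cases hr : r = i
          · subst hr
            have : (⟨r.val + 1, h⟩ : Fin n) ≠ q := fun e => hq (congrArg Fin.val e).symm
            simp [Pi.single_apply, hq, this]
          · simp [Pi.single_apply, hr, hq]
      · simp
        split_ifs <;> simp
      · simp
        split_ifs <;> simp
    · have h' : i.val + 1 = n := by omega
      rw [if_neg (by omega), vecAct_x_of_last i h']
      funext a
      rcases a with r | _ | r
      · by_cases hr : r = i <;> simp [Pi.single_apply, hr]
      · simp
      · simp
  rw [this]
  split_ifs
  · rw [vecAct_add, vecAct_smul]; rfl
  · rfl

/-- Left multiplication by `y_i(t)` adds a multiple of row `i` to row `i + 1`. Either both rows lie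
in the leading block, or the changed row lies outside it. -/
theorem leadingMinor_y_mul {n : ℕ} (j i : Fin n) (t : ℂ) (g : G n) :
    leadingMinor j (y i t * g) = leadingMinor j g := by
  by_cases h : i.val < j.val
  · have hne : (⟨i.val + 1, by omega⟩ : Fin (j.val + 1)) ≠ ⟨i.val, by omega⟩ := by
      simp [Fin.ext_iff]
    rw [leadingMinor, leadingMinor, ← Matrix.det_updateRow_add_smul_self
      (Matrix.of fun p q : Fin (j.val + 1) => vecEntry g (lead j p) (lead j q)) hne t]
    congr 1
    funext p q
    simp only [Matrix.of_apply, vecEntry_y_mul, Matrix.updateRow_apply, Fin.ext_iff]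
    split_ifs with hp
    · simp [lead, hp]
    · rfl
  · rw [leadingMinor, leadingMinor]
    congr 1
    funext p q
    simp only [Matrix.of_apply, vecEntry_y_mul]
    have hp := p.2
    exact if_neg fun e : p.val = i.val + 1 => by omega

theorem leadingMinor_mul_x {n : ℕ} (j i : Fin n) (t : ℂ) (g : G n) :
    leadingMinor j (g * x i t) = leadingMinor j g := by
  by_cases h : i.val < j.val
  · have hne : (⟨i.val + 1, by omega⟩ : Fin (j.val + 1)) ≠ ⟨i.val, by omega⟩ := by
      simp [Fin.ext_iff]
    rw [leadingMinor, leadingMinor, ← Matrix.det_updateCol_add_smul_self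
      (Matrix.of fun p q : Fin (j.val + 1) => vecEntry g (lead j p) (lead j q)) hne t]
    congr 1
    funext p q
    simp only [Matrix.of_apply, vecEntry_mul_x, Matrix.updateCol_apply, Fin.ext_iff]
    split_ifs with hp
    · simp [lead, hp]
    · rfl
  · rw [leadingMinor, leadingMinor]
    congr 1
    funext p q
    simp only [Matrix.of_apply, vecEntry_mul_x]
    have hq := q.2
    exact if_neg fun e : q.val = i.val + 1 => by omega

theorem spinAct_y_top {n : ℕ} (i : Fin n) (t : ℂ) (f : SpinIdx n → ℂ) :
    spinAct (y i t) f (fun _ => true) = f fun _ => true := by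
  have := i.2
  by_cases h : i.val + 1 < n
  · simp [spinAct_y_of_lt i h]
  · simp [spinAct_y_of_last i (by omega)]

theorem spinAct_x_top {n : ℕ} (i : Fin n) (t : ℂ) :
    spinAct (x i t) (Pi.single (fun _ => true) 1) = Pi.single (fun _ => true) 1 := by
  have hin := i.2
  funext s
  by_cases h : i.val + 1 < n
  · have hij : i ≠ ⟨i.val + 1, h⟩ := by simp [Fin.ext_iff]
    rw [spinAct_x_of_lt i h]
    split_ifs with hs
    · have : upd2 s i ⟨i.val + 1, h⟩ false true ≠ fun _ => true := fun e => by
        simpa [upd2_fst hij] using congrFun e i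
      simp [Pi.single_apply, this]
    · rfl
  · rw [spinAct_x_of_last i (by omega)]
    split_ifs with hs
    · have : Function.update s i false ≠ fun _ => true := fun e => by
        simpa using congrFun e i
      simp [Pi.single_apply, this]
    · rfl

theorem apply_mul_of_mem_UMinus {n : ℕ} {F : G n → ℂ} (hF : ∀ i t g, F (y i t * g) = F g)
    {u : G n} (hu : u ∈ UMinus n) (g : G n) : F (u * g) = F g := by
  induction hu using Subgroup.closure_induction_left with
  | one => rw [one_mul]
  | mul_left k hk v hv ih =>
    obtain ⟨i, t, rfl⟩ := hk
    rw [mul_assoc, hF, ih]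
  | inv_mul_cancel k hk v hv ih =>
    obtain ⟨i, t, rfl⟩ := hk
    rw [y_inv, mul_assoc, hF, ih]

theorem apply_mul_of_mem_UPlus {n : ℕ} {F : G n → ℂ} (hF : ∀ i t g, F (g * x i t) = F g)
    {u : G n} (hu : u ∈ UPlus n) (g : G n) : F (g * u) = F g := by
  induction hu using Subgroup.closure_induction_right with
  | one => rw [mul_one]
  | mul_right v hv k hk ih =>
    obtain ⟨i, t, rfl⟩ := hk
    rw [← mul_assoc, hF, ih]
  | mul_inv_cancel v hv k hk ih =>
    obtain ⟨i, t, rfl⟩ := hk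
    rw [x_inv, ← mul_assoc, hF, ih]

theorem IsDiag.leadingMinor {n : ℕ} {g : G n} {d : (Fin n → ℂˣ) × ℂˣ} (hg : IsDiag g d)
    (i : Fin n) : leadingMinor i g = ((∏ j, d.1 (lead i j) : ℂˣ) : ℂ) := by
  rw [TypeB.leadingMinor, show (Matrix.of fun p q : Fin (i.val + 1) =>
    vecEntry g (lead i p) (lead i q)) = Matrix.diagonal fun j => (d.1 (lead i j) : ℂ) from ?_,
    Matrix.det_diagonal]
  · simp
  · funext p q
    rw [Matrix.of_apply, vecEntry, hg.inl]
    by_cases h : p = q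
    · simp [h]
    · have : p.val ≠ q.val := fun e => h (Fin.ext e)
      simp [h, this]

theorem prod_lead_mulSingle {n : ℕ} (i l : Fin n) (c : ℂˣ) :
    ∏ j, (Pi.mulSingle l c : Fin n → ℂˣ) (lead i j) = if l.val ≤ i.val then c else 1 := by
  split_ifs with h
  · rw [Finset.prod_eq_single ⟨l.val, by omega⟩]
    · simp [lead]
    · intro j _ hj
      have : lead i j ≠ l := fun e => hj (Fin.ext (by simpa using congrArg Fin.val e))
      simp [this]
    · simp
  · refine Finset.prod_eq_one fun j _ => ?_
    have : lead i j ≠ l := fun e => by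
      have := congrArg Fin.val e
      simp at this
      omega
    simp [this]

/-- Inside the block the eigenvalues `c` and `c⁻¹` of `α_l^∨(c)` cancel; only at `l = i` does the
edge of the block separate them. The hypothesis on `i` keeps the eigenvalue `c ^ 2` of the last
coroot outside. -/
theorem prod_lead_cochar {n : ℕ} (i l : Fin n) (hi : i.val + 1 < n) (c : ℂˣ) :
    ∏ j, (cochar l c).1 (lead i j) = if l = i then c else 1 := by
  have hl := l.2
  by_cases h : l.val + 1 < n
  · rw [cochar_of_lt l h]
    simp only [Pi.mul_apply, Finset.prod_mul_distrib, prod_lead_mulSingle]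
    by_cases h1 : l = i
    · simp [h1]
    · have := Fin.val_ne_of_ne h1
      by_cases h2 : l.val ≤ i.val
      · rw [if_pos h2, if_pos (by omega), if_neg h1, mul_inv_cancel]
      · rw [if_neg h2, if_neg (by omega), if_neg h1, mul_one]
  · rw [cochar_of_last l (by omega)]
    simp only [prod_lead_mulSingle]
    rw [if_neg (by omega), if_neg (by rintro rfl; omega)]

theorem prod_fundWeight {n : ℕ} (i : Fin n) (a : Fin n → ℂˣ) :
    ∏ j, (a j : ℂ) ^ (fundWeight i j) = a i := by
  rw [Finset.prod_eq_single i]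
  · simp [fundWeight]
  · intro j _ hj
    simp [fundWeight, hj]
  · simp

theorem isPrincipalMinor_leadingMinor {n : ℕ} (i : Fin n) (hi : i.val + 1 < n) :
    IsPrincipalMinor (fundWeight i) (leadingMinor i) := by
  refine ⟨isRegular_leadingMinor i, fun u hu a v hv => ?_⟩
  rw [apply_mul_of_mem_UPlus (leadingMinor_mul_x i) hv,
    apply_mul_of_mem_UMinus (leadingMinor_y_mul i) hu, (isDiag_torus a).leadingMinor,
    prod_fundWeight]
  congr 1
  simp only [Prod.fst_prod, Finset.prod_apply]
  rw [Finset.prod_comm]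
  simp [prod_lead_cochar _ _ hi]

/-- On `(+, …, +)` a coroot `α_l^∨(c)` with `l < n` acts by `c * c⁻¹ = 1`, and the last one by `c ^
2 * c⁻¹ = c`, which is the character `Λ_n`. -/
theorem isPrincipalMinor_spinCorner {n : ℕ} (i : Fin n) (hi : i.val + 1 = n) :
    IsPrincipalMinor (fundWeight i) spinCorner := by
  refine ⟨isRegular_spinCorner, fun u hu a v hv => ?_⟩
  have hx : ∀ i t (g : G n), spinCorner (g * x i t) = spinCorner g := by
    intro i t g
    rw [spinCorner, spinAct_mul, spinAct_x_top]
    rfl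
  have hy : ∀ i t (g : G n), spinCorner (y i t * g) = spinCorner g := by
    intro i t g
    rw [spinCorner, spinAct_mul, spinAct_y_top]
    rfl
  rw [apply_mul_of_mem_UPlus hx hv, apply_mul_of_mem_UMinus hy hu, spinCorner,
    (isDiag_torus a).spin, prod_fundWeight]
  simp only [Pi.single_eq_same, mul_one]
  congr 1
  simp only [if_true, Prod.fst_prod, Prod.snd_prod, Finset.prod_apply]
  rw [Finset.prod_comm, ← Finset.prod_mul_distrib, Finset.prod_eq_single i]
  · rw [cochar_of_last i hi]
    simp [Finset.prod_pi_mulSingle', pow_two]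
  · intro l _ hl
    have h : l.val + 1 < n := by
      have := Fin.val_ne_of_ne hl
      omega
    rw [cochar_of_lt l h]
    simp [Finset.prod_mul_distrib, Finset.prod_pi_mulSingle']
  · simp

end TypeB

namespace TypeB

/-! ### The Weyl group as a group of signed permutations -/

/-- The weight with the orthonormal coordinates `a`. -/
def ofEps {n : ℕ} (a : Fin n → ℤ) : Weight n :=
  fun i => if h : i.val + 1 < n then a i - a ⟨i.val + 1, h⟩ else 2 * a i

/-- The simple reflection `s_i` in orthonormal coordinates. -/
def reflEps {n : ℕ} (i : Fin n) (a : Fin n → ℤ) : Fin n → ℤ :=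
  if h : i.val + 1 < n then a ∘ Equiv.swap i ⟨i.val + 1, h⟩ else Function.update a i (-a i)

/-- The product of the simple reflections of a word, in orthonormal coordinates. -/
def wordEps {n : ℕ} (l : List (Fin n)) (a : Fin n → ℤ) : Fin n → ℤ := l.foldr reflEps a

/-- The regular dominant weight `(n, n - 1, …, 1)`. -/
def stdEps (n : ℕ) : Fin n → ℤ := fun i => n - i.val

theorem ofEps_of_lt {n : ℕ} (i : Fin n) (h : i.val + 1 < n) (a : Fin n → ℤ) :
    ofEps a i = a i - a ⟨i.val + 1, h⟩ := by
  simp [ofEps, h]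

theorem ofEps_of_last {n : ℕ} (i : Fin n) (h : i.val + 1 = n) (a : Fin n → ℤ) :
    ofEps a i = 2 * a i := by
  simp [ofEps, h]

theorem reflEps_of_lt {n : ℕ} (i : Fin n) (h : i.val + 1 < n) (a : Fin n → ℤ) (p : Fin n) :
    reflEps i a p = if p = i then a ⟨i.val + 1, h⟩ else
      if p.val = i.val + 1 then a i else a p := by
  have : (p = ⟨i.val + 1, h⟩) ↔ p.val = i.val + 1 := by simp [Fin.ext_iff]
  simp only [reflEps, h, dif_pos, Function.comp, Equiv.swap_apply_def, this]
  split_ifs <;> rfl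

theorem reflEps_of_last {n : ℕ} (i : Fin n) (h : i.val + 1 = n) (a : Fin n → ℤ) (p : Fin n) :
    reflEps i a p = if p = i then -a i else a p := by
  simp [reflEps, h, Function.update_apply]

/-- Here `α_i = ε_i - ε_{i+1}` for `i < n` and `α_n = ε_n`, so reflections are transpositions of
neighbours and one sign change. The cases compare the positions of `i` and `j` in the Dynkin
diagram. -/
theorem reflectionMap_ofEps {n : ℕ} (i : Fin n) (a : Fin n → ℤ) :
    reflectionMap i (ofEps a) = ofEps (reflEps i a) := by
  have hin := i.2
  rw [reflectionMap, Module.reflection_apply]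
  funext j
  have hjn := j.2
  simp only [LinearMap.proj_apply, Pi.sub_apply, Pi.smul_apply, smul_eq_mul, simpleRoot,
    CartanMatrix.B, Matrix.of_apply]
  by_cases h : i.val + 1 < n
  · rw [ofEps_of_lt i h]
    by_cases hj : j.val + 1 < n
    · rw [ofEps_of_lt j hj, ofEps_of_lt j hj]
      simp only [reflEps_of_lt i h]
      by_cases h1 : i = j
      · subst h1
        simp [Fin.ext_iff]
        ring
      · by_cases h2 : i.val + 1 = j.val
        · obtain rfl : j = ⟨i.val + 1, h⟩ := Fin.ext h2.symm
          simp [Fin.ext_iff]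
          rw [if_neg (by omega), if_neg (by omega)]
          ring
        · have h1' : j ≠ i := Ne.symm h1
          by_cases h3 : j.val + 1 = i.val
          · obtain rfl : i = ⟨j.val + 1, hj⟩ := Fin.ext h3.symm
            have h4 : j.val ≠ j.val + 1 + 1 := by omega
            have h5 : j.val + 1 + 1 ≠ j.val := by omega
            simp [Fin.ext_iff, h4, h5]
          · have h4 : j.val ≠ i.val + 1 := by omega
            have h5 : j.val ≠ i.val := fun e => h1' (Fin.ext e)
            simp [h1, h2, h3, h4, h5, Fin.ext_iff]
    · have hj' : j.val + 1 = n := by omega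
      rw [ofEps_of_last j hj', ofEps_of_last j hj']
      simp only [reflEps_of_lt i h]
      have h1 : i ≠ j := by rintro rfl; omega
      by_cases h2 : i.val + 1 = j.val
      · obtain rfl : j = ⟨i.val + 1, h⟩ := Fin.ext h2.symm
        rw [if_neg h1, if_pos rfl, if_pos (by simp; omega), if_neg (Ne.symm h1), if_pos rfl]
        ring
      · rw [if_neg h1, if_neg h2, if_neg (by omega), if_neg (Ne.symm h1), if_neg (by omega)]
        ring
  · have h' : i.val + 1 = n := by omega
    rw [ofEps_of_last i h']
    by_cases hj : j.val + 1 < n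
    · have h1 : i ≠ j := by rintro rfl; omega
      rw [ofEps_of_lt j hj, ofEps_of_lt j hj, if_neg h1, if_neg (by omega)]
      simp only [reflEps_of_last i h', if_neg (Ne.symm h1)]
      by_cases h2 : j.val + 1 = i.val
      · obtain rfl : i = ⟨j.val + 1, hj⟩ := Fin.ext h2.symm
        simp
        ring
      · have : (⟨j.val + 1, hj⟩ : Fin n) ≠ i := fun e => h2 (congrArg Fin.val e)
        simp [h2, this]
    · obtain rfl : i = j := Fin.ext (by omega)
      rw [ofEps_of_last i h', ofEps_of_last i h', reflEps_of_last i h']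
      simp
      ring

theorem word_apply_ofEps {n : ℕ} (l : List (Fin n)) (a : Fin n → ℤ) :
    ((l.map simpleRefl).prod : Weyl n).1 (ofEps a) = ofEps (wordEps l a) := by
  induction l with
  | nil => rfl
  | cons i l ih =>
    rw [List.map_cons, List.prod_cons]
    change (simpleRefl i).1 (((l.map simpleRefl).prod : Weyl n).1 (ofEps a)) = _
    rw [ih]
    exact reflectionMap_ofEps i _

/-- The orthonormal coordinates of `2μ`. -/
def toEps {n : ℕ} (μ : Weight n) : Fin n → ℤ :=
  fun i => ∑ j : Fin n, if i ≤ j then (if j.val + 1 < n then 2 * μ j else μ j) else 0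

/-- Weights of spin type have half-integral orthonormal coordinates, hence the doubling. -/
theorem ofEps_toEps {n : ℕ} (μ : Weight n) : ofEps (toEps μ) = (2 : ℤ) • μ := by
  funext i
  have hin := i.2
  by_cases h : i.val + 1 < n
  · rw [ofEps_of_lt i h, toEps, toEps, ← Finset.sum_sub_distrib, Finset.sum_eq_single i]
    · simp [h, Fin.le_def]
    · intro j _ hj
      have hv := Fin.val_ne_of_ne hj
      simp only [Fin.le_def]
      by_cases h1 : i.val ≤ j.val
      · rw [if_pos h1, if_pos (show i.val + 1 ≤ j.val by omega), sub_self]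
      · rw [if_neg h1, if_neg (show ¬ i.val + 1 ≤ j.val by omega), sub_self]
    · simp
  · rw [ofEps_of_last i (by omega), toEps, Finset.sum_eq_single i]
    · simp [h]
    · intro j _ hj
      have hv := Fin.val_ne_of_ne hj
      rw [if_neg (by rw [Fin.le_def]; omega)]
    · simp

theorem ofEps_injective {n : ℕ} : Function.Injective (ofEps : (Fin n → ℤ) → Weight n) := by
  intro a b hab
  have : ∀ k, ∀ i : Fin n, i.val + k + 1 = n → a i = b i := by
    intro k
    induction k with
    | zero =>
      intro i hi
      have := congrFun hab i
      rw [ofEps_of_last i (by omega), ofEps_of_last i (by omega)] at this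
      omega
    | succ k ih =>
      intro i hi
      have h1 := congrFun hab i
      have h2 := ih ⟨i.val + 1, by omega⟩ (by simp; omega)
      rw [ofEps_of_lt i (by omega), ofEps_of_lt i (by omega)] at h1
      omega
  funext i
  exact this (n - 1 - i.val) i (by omega)

theorem wordEps_eq_of_prod_eq {n : ℕ} {l l' : List (Fin n)}
    (h : (l.map simpleRefl).prod = (l'.map simpleRefl).prod) (a : Fin n → ℤ) :
    wordEps l a = wordEps l' a := by
  apply ofEps_injective
  rw [← word_apply_ofEps, ← word_apply_ofEps, h]

/-- Every `2μ` has integral orthonormal coordinates, and the weight lattice is torsion free, so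
triviality on such coordinates is enough. -/
theorem word_eq_one {n : ℕ} {l : List (Fin n)} (h : ∀ a, wordEps l a = a) :
    (l.map simpleRefl).prod = 1 := by
  apply Subtype.ext
  apply LinearEquiv.ext
  intro μ
  have h2 : ((l.map simpleRefl).prod : Weyl n).1 ((2 : ℤ) • μ) = (2 : ℤ) • μ := by
    rw [← ofEps_toEps, word_apply_ofEps, h]
  rw [map_smul] at h2
  exact smul_right_injective _ (two_ne_zero) h2

/-! ### Signed permutations of the regular weight -/

theorem exists_signed_perm {n : ℕ} (l : List (Fin n)) :
    ∃ (σ : Equiv.Perm (Fin n)) (η : Fin n → ℤˣ), ∀ a p, wordEps l a p = η p * a (σ p) := by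
  induction l with
  | nil => exact ⟨1, 1, fun a p => by simp [wordEps]⟩
  | cons i l ih =>
    obtain ⟨σ, η, H⟩ := ih
    by_cases h : i.val + 1 < n
    · refine ⟨σ * Equiv.swap i ⟨i.val + 1, h⟩, η ∘ Equiv.swap i ⟨i.val + 1, h⟩, fun a p => ?_⟩
      change reflEps i (wordEps l a) p = _
      simp [reflEps, h, H]
    · have hin := i.2
      refine ⟨σ, Function.update η i (-η i), fun a p => ?_⟩
      change reflEps i (wordEps l a) p = _
      rw [reflEps_of_last i (by omega), Function.update_apply]
      split_ifs with hp
      · simp [H, hp]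
      · exact H a p

theorem stdEps_pos {n : ℕ} (p : Fin n) : 0 < stdEps n p := by
  have := p.2
  simp only [stdEps]
  omega

/-- The entries of a signed permutation of `(n, …, 1)` are nonzero with distinct absolute values, so
no simple coroot vanishes on it. -/
theorem ofEps_wordEps_ne_zero {n : ℕ} (l : List (Fin n)) (i : Fin n) :
    ofEps (wordEps l (stdEps n)) i ≠ 0 := by
  obtain ⟨σ, η, H⟩ := exists_signed_perm l
  have h1 := stdEps_pos (σ i)
  by_cases h : i.val + 1 < n
  · rw [ofEps_of_lt i h, H, H]
    have h2 := stdEps_pos (σ ⟨i.val + 1, h⟩)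
    have h3 : stdEps n (σ i) ≠ stdEps n (σ ⟨i.val + 1, h⟩) := by
      intro e
      have : σ i = σ ⟨i.val + 1, h⟩ := Fin.ext (by simp only [stdEps] at e; omega)
      simpa [Fin.ext_iff] using σ.injective this
    rcases Int.units_eq_one_or (η i) with e | e <;>
      rcases Int.units_eq_one_or (η ⟨i.val + 1, h⟩) with e' | e' <;>
      rw [e, e'] <;> push_cast <;> omega
  · have hin := i.2
    rw [ofEps_of_last i (by omega), H]
    rcases Int.units_eq_one_or (η i) with e | e <;> rw [e] <;> push_cast <;> omega

/-- Strict dominance means strictly decreasing positive entries. This forces all signs to be `+` and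
`σ` to be increasing, hence the identity. -/
theorem signed_perm_eq_std {n : ℕ} {σ : Equiv.Perm (Fin n)} {η : Fin n → ℤˣ}
    (h : ∀ i, 0 < ofEps (fun p => (η p : ℤ) * stdEps n (σ p)) i) : σ = 1 ∧ η = 1 := by
  set a : Fin n → ℤ := fun p => (η p : ℤ) * stdEps n (σ p) with ha
  have hanti : ∀ k, ∀ p q : Fin n, p.val + k + 1 = q.val → a q < a p := by
    intro k
    induction k with
    | zero =>
      intro p q hpq
      have := h p
      rw [ofEps_of_lt p (by omega)] at this
      rw [show q = ⟨p.val + 1, by omega⟩ from Fin.ext hpq.symm]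
      omega
    | succ k ih =>
      intro p q hpq
      have h1 := h p
      rw [ofEps_of_lt p (by omega)] at h1
      have h2 := ih ⟨p.val + 1, by omega⟩ q (by simp; omega)
      omega
  have hanti' : ∀ p q : Fin n, p < q → a q < a p := by
    intro p q hpq
    rw [Fin.lt_def] at hpq
    exact hanti (q.val - p.val - 1) p q (by omega)
  have hpos : ∀ p, 0 < a p := by
    intro p
    have hp := p.2
    have h1 := h ⟨n - 1, by omega⟩
    rw [ofEps_of_last _ (by simp; omega)] at h1
    by_cases hp' : p = ⟨n - 1, by omega⟩
    · rw [hp']; omega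
    · have := Fin.val_ne_of_ne hp'
      have h2 := hanti' p ⟨n - 1, by omega⟩ (by rw [Fin.lt_def]; simp at *; omega)
      omega
  have hη : η = 1 := by
    funext p
    have h1 := hpos p
    have h2 := stdEps_pos (σ p)
    rcases Int.units_eq_one_or (η p) with e | e
    · exact e
    · simp only [ha, e] at h1
      push_cast at h1
      omega
  refine ⟨?_, hη⟩
  have hmono : StrictMono σ := by
    intro p q hpq
    have h1 := hanti' p q hpq
    simp only [ha, hη, stdEps, Pi.one_apply, Units.val_one, one_mul] at h1
    rw [Fin.lt_def]
    omega
  have : (σ : Fin n → Fin n) = id := (hmono.range_inj strictMono_id).1 (by simp)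
  exact Equiv.ext fun p => congrFun this p

/-! ### The length function -/

/-- `1`, `0` or `-1` according to the order of `p` and `q`. -/
def ordSign {n : ℕ} (p q : Fin n) : ℤ := if p < q then 1 else if q < p then -1 else 0

/-- The number of positive roots minus twice the number of those with a negative value, up to a
factor. -/
def heightEps {n : ℕ} (a : Fin n → ℤ) : ℤ :=
  (∑ p, ∑ q, (ordSign p q * Int.sign (a p - a q) + Int.sign (a p + a q))) + ∑ p, Int.sign (a p)

theorem heightEps_le {n : ℕ} (a : Fin n → ℤ) : heightEps a ≤ 2 * n * n + n := by
  have hs : ∀ z : ℤ, z.sign ≤ 1 ∧ -1 ≤ z.sign := fun z => by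
    rcases Int.sign_trichotomy z with h | h | h <;> omega
  have h1 : ∀ p q, ordSign p q * Int.sign (a p - a q) + Int.sign (a p + a q) ≤ 2 := by
    intro p q
    have h1 := hs (a p - a q)
    have h2 := hs (a p + a q)
    rw [ordSign]
    split_ifs <;> omega
  have h2 : (∑ p, ∑ q, (ordSign p q * Int.sign (a p - a q) + Int.sign (a p + a q))) ≤
      ∑ _p : Fin n, ∑ _q : Fin n, (2 : ℤ) :=
    Finset.sum_le_sum fun p _ => Finset.sum_le_sum fun q _ => h1 p q
  have h3 : ∑ p, Int.sign (a p) ≤ ∑ _p : Fin n, (1 : ℤ) :=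
    Finset.sum_le_sum fun p _ => (hs _).1
  simp at h2 h3
  rw [heightEps]
  linarith

theorem ordSign_swap {n : ℕ} (i : Fin n) (h : i.val + 1 < n) (p q : Fin n) :
    ordSign p q = ordSign (Equiv.swap i ⟨i.val + 1, h⟩ p) (Equiv.swap i ⟨i.val + 1, h⟩ q) +
      ((if p = i ∧ q = ⟨i.val + 1, h⟩ then 2 else 0) -
        (if p = ⟨i.val + 1, h⟩ ∧ q = i then 2 else 0)) := by
  simp only [ordSign, Equiv.swap_apply_def, Fin.ext_iff, Fin.lt_def, apply_ite Fin.val]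
  split_ifs <;> first | rfl | omega

/-- The reflection `s_i` permutes the positive roots other than `α_i` and negates `α_i`. In
`heightEps` every positive root is counted twice, and one sign drops from `1` to `-1`, which gives
`4`. -/
theorem heightEps_reflEps {n : ℕ} (i : Fin n) (a : Fin n → ℤ) (ha : 0 < ofEps a i) :
    heightEps (reflEps i a) = heightEps a - 4 := by
  by_cases h : i.val + 1 < n
  · rw [ofEps_of_lt i h] at ha
    set sw := Equiv.swap i ⟨i.val + 1, h⟩ with hsw
    have e : reflEps i a = a ∘ sw := by simp [reflEps, h, hsw]
    have h1 : ∑ p, Int.sign ((a ∘ sw) p) = ∑ p, Int.sign (a p) :=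
      Equiv.sum_comp sw fun p => Int.sign (a p)
    have h2 : ∑ p, ∑ q, (ordSign p q * Int.sign ((a ∘ sw) p - (a ∘ sw) q) +
        Int.sign ((a ∘ sw) p + (a ∘ sw) q)) =
        ∑ p, ∑ q, (ordSign (sw p) (sw q) * Int.sign (a p - a q) + Int.sign (a p + a q)) := by
      rw [← Equiv.sum_comp sw]
      refine Finset.sum_congr rfl fun p _ => ?_
      rw [← Equiv.sum_comp sw]
      refine Finset.sum_congr rfl fun q _ => ?_
      simp [hsw]
    have h3 : ∑ p, ∑ q, (ordSign p q * Int.sign (a p - a q) + Int.sign (a p + a q)) =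
        ∑ p, ∑ q, (ordSign (sw p) (sw q) * Int.sign (a p - a q) + Int.sign (a p + a q)) + 4 := by
      have h4 : ∀ p q, ordSign p q * Int.sign (a p - a q) + Int.sign (a p + a q) =
          (ordSign (sw p) (sw q) * Int.sign (a p - a q) + Int.sign (a p + a q)) +
          ((if p = i ∧ q = ⟨i.val + 1, h⟩ then 2 * Int.sign (a p - a q) else 0) -
            (if p = ⟨i.val + 1, h⟩ ∧ q = i then 2 * Int.sign (a p - a q) else 0)) := by
        intro p q
        rw [ordSign_swap i h p q]
        split_ifs <;> ring
      simp only [h4, Finset.sum_add_distrib, Finset.sum_sub_distrib]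
      congr 1
      simp only [ite_and]
      simp
      rw [Int.sign_eq_one_of_pos ha, Int.sign_eq_neg_one_of_neg (by omega)]
      rfl
    rw [heightEps, heightEps, e, h1, h2, h3]
    ring
  · have h' : i.val + 1 = n := by omega
    rw [ofEps_of_last i h'] at ha
    have h1 : ∑ p, Int.sign (a p) = ∑ p, Int.sign (reflEps i a p) + 2 := by
      have : ∀ p, Int.sign (a p) = Int.sign (reflEps i a p) + if p = i then 2 else 0 := by
        intro p
        rw [reflEps_of_last i h']
        split_ifs with hp
        · rw [hp, Int.sign_neg, Int.sign_eq_one_of_pos (by omega)]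
          rfl
        · simp
      simp [this, Finset.sum_add_distrib]
    have h2 : ∑ p, ∑ q, (ordSign p q * Int.sign (a p - a q) + Int.sign (a p + a q)) =
        ∑ p, ∑ q, (ordSign p q * Int.sign (reflEps i a p - reflEps i a q) +
          Int.sign (reflEps i a p + reflEps i a q)) + 2 := by
      have h3 : ∀ p q, ordSign p q * Int.sign (a p - a q) + Int.sign (a p + a q) =
          (ordSign p q * Int.sign (reflEps i a p - reflEps i a q) +
            Int.sign (reflEps i a p + reflEps i a q)) + if p = i then (if q = i then 2 else 0)
            else 0 := by
        intro p q
        simp only [reflEps_of_last i h']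
        by_cases hp : p = i
        · by_cases hq : q = i
          · rw [hp, hq]
            simp only [if_true, sub_self]
            rw [Int.sign_eq_one_of_pos (show 0 < a i + a i by omega),
              Int.sign_eq_neg_one_of_neg (show -a i + -a i < 0 by omega)]
            simp
          · have : ordSign p q = -1 := by
              have := Fin.val_ne_of_ne hq
              rw [ordSign, if_neg (by rw [Fin.lt_def, hp]; omega),
                if_pos (by rw [Fin.lt_def, hp]; omega)]
            rw [this, if_pos hp, if_neg hq, if_pos hp, if_neg hq, hp,
              show -a i - a q = -(a i + a q) by ring, show -a i + a q = -(a i - a q) by ring,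
              Int.sign_neg, Int.sign_neg]
            ring
        · by_cases hq : q = i
          · have : ordSign p q = 1 := by
              have := Fin.val_ne_of_ne hp
              rw [ordSign, if_pos (by rw [Fin.lt_def, hq]; omega)]
            rw [this, if_neg hp, if_pos hq, if_neg hp, hq, sub_neg_eq_add, ← sub_eq_add_neg]
            ring
          · simp [hp, hq]
      simp [h3, Finset.sum_add_distrib]
    rw [heightEps, heightEps, h1, h2]
    ring

theorem reflEps_reflEps {n : ℕ} (i : Fin n) (a : Fin n → ℤ) : reflEps i (reflEps i a) = a := by
  have hin := i.2
  by_cases h : i.val + 1 < n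
  · funext p
    simp [reflEps, h]
  · simp [reflEps, h]

theorem ofEps_reflEps {n : ℕ} (i : Fin n) (a : Fin n → ℤ) :
    ofEps (reflEps i a) i = -ofEps a i := by
  have hin := i.2
  by_cases h : i.val + 1 < n
  · rw [ofEps_of_lt i h, ofEps_of_lt i h, reflEps_of_lt i h, reflEps_of_lt i h]
    simp [Fin.ext_iff]
  · rw [ofEps_of_last i (by omega), ofEps_of_last i (by omega), reflEps_of_last i (by omega)]
    simp

theorem heightEps_reflEps_of_neg {n : ℕ} (i : Fin n) (a : Fin n → ℤ) (ha : ofEps a i < 0) :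
    heightEps (reflEps i a) = heightEps a + 4 := by
  have := heightEps_reflEps i (reflEps i a) (by rw [ofEps_reflEps]; omega)
  rw [reflEps_reflEps] at this
  omega

theorem height_sub_le {n : ℕ} (l : List (Fin n)) :
    heightEps (stdEps n) - heightEps (wordEps l (stdEps n)) ≤ 4 * l.length := by
  induction l with
  | nil => simp [wordEps]
  | cons i l ih =>
    change _ - heightEps (reflEps i (wordEps l (stdEps n))) ≤ _
    rw [List.length_cons]
    push_cast
    rcases lt_or_gt_of_ne (ofEps_wordEps_ne_zero l i) with h | h
    · rw [heightEps_reflEps_of_neg _ _ h]; omega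
    · rw [heightEps_reflEps _ _ h]; omega

/-- As long as some simple root is negative, prepending its reflection raises the height by `4`. The
process stops at a dominant signed permutation of `(n, …, 1)`, which is the identity, and the
prepended letters spell the element. -/
theorem exists_word_of_height {n : ℕ} (l : List (Fin n)) :
    ∃ l' : List (Fin n), (l'.map simpleRefl).prod = (l.map simpleRefl).prod ∧
      4 * (l'.length : ℤ) = heightEps (stdEps n) - heightEps (wordEps l (stdEps n)) := by
  -- The induction is on the gap to the crude bound of `heightEps_le`.
  have H : ∀ (N : ℕ) (l : List (Fin n)),
      2 * n * n + n - heightEps (wordEps l (stdEps n)) ≤ N →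
      ∃ l' : List (Fin n), (l'.map simpleRefl).prod = (l.map simpleRefl).prod ∧
      4 * (l'.length : ℤ) = heightEps (stdEps n) - heightEps (wordEps l (stdEps n)) := by
    intro N
    induction N using Nat.strong_induction_on with
    | _ N ih =>
      intro l hl
      by_cases h : ∃ i, ofEps (wordEps l (stdEps n)) i < 0
      · obtain ⟨i, hi⟩ := h
        have h1 : heightEps (wordEps (i :: l) (stdEps n)) = heightEps (wordEps l (stdEps n)) + 4 :=
          heightEps_reflEps_of_neg i _ hi
        have h2 := heightEps_le (wordEps (i :: l) (stdEps n))
        obtain ⟨l', h3, h4⟩ := ih (N - 4) (by omega) (i :: l) (by omega)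
        refine ⟨i :: l', ?_, ?_⟩
        · rw [List.map_cons, List.prod_cons, h3, List.map_cons, List.prod_cons, ← mul_assoc]
          nth_rewrite 1 [← simpleRefl_inv]
          rw [inv_mul_cancel, one_mul]
        · rw [List.length_cons]
          push_cast
          omega
      · push Not at h
        obtain ⟨σ, η, hση⟩ := exists_signed_perm l
        have h0 : ∀ i, 0 < ofEps (fun p => (η p : ℤ) * stdEps n (σ p)) i := by
          intro i
          rw [← funext (hση (stdEps n))]
          exact lt_of_le_of_ne (h i) (ofEps_wordEps_ne_zero l i).symm
        obtain ⟨rfl, rfl⟩ := signed_perm_eq_std h0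
        have h1 : ∀ a, wordEps l a = a := fun a => by
          funext p
          simp [hση]
        exact ⟨[], by rw [word_eq_one h1]; rfl, by simp [h1]⟩
  have := heightEps_le (wordEps l (stdEps n))
  exact H (2 * n * n + n - heightEps (wordEps l (stdEps n))).toNat l (by omega)

theorem weylLength_le {n : ℕ} (l : List (Fin n)) :
    weylLength (l.map simpleRefl).prod ≤ l.length :=
  Nat.sInf_le ⟨l, rfl, rfl⟩

/-- No letter lowers the height by more than `4`, and some word lowers it by exactly `4` at each
letter. -/
theorem four_mul_weylLength {n : ℕ} (l : List (Fin n)) :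
    4 * (weylLength (l.map simpleRefl).prod : ℤ) =
      heightEps (stdEps n) - heightEps (wordEps l (stdEps n)) := by
  apply le_antisymm
  · obtain ⟨l', h1, h2⟩ := exists_word_of_height l
    rw [← h2, ← h1]
    have := weylLength_le l'
    omega
  · obtain ⟨l', h1, h2⟩ := exists_reducedWord (l.map simpleRefl).prod
    rw [← h2, ← wordEps_eq_of_prod_eq h1]
    exact height_sub_le l'

/-- Every letter of the word increases the length. -/
def Ascending {n : ℕ} : List (Fin n) → Prop
  | [] => True
  | i :: l => 0 < ofEps (wordEps l (stdEps n)) i ∧ Ascending l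

/-- A reduced word uses up the whole bound of `height_sub_le`, so each of its letters has to lower
the height. -/
theorem IsReducedWord.ascending {n : ℕ} {l : List (Fin n)} {w : Weyl n} (h : IsReducedWord l w) :
    Ascending l := by
  obtain ⟨rfl, h⟩ := h
  have h1 := four_mul_weylLength l
  rw [← h] at h1
  clear h
  induction l with
  | nil => trivial
  | cons i l ih =>
    have h2 := height_sub_le l
    change _ = _ - heightEps (reflEps i (wordEps l (stdEps n))) at h1
    rw [List.length_cons] at h1
    push_cast at h1
    rcases lt_or_gt_of_ne (ofEps_wordEps_ne_zero l i) with h | h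
    · rw [heightEps_reflEps_of_neg _ _ h] at h1; omega
    · rw [heightEps_reflEps _ _ h] at h1
      exact ⟨h, ih (by omega)⟩

/-- A positive simple root on `w(n, …, 1)` would allow a longer element. Hence `-w(n, …, 1)` is
strictly dominant and equals `(n, …, 1)`. -/
theorem IsLongest.wordEps {n : ℕ} {w : Weyl n} (hw : IsLongest w) {l : List (Fin n)}
    (hl : (l.map simpleRefl).prod = w) : wordEps l (stdEps n) = -stdEps n := by
  obtain ⟨σ, η, hση⟩ := exists_signed_perm l
  have h0 : ∀ i, 0 < ofEps (fun p => ((-η) p : ℤ) * stdEps n (σ p)) i := by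
    intro i
    have h1 : (fun p => ((-η) p : ℤ) * stdEps n (σ p)) = -TypeB.wordEps l (stdEps n) := by
      funext p
      simp [hση]
    have h2 : ofEps (-TypeB.wordEps l (stdEps n)) i = -ofEps (TypeB.wordEps l (stdEps n)) i := by
      simp only [ofEps, Pi.neg_apply]
      split_ifs <;> ring
    rw [h1, h2]
    rcases lt_or_gt_of_ne (ofEps_wordEps_ne_zero l i) with h | h
    · omega
    · exfalso
      have h3 := four_mul_weylLength l
      have h4 := four_mul_weylLength (i :: l)
      have h5 := hw ((i :: l).map simpleRefl).prod
      rw [← hl] at h5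
      change _ = _ - heightEps (reflEps i (TypeB.wordEps l (stdEps n))) at h4
      rw [heightEps_reflEps _ _ h] at h4
      omega
  obtain ⟨rfl, h⟩ := signed_perm_eq_std h0
  funext p
  have := congrFun h p
  simp only [Pi.neg_apply, Pi.one_apply, neg_eq_iff_eq_neg] at this
  simp [hση, this]

theorem reducedWord_simpleRefl {n : ℕ} {l : List (Fin n)} {i : Fin n}
    (h : IsReducedWord l (simpleRefl i)) : l = [i] := by
  obtain ⟨h1, h2⟩ := h
  have h3 : simpleRefl i = ([i].map simpleRefl).prod := by simp
  have h4 := four_mul_weylLength [i]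
  have h5 : heightEps (TypeB.wordEps [i] (stdEps n)) = heightEps (stdEps n) - 4 := by
    refine heightEps_reflEps i _ ?_
    by_cases h : i.val + 1 < n
    · rw [ofEps_of_lt i h]
      simp [stdEps]
    · have h6 : 0 < stdEps n i := stdEps_pos i
      rw [ofEps_of_last i (by omega)]
      change 0 < 2 * stdEps n i
      omega
  rw [← h3, ← h2, h5] at h4
  obtain ⟨j, rfl⟩ := List.length_eq_one_iff.1 (show l.length = 1 by omega)
  rw [h3] at h1
  have h6 := congrFun (wordEps_eq_of_prod_eq h1 (stdEps n))
  change ∀ p, reflEps j (stdEps n) p = reflEps i (stdEps n) p at h6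
  -- If `j < i`, then `s_i` leaves the entry at place `j` alone, while `s_j` replaces it by its
  -- right neighbour.
  have key : ∀ i j : Fin n, reflEps j (stdEps n) j = reflEps i (stdEps n) j → i.val ≤ j.val := by
    intro i j e
    by_contra hlt
    have hji : j ≠ i := by rintro rfl; exact hlt le_rfl
    have hin := i.2
    have h7 : reflEps i (stdEps n) j = stdEps n j := by
      by_cases h : i.val + 1 < n
      · rw [reflEps_of_lt i h, if_neg hji, if_neg (by omega)]
      · rw [reflEps_of_last i (by omega), if_neg hji]
    rw [h7, reflEps_of_lt j (by omega), if_pos rfl] at e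
    simp [stdEps] at e
  have h8 := key i j (h6 j)
  have h9 := key j i (h6 i).symm
  rw [Fin.ext (le_antisymm h8 h9)]

end TypeB

namespace TypeB

/-! ### Representatives of Weyl group elements -/

/-- The place `q` contributes a sign to the image of the basis vector that is moved to the place `p`
by the signed permutation `a`. -/
def SignCond {n : ℕ} (a : Fin n → ℤ) (p q : Fin n) : Prop :=
  if 0 < a p then a q < -a p ∨ (p < q ∧ a p < a q) else q < p ∧ a q < a p

instance {n : ℕ} (a : Fin n → ℤ) (p q : Fin n) : Decidable (SignCond a p q) := by
  unfold SignCond; infer_instance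

/-- The sign of the image of the basis vector that is moved to the place `p`. -/
def signEps {n : ℕ} (a : Fin n → ℤ) (p : Fin n) : ℂ := ∏ q, if SignCond a p q then -1 else 1

/-- In an ascending step a sign arises exactly when a positive entry moves one place to the left or
a nonpositive one moves one place to the right. These are the two extra alternatives; every other
pair is only carried along. -/
theorem signCond_reflEps_of_lt {n : ℕ} (i : Fin n) (h : i.val + 1 < n) (a : Fin n → ℤ)
    (ha : a ⟨i.val + 1, h⟩ < a i) (p q : Fin n) :
    SignCond (reflEps i a) p q ↔ (SignCond a (Equiv.swap i ⟨i.val + 1, h⟩ p)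
      (Equiv.swap i ⟨i.val + 1, h⟩ q) ∨ (p = i ∧ q = ⟨i.val + 1, h⟩ ∧ 0 < a ⟨i.val + 1, h⟩) ∨
        (p = ⟨i.val + 1, h⟩ ∧ q = i ∧ ¬ 0 < a i)) := by
  have hij : (⟨i.val + 1, h⟩ : Fin n) ≠ i := by simp [Fin.ext_iff]
  have e : reflEps i a = a ∘ Equiv.swap i ⟨i.val + 1, h⟩ := by simp [reflEps, h]
  have hlt : i < ⟨i.val + 1, h⟩ := by simp [Fin.lt_def]
  have hlt' : ¬ (⟨i.val + 1, h⟩ : Fin n) < i := by simp [Fin.lt_def]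
  have hother : ∀ r : Fin n, r ≠ i → r ≠ ⟨i.val + 1, h⟩ →
      ((r < i ↔ r < ⟨i.val + 1, h⟩) ∧ (i < r ↔ ⟨i.val + 1, h⟩ < r)) := by
    intro r h1 h2
    simp only [Fin.lt_def]
    have := Fin.val_ne_of_ne h1
    have : r.val ≠ i.val + 1 := fun e => h2 (Fin.ext e)
    constructor <;> constructor <;> intro _ <;> omega
  simp only [SignCond, e, Function.comp]
  by_cases hp : p = i
  · subst hp
    by_cases hq : q = p
    · subst hq
      simp [hij.symm]
    · by_cases hq' : q = ⟨p.val + 1, h⟩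
      · subst hq'
        simp [hij, hij.symm, hlt, hlt']
        split_ifs <;> omega
      · have := hother q hq hq'
        simp [Equiv.swap_apply_of_ne_of_ne hq hq', hq, hq', this]
  · by_cases hp' : p = ⟨i.val + 1, h⟩
    · subst hp'
      by_cases hq : q = i
      · subst hq
        simp [hij, hij.symm, hlt, hlt']
        split_ifs <;> omega
      · by_cases hq' : q = ⟨i.val + 1, h⟩
        · subst hq'
          simp [hij]
        · have := hother q hq hq'
          simp [Equiv.swap_apply_of_ne_of_ne hq hq', hij, hq, this]
    · have := hother p hp hp'
      by_cases hq : q = i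
      · subst hq
        simp [Equiv.swap_apply_of_ne_of_ne hp hp', hp, hp', this]
      · by_cases hq' : q = ⟨i.val + 1, h⟩
        · subst hq'
          simp [Equiv.swap_apply_of_ne_of_ne hp hp', hp, hp', this]
        · simp [Equiv.swap_apply_of_ne_of_ne hp hp', Equiv.swap_apply_of_ne_of_ne hq hq', hp, hp']

/-- The pairs added by the step were not counted before, so the sign really changes. -/
theorem not_signCond_of_descent {n : ℕ} (i : Fin n) (h : i.val + 1 < n) (a : Fin n → ℤ)
    (ha : a ⟨i.val + 1, h⟩ < a i) :
    (0 < a ⟨i.val + 1, h⟩ → ¬ SignCond a ⟨i.val + 1, h⟩ i) ∧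
      (¬ 0 < a i → ¬ SignCond a i ⟨i.val + 1, h⟩) := by
  constructor
  · intro h1
    simp only [SignCond, if_pos h1, Fin.lt_def]
    omega
  · intro h1
    simp only [SignCond, if_neg h1, Fin.lt_def]
    omega

theorem signEps_reflEps_of_lt {n : ℕ} (i : Fin n) (h : i.val + 1 < n) (a : Fin n → ℤ)
    (ha : a ⟨i.val + 1, h⟩ < a i) (p : Fin n) :
    signEps (reflEps i a) p = signEps a (Equiv.swap i ⟨i.val + 1, h⟩ p) *
      (if (p = i ∧ 0 < a ⟨i.val + 1, h⟩) ∨ (p = ⟨i.val + 1, h⟩ ∧ ¬ 0 < a i) then -1 else 1) := by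
  have hij : (⟨i.val + 1, h⟩ : Fin n) ≠ i := by simp [Fin.ext_iff]
  obtain ⟨d1, d2⟩ := not_signCond_of_descent i h a ha
  set sw := Equiv.swap i ⟨i.val + 1, h⟩ with hsw
  have h1 : signEps a (sw p) = ∏ q, if SignCond a (sw p) (sw q) then (-1 : ℂ) else 1 :=
    (Equiv.prod_comp sw fun q => if SignCond a (sw p) q then (-1 : ℂ) else 1).symm
  have h2 : (if (p = i ∧ 0 < a ⟨i.val + 1, h⟩) ∨ (p = ⟨i.val + 1, h⟩ ∧ ¬ 0 < a i) then (-1 : ℂ)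
      else 1) = ∏ q, if q = sw p then (if (p = i ∧ 0 < a ⟨i.val + 1, h⟩) ∨
        (p = ⟨i.val + 1, h⟩ ∧ ¬ 0 < a i) then (-1 : ℂ) else 1) else 1 := by
    simp
  rw [h1, h2, signEps, ← Finset.prod_mul_distrib]
  refine Finset.prod_congr rfl fun q _ => ?_
  simp only [signCond_reflEps_of_lt i h a ha p q, ← hsw]
  by_cases hp : p = i
  · subst hp
    have : sw p = ⟨p.val + 1, h⟩ := by simp [hsw]
    rw [this]
    by_cases hq : q = ⟨p.val + 1, h⟩
    · subst hq
      have : sw ⟨p.val + 1, h⟩ = p := by simp [hsw]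
      rw [this]
      by_cases h0 : 0 < a ⟨p.val + 1, h⟩
      · simp [h0, d1 h0]
      · simp [h0, hij.symm]
    · simp [hq, hij.symm]
  · by_cases hp' : p = ⟨i.val + 1, h⟩
    · subst hp'
      have : sw ⟨i.val + 1, h⟩ = i := by simp [hsw]
      rw [this]
      by_cases hq : q = i
      · subst hq
        have : sw q = ⟨q.val + 1, h⟩ := by simp [hsw]
        rw [this]
        by_cases h0 : 0 < a q
        · simp [h0, hij]
        · simp [h0, d2 h0]
      · simp [hq, hij]
    · simp [hp, hp']

/-- The two branches of `SignCond` are matched for this: at the last place every other `q` lies to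
the left, and negating the entry exchanges the branches without changing the condition. -/
theorem signEps_reflEps_of_last {n : ℕ} (i : Fin n) (h : i.val + 1 = n) (a : Fin n → ℤ)
    (ha : 0 < a i) (p : Fin n) : signEps (reflEps i a) p = signEps a p := by
  have hcond : ∀ q, SignCond (reflEps i a) p q ↔ SignCond a p q := by
    intro q
    have hpn := p.2
    have hqn := q.2
    simp only [SignCond, reflEps_of_last i h]
    by_cases hp : p = i
    · subst hp
      by_cases hq : q = p
      · subst hq
        simp [ha]
      · have := Fin.val_ne_of_ne hq
        have h1 : q < p := by rw [Fin.lt_def]; omega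
        simp [ha, hq, h1, not_lt.2 h1.le, not_lt.2 ha.le]
    · have := Fin.val_ne_of_ne hp
      have h1 : p < i := by rw [Fin.lt_def]; omega
      by_cases hq : q = i
      · subst hq
        simp [hp, h1, not_lt.2 h1.le]
        intro _
        omega
      · simp [hp, hq]
  simp only [signEps, hcond]

/-- The product of the representatives of the letters of a word. -/
noncomputable def wordLift {n : ℕ} (l : List (Fin n)) : G n := (l.map sBar).prod

theorem wordLift_cons_inv {n : ℕ} (i : Fin n) (l : List (Fin n)) :
    (wordLift (i :: l))⁻¹ = (wordLift l)⁻¹ * reflElt i 1 := by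
  rw [wordLift, List.map_cons, List.prod_cons, mul_inv_rev, sBar_inv]
  rfl

/-- Peeling off the first letter, the sign in the matrix of `reflElt i 1` is the one recorded by
`signEps`. The ascent condition is what makes the sign depend on the resulting signed permutation
alone. -/
theorem vecAct_wordLift_inv {n : ℕ} {l : List (Fin n)} (hl : Ascending l) :
    ∀ (f : VecIdx n → ℂ) (p j : Fin n),
      (wordEps l (stdEps n) p = stdEps n j ∨ wordEps l (stdEps n) p = -stdEps n j) →
      vecAct (wordLift l)⁻¹ f (.inl j) = signEps (wordEps l (stdEps n)) p *
        f (if 0 < wordEps l (stdEps n) p then .inl p else .inr (.inr p)) := by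
  induction l with
  | nil =>
    intro f p j hpj
    have hp := stdEps_pos p
    have hj := stdEps_pos j
    change stdEps n p = stdEps n j ∨ stdEps n p = -stdEps n j at hpj
    have : p = j := Fin.ext (by simp only [stdEps] at *; omega)
    subst this
    have h1 : signEps (stdEps n) p = 1 := by
      refine Finset.prod_eq_one fun q _ => if_neg ?_
      have hq := stdEps_pos q
      rw [SignCond, if_pos hp]
      rintro (h | ⟨h1, h2⟩)
      · omega
      · rw [Fin.lt_def] at h1
        simp only [stdEps] at h2
        omega
    change vecAct (wordLift [])⁻¹ f _ = signEps (stdEps n) p * f (if 0 < stdEps n p then _ else _)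
    rw [h1, if_pos hp, show wordLift ([] : List (Fin n)) = 1 from rfl, inv_one, vecAct_one, one_mul]
  | cons i l ih =>
    intro f p j hpj
    obtain ⟨hi, hl⟩ := hl
    set a := wordEps l (stdEps n) with ha
    have ea : wordEps (i :: l) (stdEps n) = reflEps i a := rfl
    rw [ea] at hpj ⊢
    rw [wordLift_cons_inv, vecAct_mul]
    by_cases h : i.val + 1 < n
    · rw [ofEps_of_lt i h] at hi
      have hij : (⟨i.val + 1, h⟩ : Fin n) ≠ i := by simp [Fin.ext_iff]
      have e : reflEps i a p = a (Equiv.swap i ⟨i.val + 1, h⟩ p) := by simp [reflEps, h]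
      rw [e] at hpj ⊢
      rw [ih hl _ (Equiv.swap i ⟨i.val + 1, h⟩ p) j hpj, signEps_reflEps_of_lt i h a (by omega),
        mul_assoc]
      congr 1
      rw [vecAct_reflElt_of_lt i h one_ne_zero]
      by_cases hp : p = i
      · subst hp
        by_cases h0 : 0 < a ⟨p.val + 1, h⟩
        · simp [h0, hij]
        · simp [h0, hij, hij.symm]
      · by_cases hp' : p = ⟨i.val + 1, h⟩
        · subst hp'
          by_cases h0 : 0 < a i
          · simp [h0, hij]
          · simp [h0]
        · have hp'' : p.val ≠ i.val + 1 := fun e => hp' (Fin.ext e)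
          rw [Equiv.swap_apply_of_ne_of_ne hp hp']
          by_cases h0 : 0 < a p
          · simp [h0, hp, hp', hp'']
          · simp [h0, hp, hp', hp'']
    · have hin := i.2
      have h' : i.val + 1 = n := by omega
      rw [ofEps_of_last i h'] at hi
      rw [signEps_reflEps_of_last i h' a (by omega)]
      rw [reflEps_of_last i h'] at hpj ⊢
      rw [ih hl _ p j (by
        split_ifs at hpj with hp
        · rw [hp]; omega
        · exact hpj)]
      congr 1
      rw [vecAct_reflElt_of_last i h' one_ne_zero]
      by_cases hp : p = i
      · subst hp
        have h0 : 0 < a p := by omega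
        simp [h0, not_lt.2 h0.le]
      · by_cases h0 : 0 < a p
        · simp [h0, hp]
        · simp [h0, hp]

/-- The only negative entries of `reflElt i 1` that could be met belong to `(-, +)` at the places
`i`, `i + 1`, or to `-` at the last place. An ascent excludes both, so no sign appears. -/
theorem spinAct_wordLift_inv {n : ℕ} {l : List (Fin n)} (hl : Ascending l) :
    ∀ f : SpinIdx n → ℂ, spinAct (wordLift l)⁻¹ f (fun _ => true) =
      f fun p => decide (0 < wordEps l (stdEps n) p) := by
  induction l with
  | nil =>
    intro f
    rw [show wordLift ([] : List (Fin n)) = 1 from rfl, inv_one, spinAct_one]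
    congr 1
    funext p
    exact (decide_eq_true (stdEps_pos p)).symm
  | cons i l ih =>
    intro f
    obtain ⟨hi, hl⟩ := hl
    set a := wordEps l (stdEps n) with ha
    have ea : wordEps (i :: l) (stdEps n) = reflEps i a := rfl
    rw [ea, wordLift_cons_inv, spinAct_mul, ih hl]
    by_cases h : i.val + 1 < n
    · rw [ofEps_of_lt i h] at hi
      have hij : i ≠ ⟨i.val + 1, h⟩ := by simp [Fin.ext_iff]
      rw [spinAct_reflElt_of_lt i h one_ne_zero]
      simp only [decide_eq_true_eq, decide_eq_false_iff_not]
      split_ifs with h1 h2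
      · rw [one_mul]
        congr 1
        funext p
        rw [reflEps_of_lt i h]
        by_cases hp : p = i
        · subst hp
          simp [upd2_fst hij, h1]
        · by_cases hp' : p.val = i.val + 1
          · obtain rfl : p = ⟨i.val + 1, h⟩ := Fin.ext hp'
            simp [upd2, hp, h1]
          · have hp'' : p ≠ ⟨i.val + 1, h⟩ := fun e => hp' (congrArg Fin.val e)
            simp [upd2, hp, hp', hp'']
      · omega
      · congr 1
        funext p
        rw [reflEps_of_lt i h]
        split_ifs with hp hp'
        · rw [hp]
          congr 1
          apply propext
          omega
        · obtain rfl : p = ⟨i.val + 1, h⟩ := Fin.ext hp'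
          congr 1
          apply propext
          omega
        · rfl
    · have hin := i.2
      have h' : i.val + 1 = n := by omega
      rw [ofEps_of_last i h'] at hi
      rw [spinAct_reflElt_of_last i h' one_ne_zero]
      have h0 : 0 < a i := by omega
      simp only [decide_eq_true_eq, if_pos h0, one_mul]
      congr 1
      funext p
      rw [reflEps_of_last i h', Function.update_apply]
      split_ifs with hp
      · simp [h0.le]
      · rfl

theorem signEps_neg_stdEps {n : ℕ} (p : Fin n) : signEps (-stdEps n) p = (-1) ^ p.val := by
  have hp := stdEps_pos p
  have : ∀ q, SignCond (-stdEps n) p q ↔ q ∈ Finset.Iio p := by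
    intro q
    rw [SignCond, if_neg (by simp [hp.le]), Finset.mem_Iio]
    refine ⟨And.left, fun h => ⟨h, ?_⟩⟩
    rw [Fin.lt_def] at h
    simp only [Pi.neg_apply, stdEps]
    omega
  simp only [signEps, this]
  rw [Finset.prod_ite_mem, Finset.univ_inter, Finset.prod_const, Fin.card_Iio]

theorem vecAct_weylLift_inv {n : ℕ} {w : Weyl n} (hw : IsLongest w) (f : VecIdx n → ℂ)
    (j : Fin n) :
    vecAct (weylLift w)⁻¹ f (.inl j) = (-1) ^ j.val * f (.inr (.inr j)) := by
  have hr := (exists_reducedWord w).choose_spec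
  have h1 := hw.wordEps hr.1
  have h2 := vecAct_wordLift_inv hr.ascending f j j (by rw [h1]; right; rfl)
  have hj := stdEps_pos j
  rw [h1, signEps_neg_stdEps, if_neg (by simp [hj.le])] at h2
  exact h2

theorem spinAct_weylLift_inv {n : ℕ} {w : Weyl n} (hw : IsLongest w) (f : SpinIdx n → ℂ) :
    spinAct (weylLift w)⁻¹ f (fun _ => true) = f fun _ => false := by
  have hr := (exists_reducedWord w).choose_spec
  have h2 := spinAct_wordLift_inv hr.ascending f
  rw [hw.wordEps hr.1] at h2
  refine h2.trans (congrArg f (funext fun p => ?_))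
  have := stdEps_pos p
  simp [this.le]

theorem weylLift_simpleRefl {n : ℕ} (i : Fin n) : weylLift (simpleRefl i) = sBar i := by
  rw [weylLift, reducedWord_simpleRefl (exists_reducedWord (simpleRefl i)).choose_spec]
  simp

end TypeB

namespace TypeB

/-! ### The factors of `Θ⁻` -/

theorem isDiag_coroot_inv {n : ℕ} (i : Fin n) (c : ℂˣ) :
    IsDiag (coroot i c⁻¹) (cochar i c⁻¹) := isDiag_coroot i _

theorem vecAct_yBold_of_lt {n : ℕ} (i : Fin n) (h : i.val + 1 < n) (c : ℂˣ) (f : VecIdx n → ℂ) :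
    vecAct (yBold i c) f = fun a => match a with
      | .inl p => if p = i then (c : ℂ)⁻¹ * f (.inl i) else
          if p.val = i.val + 1 then c * f (.inl p) + f (.inl i) else f (.inl p)
      | .inr (.inl _) => f (.inr (.inl ()))
      | .inr (.inr p) => if p = i then c * f (.inr (.inr i)) + f (.inr (.inr ⟨i.val + 1, h⟩)) else
          if p.val = i.val + 1 then (c : ℂ)⁻¹ * f (.inr (.inr p)) else f (.inr (.inr p)) := by
  have hij : (⟨i.val + 1, h⟩ : Fin n) ≠ i := by simp [Fin.ext_iff]
  have hd := isDiag_coroot_inv i c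
  have hc := c.ne_zero
  rw [cochar_of_lt i h] at hd
  rw [yBold, vecAct_mul, vecAct_y_of_lt i h]
  funext a
  rcases a with p | _ | p
  · simp only [hd.inl]
    by_cases hp : p = i
    · subst hp
      simp [hij.symm]
    · by_cases hp' : p.val = i.val + 1
      · obtain rfl : p = ⟨i.val + 1, h⟩ := Fin.ext hp'
        simp [hij, hij.symm]
      · have hp'' : p ≠ ⟨i.val + 1, h⟩ := fun e => hp' (congrArg Fin.val e)
        simp [hp, hp', hp'']
  · simp only [hd.mid]
  · simp only [hd.inr]
    by_cases hp : p = i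
    · subst hp
      simp [hij, hij.symm]
    · by_cases hp' : p.val = i.val + 1
      · obtain rfl : p = ⟨i.val + 1, h⟩ := Fin.ext hp'
        simp [hij]
      · have hp'' : p ≠ ⟨i.val + 1, h⟩ := fun e => hp' (congrArg Fin.val e)
        simp [hp, hp', hp'']

theorem vecAct_yBold_of_last {n : ℕ} (i : Fin n) (h : i.val + 1 = n) (c : ℂˣ) (f : VecIdx n → ℂ) :
    vecAct (yBold i c) f = fun a => match a with
      | .inl p => if p = i then ((c : ℂ) ^ 2)⁻¹ * f (.inl i) else f (.inl p)
      | .inr (.inl _) => f (.inr (.inl ())) + (c : ℂ)⁻¹ * f (.inl i)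
      | .inr (.inr p) => if p = i then f (.inl i) + 2 * c * f (.inr (.inl ())) +
          (c : ℂ) ^ 2 * f (.inr (.inr i)) else f (.inr (.inr p)) := by
  have hd := isDiag_coroot_inv i c
  have hc := c.ne_zero
  rw [cochar_of_last i h] at hd
  rw [yBold, vecAct_mul, vecAct_y_of_last i h]
  funext a
  rcases a with p | _ | p
  · simp only [hd.inl]
    by_cases hp : p = i <;> simp [hp]
  · simp only [hd.mid, hd.inl]
    simp
    field_simp
  · simp only [hd.mid, hd.inl, hd.inr]
    by_cases hp : p = i
    · simp [hp]
      ring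
    · simp [hp]

theorem spinAct_yBold_of_lt {n : ℕ} (i : Fin n) (h : i.val + 1 < n) (c : ℂˣ) (f : SpinIdx n → ℂ)
    (s : SpinIdx n) :
    spinAct (yBold i c) f s = if s i = false ∧ s ⟨i.val + 1, h⟩ = true then
        c * f s + f (upd2 s i ⟨i.val + 1, h⟩ true false)
      else if s i = true ∧ s ⟨i.val + 1, h⟩ = false then (c : ℂ)⁻¹ * f s else f s := by
  have hij : i ≠ ⟨i.val + 1, h⟩ := by simp [Fin.ext_iff]
  have hd := isDiag_coroot_inv i c
  have key : ∀ s : SpinIdx n, (∏ p, if s p = true then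
      (Pi.mulSingle i c⁻¹ * Pi.mulSingle ⟨i.val + 1, h⟩ c⁻¹⁻¹ : Fin n → ℂˣ) p else 1) =
      (if s i = true then c⁻¹ else 1) * (if s ⟨i.val + 1, h⟩ = true then c⁻¹⁻¹ else 1) := by
    intro s
    rw [← prod_ite_mulSingle, ← prod_ite_mulSingle, ← Finset.prod_mul_distrib]
    refine Finset.prod_congr rfl fun p _ => ?_
    split_ifs <;> simp
  rw [cochar_of_lt i h] at hd
  rw [yBold, spinAct_mul, spinAct_y_of_lt i h, hd.spin, hd.spin, key, key, upd2_fst hij, upd2_snd]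
  cases h1 : s i <;> cases h2 : s ⟨i.val + 1, h⟩ <;> simp

theorem spinAct_yBold_of_last {n : ℕ} (i : Fin n) (h : i.val + 1 = n) (c : ℂˣ)
    (f : SpinIdx n → ℂ) (s : SpinIdx n) :
    spinAct (yBold i c) f s = if s i = true then (c : ℂ)⁻¹ * f s else
      c * f s + f (Function.update s i true) := by
  have hd := isDiag_coroot_inv i c
  have hc := c.ne_zero
  rw [cochar_of_last i h] at hd
  rw [yBold, spinAct_mul, spinAct_y_of_last i h, hd.spin, hd.spin, prod_ite_mulSingle,
    prod_ite_mulSingle, Function.update_self]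
  cases h1 : s i
  · simp
    field_simp
  · simp
    left
    field_simp

/-- The product of the factors `y_i(d_i) α_i^∨(d_i⁻¹)` over the indices `i > j`. -/
noncomputable def rowTail {n : ℕ} (d : ℕ → ℂˣ) (j : ℕ) : G n :=
  (((List.finRange n).drop j).map fun i => yBold i (d (i.val + 1))).prod

theorem rowTail_of_lt {n : ℕ} (d : ℕ → ℂˣ) (j : Fin n) :
    rowTail d j.val = yBold j (d (j.val + 1)) * rowTail d (j.val + 1) := by
  rw [rowTail, List.drop_eq_getElem_cons (by simp), List.map_cons, List.prod_cons]
  simp [rowTail]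

theorem rowTail_self {n : ℕ} (d : ℕ → ℂˣ) : (rowTail d n : G n) = 1 := by
  rw [rowTail, List.drop_eq_nil_of_le (by simp)]
  rfl

/-- The product of the rows of `Θ⁻` after the first `m`. -/
noncomputable def thetaTail {n : ℕ} (c : ℕ → ℕ → ℂˣ) (m : ℕ) : G n :=
  (((List.finRange n).drop m).map fun p => rowTail (c (p.val + 1)) 0).prod

theorem thetaTail_of_lt {n : ℕ} (c : ℕ → ℕ → ℂˣ) {m : ℕ} (hm : m < n) :
    (thetaTail c m : G n) = rowTail (c (m + 1)) 0 * thetaTail c (m + 1) := by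
  rw [thetaTail, List.drop_eq_getElem_cons (by simpa using hm), List.map_cons, List.prod_cons]
  simp [thetaTail]

theorem thetaTail_self {n : ℕ} (c : ℕ → ℕ → ℂˣ) : (thetaTail c n : G n) = 1 := by
  rw [thetaTail, List.drop_eq_nil_of_le (by simp)]
  rfl

theorem thetaMinus_wordZero {n : ℕ} (c : ℕ → ℕ → ℂˣ) :
    thetaMinus (wordZero n c) = thetaTail c 0 := by
  rw [thetaMinus, wordZero, List.map_flatten, List.prod_flatten, thetaTail, List.drop_zero,
    List.ofFn_eq_map, List.map_map, List.map_map]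
  congr 1
  refine List.map_congr_left fun p _ => ?_
  simp [rowTail, List.ofFn_eq_map, Function.comp_def]

/-! ### The vector representation of a row -/

/-- The functional through which a row factors on the way to the lower half of the basis. -/
noncomputable def rowFun {n : ℕ} (d : ℕ → ℂˣ) (hn : 0 < n) (p : ℕ) (f : VecIdx n → ℂ) : ℂ :=
  f (.inl ⟨n - 1, by omega⟩) + 2 * d n * f (.inr (.inl ())) +
    (d n : ℂ) ^ 2 * f (.inr (.inr ⟨n - 1, by omega⟩)) +
    ∑ b : Fin n, if p ≤ b.val ∧ b.val + 1 < n then (d (b.val + 1) : ℂ) * f (.inr (.inr b)) else 0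

theorem rowFun_of_lt {n : ℕ} (d : ℕ → ℂˣ) (hn : 0 < n) (p : Fin n) (hp : p.val + 1 < n)
    (f : VecIdx n → ℂ) : rowFun d hn p.val f =
      d (p.val + 1) * f (.inr (.inr p)) + rowFun d hn (p.val + 1) f := by
  have : (∑ b : Fin n, if p.val ≤ b.val ∧ b.val + 1 < n then
      (d (b.val + 1) : ℂ) * f (.inr (.inr b)) else 0) = d (p.val + 1) * f (.inr (.inr p)) +
      ∑ b : Fin n, if p.val + 1 ≤ b.val ∧ b.val + 1 < n then
      (d (b.val + 1) : ℂ) * f (.inr (.inr b)) else 0 := by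
    have h2 : (d (p.val + 1) : ℂ) * f (.inr (.inr p)) =
        ∑ b : Fin n, if b = p then (d (b.val + 1) : ℂ) * f (.inr (.inr b)) else 0 := by simp
    rw [h2, ← Finset.sum_add_distrib]
    refine Finset.sum_congr rfl fun b _ => ?_
    by_cases hb : b = p
    · subst hb
      simp [hp]
    · have := Fin.val_ne_of_ne hb
      by_cases h3 : p.val ≤ b.val ∧ b.val + 1 < n
      · rw [if_pos h3, if_neg hb, if_pos (by omega), zero_add]
      · rw [if_neg h3, if_neg hb, if_neg (by omega), zero_add]
  rw [rowFun, rowFun, this]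
  ring

/-- The diagonal factor of a row. -/
noncomputable def rowDiag (n : ℕ) (d : ℕ → ℂˣ) (p : ℕ) : ℂ :=
  if p + 1 < n then (d (p + 1) : ℂ)⁻¹ else ((d (p + 1) : ℂ) ^ 2)⁻¹

/-- The factors act in the order `n, n - 1, …`. On the upper half `f_{p+1}` has acted before `f_p`,
so a vector advances at most one step. On the lower half the order is the favourable one: a vector
can run down to `v_{\bar j}` within one row, which produces the tail sums of `rowFun`. -/
theorem vecAct_rowTail {n : ℕ} (d : ℕ → ℂˣ) (hn : 0 < n) (f : VecIdx n → ℂ) (k : ℕ) :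
    ∀ j : Fin n, j.val + k + 1 = n → vecAct (rowTail d j.val) f = fun a => match a with
      | .inl p => if p < j then f (.inl p) else if p = j then rowDiag n d p * f (.inl p) else
          f (.inl ⟨p.val - 1, by omega⟩) + d p.val * rowDiag n d p * f (.inl p)
      | .inr (.inl _) => f (.inr (.inl ())) + (d n : ℂ)⁻¹ * f (.inl ⟨n - 1, by omega⟩)
      | .inr (.inr p) => if p < j then f (.inr (.inr p)) else if p = j then rowFun d hn p f else
          (d p.val : ℂ)⁻¹ * rowFun d hn p f := by
  induction k with
  | zero =>
    intro j hj
    have e : j = ⟨n - 1, by omega⟩ := Fin.ext (by simp; omega)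
    rw [rowTail_of_lt, show j.val + 1 = n from hj, rowTail_self, mul_one,
      vecAct_yBold_of_last j hj]
    have hlt : ∀ p : Fin n, p ≠ j → p < j := by
      intro p hp
      have := Fin.val_ne_of_ne hp
      rw [Fin.lt_def]
      omega
    funext a
    rcases a with p | _ | p
    · by_cases hp : p = j
      · subst hp
        simp [rowDiag, hj]
      · simp [hp, hlt p hp]
    · simp [e]
    · by_cases hp : p = j
      · subst hp
        have : ∀ b : Fin n, ¬ (p.val ≤ b.val ∧ b.val + 1 < n) := fun b => by omega
        simp only [lt_irrefl, if_true, if_false, rowFun, this, Finset.sum_const_zero, add_zero,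
          ← e]
      · simp [hp, hlt p hp]
  | succ k ih =>
    intro j hj
    have hj1 : j.val + 1 < n := by omega
    have h1 := ih ⟨j.val + 1, hj1⟩ (by simp; omega)
    simp only at h1
    rw [rowTail_of_lt, vecAct_mul, h1, vecAct_yBold_of_lt j hj1]
    have hij : (⟨j.val + 1, hj1⟩ : Fin n) ≠ j := by simp [Fin.ext_iff]
    have hlt : j < ⟨j.val + 1, hj1⟩ := by simp [Fin.lt_def]
    have hlt2 : ∀ p : Fin n, p ≠ j → p ≠ ⟨j.val + 1, hj1⟩ → (p < ⟨j.val + 1, hj1⟩ ↔ p < j) := by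
      intro p hp hp'
      have h2 := Fin.val_ne_of_ne hp
      have h3 : p.val ≠ j.val + 1 := fun e => hp' (Fin.ext e)
      simp only [Fin.lt_def]
      constructor <;> intro _ <;> omega
    funext a
    rcases a with p | _ | p
    · by_cases hp : p = j
      · subst hp
        simp [rowDiag, hj1, hlt]
      · by_cases hp' : p = ⟨j.val + 1, hj1⟩
        · subst hp'
          simp [hij, hlt, not_lt.2 hlt.le]
          ring
        · have h3 : p.val ≠ j.val + 1 := fun e => hp' (Fin.ext e)
          simp [hp, hp', h3, hlt2 p hp hp']
    · rfl
    · by_cases hp : p = j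
      · subst hp
        simp [hlt, rowFun_of_lt d hn p hj1]
      · by_cases hp' : p = ⟨j.val + 1, hj1⟩
        · subst hp'
          simp [hij, not_lt.2 hlt.le]
        · have h3 : p.val ≠ j.val + 1 := fun e => hp' (Fin.ext e)
          simp [hp, hp', h3, hlt2 p hp hp']

/-- The convention `d 0 = 1` lets the first coordinate, which has no preceding factor, obey the
general formula. -/
theorem vecAct_row_inl {n : ℕ} {d : ℕ → ℂˣ} (hd : d 0 = 1) (f : VecIdx n → ℂ) (p : Fin n) :
    vecAct (rowTail d 0) f (.inl p) = (if p.val = 0 then 0 else f (.inl ⟨p.val - 1, by omega⟩)) +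
      d p.val * rowDiag n d p * f (.inl p) := by
  have hn : 0 < n := by have := p.2; omega
  have := vecAct_rowTail d hn f (n - 1) ⟨0, hn⟩ (by simp; omega)
  simp only at this
  rw [this]
  by_cases hp : p.val = 0
  · obtain rfl : p = ⟨0, hn⟩ := Fin.ext hp
    simp [hd]
  · have h1 : p ≠ ⟨0, hn⟩ := fun e => hp (congrArg Fin.val e)
    simp [h1, hp, Fin.lt_def]

theorem vecAct_row_mid {n : ℕ} (d : ℕ → ℂˣ) (hn : 0 < n) (f : VecIdx n → ℂ) :
    vecAct (rowTail d 0) f (.inr (.inl ())) =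
      f (.inr (.inl ())) + (d n : ℂ)⁻¹ * f (.inl ⟨n - 1, by omega⟩) := by
  have := vecAct_rowTail d hn f (n - 1) ⟨0, hn⟩ (by simp; omega)
  simp only at this
  rw [this]

theorem vecAct_row_inr {n : ℕ} {d : ℕ → ℂˣ} (hd : d 0 = 1) (hn : 0 < n) (f : VecIdx n → ℂ)
    (p : Fin n) :
    vecAct (rowTail d 0) f (.inr (.inr p)) = (d p.val : ℂ)⁻¹ * rowFun d hn p f := by
  have := vecAct_rowTail d hn f (n - 1) ⟨0, hn⟩ (by simp; omega)
  simp only at this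
  rw [this]
  by_cases hp : p.val = 0
  · obtain rfl : p = ⟨0, hn⟩ := Fin.ext hp
    simp [hd]
  · have h1 : p ≠ ⟨0, hn⟩ := fun e => hp (congrArg Fin.val e)
    simp [h1, Fin.lt_def]

end TypeB

namespace TypeB

open Matrix

/-! ### Elimination in the vector representation -/

/-- Reversing rows and columns preserves the determinant and turns the successor row into the
predecessor row. -/
theorem det_eq_of_forall_row_eq_add_smul_succ {R : Type*} [CommRing R] {n : ℕ}
    {A B : Matrix (Fin (n + 1)) (Fin (n + 1)) R} (c : Fin n → R)
    (h_last : ∀ j, A (Fin.last n) j = B (Fin.last n) j)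
    (h : ∀ (i : Fin n) (j), A i.castSucc j = B i.castSucc j + c i * A i.succ j) :
    A.det = B.det := by
  rw [← Matrix.det_submatrix_equiv_self Fin.revPerm A,
    ← Matrix.det_submatrix_equiv_self Fin.revPerm B]
  refine Matrix.det_eq_of_forall_row_eq_smul_add_pred (fun i => c i.rev) (fun j => ?_)
    fun i j => ?_
  · simpa using h_last j.rev
  · simpa [Fin.rev_succ, Fin.rev_castSucc] using h i.rev j.rev

/-- Subtracting from each row the next one replaces `rowFun` by `d_{p+1}` times the coefficient
before the row acted; only the last row keeps `rowFun`. The hypotheses on `f 0` make the first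
column `(0, …, 0, 1)`, and expansion along it removes it together with the last row. -/
theorem det_row {n s : ℕ} {d : ℕ → ℂˣ} (hd : d 0 = 1) (hs : s + 1 < n)
    (f : Fin (s + 2) → VecIdx n → ℂ) (h_mid : f 0 (.inr (.inl ())) = 0)
    (h_inr : ∀ p, f 0 (.inr (.inr p)) = 0) (h_last : f 0 (.inl ⟨n - 1, by omega⟩) = 1) :
    det (of fun p q : Fin (s + 2) => (-1) ^ p.val *
        vecAct (rowTail d 0) (f q) (.inr (.inr ⟨p.val, by omega⟩))) =
      det (of fun p q : Fin (s + 1) => (-1) ^ p.val *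
        f q.succ (.inr (.inr ⟨p.val, by omega⟩))) := by
  have hn : 0 < n := by omega
  have h1 : (of fun p q : Fin (s + 2) => (-1 : ℂ) ^ p.val *
      vecAct (rowTail d 0) (f q) (.inr (.inr ⟨p.val, by omega⟩))) =
      of fun p q : Fin (s + 2) => ((-1 : ℂ) ^ p.val * (d p.val : ℂ)⁻¹) *
        (of fun p q : Fin (s + 2) => rowFun d hn p.val (f q)) p q := by
    funext p q
    simp only [of_apply]
    rw [vecAct_row_inr hd hn, mul_assoc]
  set B : Matrix (Fin (s + 2)) (Fin (s + 2)) ℂ := of fun p q =>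
    if p.val = s + 1 then rowFun d hn (s + 1) (f q)
      else d (p.val + 1) * f q (.inr (.inr ⟨p.val, by omega⟩)) with hB
  have h2 : det (of fun p q : Fin (s + 2) => rowFun d hn p.val (f q)) = det B := by
    apply det_eq_of_forall_row_eq_add_smul_succ fun _ => 1
    · intro j
      simp [hB]
    · intro i j
      have hi : i.val ≠ s + 1 := by omega
      have := rowFun_of_lt d hn ⟨i.val, by omega⟩ (by simp; omega) (f j)
      simpa [hB, hi] using this
  have h3 : ∀ i : Fin (s + 2), i ≠ Fin.last (s + 1) → B i 0 = 0 := by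
    intro i hi
    have : i.val ≠ s + 1 := fun e => hi (Fin.ext e)
    simp [hB, this, h_inr]
  have h4 : B (Fin.last (s + 1)) 0 = 1 := by
    simp [hB, rowFun, h_mid, h_inr, h_last]
  have h5 : B.submatrix (Fin.last (s + 1)).succAbove Fin.succ =
      of fun p q : Fin (s + 1) => (d (p.val + 1) : ℂ) *
        (of fun p q : Fin (s + 1) => f q.succ (.inr (.inr ⟨p.val, by omega⟩))) p q := by
    funext p q
    have : p.val ≠ s + 1 := by omega
    simp [hB, this]
  have h6 : det B = (-1) ^ (s + 1) * ((∏ p : Fin (s + 1), (d (p.val + 1) : ℂ)) *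
      det (of fun p q : Fin (s + 1) => f q.succ (.inr (.inr ⟨p.val, by omega⟩)))) := by
    rw [det_succ_column_zero, Finset.sum_eq_single (Fin.last (s + 1)), h4, h5, det_mul_column]
    · simp
    · intro i _ hi
      rw [h3 i hi]
      ring
    · simp
  have h7 : (∏ p : Fin (s + 1), (d (p.val + 1) : ℂ)) ≠ 0 :=
    Finset.prod_ne_zero_iff.2 fun p _ => Units.ne_zero _
  -- Since `d 0 = 1`, the scalars `d_p⁻¹` taken out of the rows cancel the `d_{p+1}` produced by the
  -- subtraction. The surplus sign cancels the sign of the expansion.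
  have h8 : (∏ p : Fin (s + 2), ((-1 : ℂ) ^ p.val * (d p.val : ℂ)⁻¹)) =
      ((∏ p : Fin (s + 1), (-1 : ℂ) ^ p.val) * (-1) ^ (s + 1)) *
        (∏ p : Fin (s + 1), (d (p.val + 1) : ℂ))⁻¹ := by
    rw [Finset.prod_mul_distrib, Fin.prod_univ_castSucc,
      Fin.prod_univ_succ (fun p : Fin (s + 2) => (d p.val : ℂ)⁻¹)]
    simp [hd]
  have h9 : ((-1 : ℂ) ^ (s + 1)) * (-1) ^ (s + 1) = 1 := by
    rw [← mul_pow]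
    simp
  have h10 : det (of fun p q : Fin (s + 1) => (-1) ^ p.val *
      f q.succ (.inr (.inr ⟨p.val, by omega⟩))) = (∏ p : Fin (s + 1), (-1 : ℂ) ^ p.val) *
      det (of fun p q : Fin (s + 1) => f q.succ (.inr (.inr ⟨p.val, by omega⟩))) :=
    det_mul_column (fun p : Fin (s + 1) => (-1 : ℂ) ^ p.val)
      (of fun p q : Fin (s + 1) => f q.succ (.inr (.inr ⟨p.val, by omega⟩)))
  rw [h1, det_mul_column, h2, h6, h8, h10]
  set P := ∏ p : Fin (s + 1), (d (p.val + 1) : ℂ)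
  set Q := ∏ p : Fin (s + 1), (-1 : ℂ) ^ p.val
  set D := det (of fun p q : Fin (s + 1) => f q.succ (.inr (.inr ⟨p.val, by omega⟩)))
  calc Q * (-1) ^ (s + 1) * P⁻¹ * ((-1) ^ (s + 1) * (P * D))
      = Q * ((-1) ^ (s + 1) * (-1) ^ (s + 1)) * (P⁻¹ * P) * D := by ring
    _ = Q * D := by rw [h9, inv_mul_cancel₀ h7]; ring

/-- The image of `v_q` under the rows after the first `m`, as long as it stays in the upper half of
the basis. -/
theorem vecAct_thetaTail {n : ℕ} {c : ℕ → ℕ → ℂˣ} (hc : ∀ m, c m 0 = 1) (q : Fin n) (k : ℕ) :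
    ∀ m, m + k = n → q.val < m →
      vecAct (thetaTail c m) (Pi.single (.inl q) 1) (.inr (.inl ())) = 0 ∧
      (∀ p, vecAct (thetaTail c m) (Pi.single (.inl q) 1) (.inr (.inr p)) = 0) ∧
      (∀ p : Fin n, q.val + k < p.val →
        vecAct (thetaTail c m) (Pi.single (.inl q) 1) (.inl p) = 0) ∧
      (∀ p : Fin n, p.val = q.val + k →
        vecAct (thetaTail c m) (Pi.single (.inl q) 1) (.inl p) = 1) ∧
      (∀ p : Fin n, p.val + 1 = q.val + k →
        vecAct (thetaTail c m) (Pi.single (.inl q) 1) (.inl p) =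
          ∑ j ∈ Finset.Icc (m + 1) n, (c j (q.val + n - j) : ℂ) / (c j (q.val + n - j + 1) : ℂ)) := by
  have hqn := q.2
  induction k with
  | zero =>
    intro m hm hq
    obtain rfl : m = n := by omega
    rw [thetaTail_self, vecAct_one]
    refine ⟨by simp, by simp, fun p hp => ?_, fun p hp => ?_, fun p hp => ?_⟩
    · have : p ≠ q := by rintro rfl; omega
      simp [this]
    · obtain rfl : p = q := Fin.ext hp
      simp
    · have : p ≠ q := by rintro rfl; omega
      simp [this]
  | succ k ih =>
    intro m hm hq
    have hn : 0 < n := by omega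
    obtain ⟨h1, h2, h3, h4, h5⟩ := ih (m + 1) (by omega) (by omega)
    rw [thetaTail_of_lt c (by omega), vecAct_mul]
    set g := vecAct (thetaTail c (m + 1)) (Pi.single (.inl q) 1) with hg
    have h6 : g (.inl ⟨n - 1, by omega⟩) = 0 := h3 _ (by simp; omega)
    refine ⟨?_, fun p => ?_, fun p hp => ?_, fun p hp => ?_, fun p hp => ?_⟩
    · rw [vecAct_row_mid _ hn, h1, h6]
      simp
    · rw [vecAct_row_inr (hc _) hn, rowFun]
      simp [h1, h2, h6]
    · rw [vecAct_row_inl (hc _), if_neg (by omega),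
        h3 ⟨p.val - 1, _⟩ (show q.val + k < p.val - 1 by omega), h3 p (by omega)]
      simp
    · rw [vecAct_row_inl (hc _), if_neg (by omega),
        h4 ⟨p.val - 1, _⟩ (show p.val - 1 = q.val + k by omega), h3 p (by omega)]
      simp
    -- The place `p` is not the last one, because its successor is the leading place `q + k + 1` of
    -- this range; so the diagonal factor is not squared.
    · have hr : rowDiag n (c (m + 1)) p = (c (m + 1) (p.val + 1) : ℂ)⁻¹ := if_pos (by omega)
      rw [vecAct_row_inl (hc _), h4 p (by omega), hr,
        ← Finset.add_sum_Ioc_eq_sum_Icc (show m + 1 ≤ n by omega)]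
      have e1 : q.val + n - (m + 1) = p.val := by omega
      rw [e1, add_comm, mul_one, ← div_eq_mul_inv]
      congr 1
      rw [← Finset.Icc_add_one_left_eq_Ioc]
      split_ifs with h0
      · rw [Finset.Icc_eq_empty (by omega), Finset.sum_empty]
      · exact h5 _ (by simp; omega)

theorem vecAct_sBar_inl {n : ℕ} (i : Fin n) (h : i.val + 1 < n) (q : Fin n) (hq : q ≤ i) :
    vecAct (sBar i) (Pi.single (.inl q) 1) =
      Pi.single (.inl (if q = i then ⟨i.val + 1, h⟩ else q)) 1 := by
  have hij : (⟨i.val + 1, h⟩ : Fin n) ≠ i := by simp [Fin.ext_iff]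
  rw [sBar_eq_reflElt, vecAct_reflElt_of_lt i h (by norm_num)]
  rw [Fin.le_def] at hq
  funext a
  rcases a with p | _ | p
  · by_cases hqi : q = i
    · subst hqi
      by_cases hp : p = q
      · subst hp
        simp [hij, hij.symm]
      · by_cases hp' : p.val = q.val + 1
        · obtain rfl : p = ⟨q.val + 1, h⟩ := Fin.ext hp'
          simp [hij]
        · have hp'' : p ≠ ⟨q.val + 1, h⟩ := fun e => hp' (congrArg Fin.val e)
          simp [hp, hp', hp'']
    · have h1 : (⟨i.val + 1, h⟩ : Fin n) ≠ q := fun e => by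
        have := congrArg Fin.val e
        simp at this
        omega
      by_cases hp : p = i
      · subst hp
        simp [hqi, h1, Ne.symm hqi]
      · by_cases hp' : p.val = i.val + 1
        · obtain rfl : p = ⟨i.val + 1, h⟩ := Fin.ext hp'
          simp [hqi, hij, h1, Ne.symm hqi]
        · simp [hp, hp', hqi]
  · simp
  · simp

/-- Each application of `det_row` strips the first remaining row of `Θ⁻` and the first column. The
last column, `v_r`, survives to the end. -/
theorem det_thetaTail {n : ℕ} {c : ℕ → ℕ → ℂˣ} (hc : ∀ m, c m 0 = 1) (r : Fin n) (s : ℕ) :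
    ∀ m, (hm : m + s < n) →
    det (of fun p q : Fin (s + 1) => (-1) ^ p.val *
      vecAct (thetaTail c m) (Pi.single (.inl (if q.val = s then r else ⟨m + q.val, by omega⟩)) 1)
        (.inr (.inr ⟨p.val, by omega⟩))) =
      vecAct (thetaTail c (m + s)) (Pi.single (.inl r) 1) (.inr (.inr ⟨0, by omega⟩)) := by
  induction s with
  | zero =>
    intro m hm
    simp
  | succ s ih =>
    intro m hm
    -- The `n - m - 1` rows after row `m + 1` are just enough to take the basis vector with index
    -- `m` to the last index, with coefficient `1` and still without a middle or lower part.
    have key := vecAct_thetaTail hc (⟨m, by omega⟩ : Fin n) (n - (m + 1)) (m + 1) (by omega) (by simp)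
    obtain ⟨h1, h2, -, h4, -⟩ := key
    have h5 := det_row (hc (m + 1)) (show s + 1 < n by omega)
      (fun q : Fin (s + 2) => vecAct (thetaTail c (m + 1))
        (Pi.single (.inl (if q.val = s + 1 then r else ⟨m + q.val, by omega⟩)) 1))
      (by simpa using h1) (by simpa using h2)
      (by simpa using h4 ⟨n - 1, by omega⟩ (by simp; omega))
    simp only [← vecAct_mul] at h5
    rw [← thetaTail_of_lt c (by omega)] at h5
    rw [h5]
    have h6 := ih (m + 1) (by omega)
    have e : m + 1 + s = m + (s + 1) := by omega
    simp only [e] at h6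
    rw [← h6]
    congr 1
    funext p q
    simp only [of_apply, Fin.val_succ, add_left_inj]
    have e' : m + (q.val + 1) = m + 1 + q.val := by omega
    simp only [e']

theorem sum_fin_ite_eq {n : ℕ} (hn : 2 ≤ n) (F : ℕ → ℂ) :
    (∑ b : Fin n, if b.val + 1 < n then F (b.val + 1) else 0) =
      F 1 + ∑ j ∈ Finset.Icc 2 (n - 1), F j := by
  obtain ⟨N, rfl⟩ : ∃ N, n = N + 2 := ⟨n - 2, by omega⟩
  rw [Fin.sum_univ_eq_sum_range (fun b => if b + 1 < N + 2 then F (b + 1) else 0),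
    Finset.sum_range_succ, if_neg (by omega), add_zero, Finset.sum_range_succ', add_comm]
  congr 1
  rw [show N + 2 - 1 = N + 1 by omega, Finset.range_eq_Ico]
  have : ∑ j ∈ Finset.Icc 2 (N + 1), F j = ∑ j ∈ Finset.Ico (0 + 2) (N + 2), F j := rfl
  rw [this, ← Finset.sum_Ico_add']
  refine Finset.sum_congr rfl fun b hb => ?_
  rw [Finset.mem_Ico] at hb
  rw [if_pos (by omega)]

/-- The formula for the indices `k < n`, for parameters normalized at the index zero. -/
theorem vecAct_thetaTail_corner {n : ℕ} {c : ℕ → ℕ → ℂˣ} (hc : ∀ m, c m 0 = 1) (k : ℕ)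
    (hk : 1 ≤ k) (hkn : k < n) :
    vecAct (thetaTail c (k - 1)) (Pi.single (.inl (⟨k, hkn⟩ : Fin n)) 1)
        (.inr (.inr ⟨0, by omega⟩)) =
      (c k 1 : ℂ) + ∑ j ∈ Finset.Icc 2 (n - 1), (c k j : ℂ) / (c (k + 1) (j - 1) : ℂ)
          + (c k n : ℂ) ^ 2 / (c (k + 1) (n - 1) : ℂ)
          + 2 * ((c k n : ℂ) / (c (k + 1) n : ℂ))
          + (c (k + 1) (n - 1) : ℂ) / (c (k + 1) n : ℂ) ^ 2
          + ∑ m ∈ Finset.Icc (k + 2) n,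
              (c m (n + k - m) : ℂ) / (c m (n + k - m + 1) : ℂ) := by
  have hn : 0 < n := by omega
  obtain ⟨h1, h2, -, h4, h5⟩ := vecAct_thetaTail hc ⟨k, hkn⟩ (n - (k + 1)) (k + 1) (by omega)
    (by simp)
  rw [thetaTail_of_lt c (show k - 1 < n by omega), vecAct_mul, show k - 1 + 1 = k by omega,
    thetaTail_of_lt c hkn, vecAct_mul]
  set g := vecAct (thetaTail c (k + 1)) (Pi.single (.inl (⟨k, hkn⟩ : Fin n)) 1) with hg
  have h6 : g (.inl ⟨n - 1, by omega⟩) = 1 := h4 _ (by simp; omega)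
  have h7 := h5 ⟨n - 2, by omega⟩ (by simp; omega)
  -- Only the `v_n`-coefficient of `g` enters, so after row `k + 1` the coefficient at a lower
  -- vector is a single inverse parameter.
  have h8 : ∀ p, rowFun (c (k + 1)) hn p g = 1 := by
    intro p
    simp [rowFun, h1, h2, h6]
  rw [vecAct_row_inr (hc k) hn, rowFun, vecAct_row_mid _ hn, vecAct_row_inl (hc _), h6, h1]
  simp only [vecAct_row_inr (hc _) hn, h8, zero_le, true_and]
  have e1 : n - 1 + 1 = n := by omega
  -- The term `j = 1` has denominator `c (k + 1) 0 = 1` and becomes the isolated summand `c k 1`.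
  have h9 := sum_fin_ite_eq (show 2 ≤ n by omega)
    fun j => (c k j : ℂ) * ((c (k + 1) (j - 1) : ℂ)⁻¹ * 1)
  simp only [Nat.add_sub_cancel] at h9
  rw [h9, if_neg (by omega)]
  have e2 : (⟨n - 1 - 1, by omega⟩ : Fin n) = ⟨n - 2, by omega⟩ := by
    apply Fin.ext
    simp
    omega
  rw [e2, h7]
  simp only [rowDiag, e1, lt_irrefl, if_false, hc, Nat.sub_self, Units.val_one, inv_one, mul_one,
    one_mul, div_eq_mul_inv, add_comm k n, zero_add]
  rw [show k + 1 + 1 = k + 2 from rfl]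
  ring

theorem leadingMinor_thetaMinus {n : ℕ} {c : ℕ → ℕ → ℂˣ} (hc : ∀ m, c m 0 = 1) {w : Weyl n}
    (hw : IsLongest w) (i : Fin n) (hi : i.val + 1 < n) :
    leadingMinor i ((weylLift w)⁻¹ * thetaMinus (wordZero n c) * weylLift (simpleRefl i)) =
      vecAct (thetaTail c i.val) (Pi.single (.inl (⟨i.val + 1, hi⟩ : Fin n)) 1)
        (.inr (.inr ⟨0, by omega⟩)) := by
  have h := det_thetaTail hc ⟨i.val + 1, hi⟩ i.val 0 (by omega)
  simp only [zero_add] at h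
  rw [← h, leadingMinor]
  congr 1
  funext p q
  rw [of_apply, of_apply, vecEntry, vecAct_mul, vecAct_mul, vecAct_weylLift_inv hw,
    weylLift_simpleRefl, vecAct_sBar_inl i hi _ (by rw [Fin.le_def]; have := q.2; simp; omega),
    thetaMinus_wordZero]
  simp only [Fin.ext_iff]

end TypeB

namespace TypeB

/-! ### The spin representation of a row -/

/-- The number of minus signs. -/
def minusCount {n : ℕ} (s : SpinIdx n) : ℕ := ∑ p, if s p = true then 0 else 1

theorem minusCount_update_true {n : ℕ} {s : SpinIdx n} {i : Fin n} (hs : s i = false) :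
    minusCount s = minusCount (Function.update s i true) + 1 := by
  rw [minusCount, minusCount, ← Finset.add_sum_erase _ _ (Finset.mem_univ i),
    ← Finset.add_sum_erase (a := i) (s := Finset.univ)
      (f := fun p => if Function.update s i true p = true then 0 else 1) (Finset.mem_univ i)]
  simp only [hs, Function.update_self, Bool.false_eq_true, if_true, if_false, zero_add]
  rw [add_comm]
  congr 1
  refine Finset.sum_congr rfl fun p hp => ?_
  rw [Function.update_of_ne (Finset.ne_of_mem_erase hp)]

theorem minusCount_upd2 {n : ℕ} {s : SpinIdx n} {i j : Fin n} (hij : i ≠ j) (hi : s i = false)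
    (hj : s j = true) : minusCount (upd2 s i j true false) = minusCount s := by
  rw [minusCount_update_true hi, minusCount_update_true (s := upd2 s i j true false) (i := j)
    (upd2_snd _ _ _ _ _), upd2, Function.update_idem,
    Function.update_eq_self_iff.2 (by rw [Function.update_of_ne hij.symm, hj])]

/-- The sign sequence that starts with `t` minus signs. -/
def minusFirst (n t : ℕ) : SpinIdx n := fun p => decide (t ≤ p.val)

theorem minusFirst_succ {n : ℕ} (t : Fin n) :
    minusFirst n (t.val + 1) = Function.update (minusFirst n t.val) t false := by
  funext p
  rw [Function.update_apply]
  split_ifs with h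
  · simp [minusFirst, h]
  · have := Fin.val_ne_of_ne h
    simp only [minusFirst]
    congr 1
    apply propext
    omega

theorem minusCount_update_minusFirst {n t : ℕ} {j : Fin n} (hj : t ≤ j.val) :
    minusCount (Function.update (minusFirst n t) j false) = minusCount (minusFirst n t) + 1 := by
  rw [minusCount_update_true (i := j) (by simp), Function.update_idem,
    update_eq_self_of_eq (by simpa [minusFirst] using hj)]

theorem minusCount_minusFirst {n : ℕ} (t : ℕ) (ht : t ≤ n) : minusCount (minusFirst n t) = t := by
  induction t with
  | zero => simp [minusCount, minusFirst]
  | succ t ih =>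
    have := minusFirst_succ (⟨t, ht⟩ : Fin n)
    simp only at this
    rw [this, minusCount_update_minusFirst (t := t) (j := ⟨t, ht⟩) le_rfl, ih (by omega)]

/-- A factor of index `i` feeds something new into the coordinate `s` only if `s` has a minus at
place `i`; here the factors act on it diagonally. -/
theorem spinAct_rowTail_eq_zero {n : ℕ} (d : ℕ → ℂˣ) {f : SpinIdx n → ℂ} {s : SpinIdx n}
    (hf : f s = 0) (k : ℕ) : ∀ j, j + k = n → (∀ p : Fin n, j ≤ p.val → s p = true) →
      spinAct (rowTail d j) f s = 0 := by
  induction k with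
  | zero =>
    intro j hj _
    obtain rfl : j = n := by omega
    rw [rowTail_self, spinAct_one, hf]
  | succ k ih =>
    intro j hj hs
    have h1 := rowTail_of_lt d (⟨j, by omega⟩ : Fin n)
    simp only at h1
    have h2 := ih (j + 1) (by omega) fun p hp => hs p (by omega)
    rw [h1, spinAct_mul]
    have h3 := hs ⟨j, by omega⟩ le_rfl
    by_cases h : j + 1 < n
    · rw [spinAct_yBold_of_lt _ h, h2, hs ⟨j + 1, h⟩ (by simp), h3]
      simp
    · rw [spinAct_yBold_of_last _ (by simp; omega), h2, if_pos h3, mul_zero]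

/-- Traced backwards, the extra minus sign at place `j` was moved there from `j + 1`, since by
`spinAct_rowTail_eq_zero` it was not there before. At the last place it was either already present,
with factor `d n`, or created by `f_n`. -/
theorem spinAct_rowTail_update {n : ℕ} (d : ℕ → ℂˣ) (hn : 0 < n) {f : SpinIdx n → ℂ} {t : ℕ}
    (hf : ∀ j : Fin n, t ≤ j.val → j.val + 1 < n → f (Function.update (minusFirst n t) j false) = 0)
    (k : ℕ) : ∀ j : Fin n, j.val + k + 1 = n → t ≤ j.val →
      spinAct (rowTail d j.val) f (Function.update (minusFirst n t) j false) =
        d n * f (Function.update (minusFirst n t) ⟨n - 1, by omega⟩ false) +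
          f (minusFirst n t) := by
  induction k with
  | zero =>
    intro j hj ht
    have e : j = ⟨n - 1, by omega⟩ := Fin.ext (by simp; omega)
    rw [rowTail_of_lt, show j.val + 1 = n from hj, rowTail_self, mul_one,
      spinAct_yBold_of_last j hj, if_neg (by simp), Function.update_idem,
      update_eq_self_of_eq (s := minusFirst n t) (i := j) (a := true)
        (by simpa [minusFirst] using ht), ← e]
  | succ k ih =>
    intro j hj ht
    have hj1 : j.val + 1 < n := by omega
    have hij : (⟨j.val + 1, hj1⟩ : Fin n) ≠ j := by simp [Fin.ext_iff]
    have h1 := ih ⟨j.val + 1, hj1⟩ (by simp; omega) (by simp; omega)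
    have h2 := spinAct_rowTail_eq_zero d (hf j ht hj1) (n - (j.val + 1)) (j.val + 1) (by omega)
      fun p hp => by
        have : p ≠ j := by rintro rfl; omega
        rw [Function.update_of_ne this]
        simp only [minusFirst]
        exact decide_eq_true (by omega)
    have h3 : minusFirst n t ⟨j.val + 1, hj1⟩ = true := decide_eq_true (by simp; omega)
    rw [rowTail_of_lt, spinAct_mul, spinAct_yBold_of_lt j hj1, h2, if_pos (by simp [hij, h3]), upd2,
      Function.update_idem, update_eq_self_of_eq (s := minusFirst n t) (i := j) (a := true)
        (by simpa [minusFirst] using ht), h1]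
    simp

/-- The factors before `t` meet two minus signs at their places and do nothing; the others are
covered by `spinAct_rowTail_update`. -/
theorem spinAct_row_minusFirst {n : ℕ} (d : ℕ → ℂˣ) {f : SpinIdx n → ℂ} (t : Fin n)
    (hf : ∀ j : Fin n, t.val ≤ j.val → j.val + 1 < n →
      f (Function.update (minusFirst n t) j false) = 0) :
    spinAct (rowTail d 0) f (minusFirst n (t.val + 1)) =
      d n * f (Function.update (minusFirst n t) ⟨n - 1, by have := t.2; omega⟩ false) +
        f (minusFirst n t) := by
  have ht := t.2
  rw [← spinAct_rowTail_update d (by omega) hf (n - 1 - t.val) t (by omega) le_rfl,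
    ← minusFirst_succ]
  have : ∀ j, j ≤ t.val → spinAct (rowTail d 0) f (minusFirst n (t.val + 1)) =
      spinAct (rowTail d j) f (minusFirst n (t.val + 1)) := by
    intro j
    induction j with
    | zero => intro _; rfl
    | succ j ih =>
      intro hj
      have h1 := rowTail_of_lt d (⟨j, by omega⟩ : Fin n)
      simp only at h1
      rw [ih (by omega), h1, spinAct_mul, spinAct_yBold_of_lt _ (by simp; omega),
        if_neg (by simp [minusFirst]; omega), if_neg (by simp [minusFirst]; omega)]
  exact this t.val le_rfl

/-- Factors of index less than `n` only exchange neighbouring signs, so a bound on the number of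
minus signs passes from the last factor to the whole tail. -/
theorem spinAct_rowTail_support {n : ℕ} (d : ℕ → ℂˣ) {f : SpinIdx n → ℂ} {a : ℕ}
    (hf : ∀ s, a < minusCount s → spinAct (rowTail d (n - 1)) f s = 0) (k : ℕ) :
    ∀ j, j + k + 1 = n → ∀ s, a < minusCount s → spinAct (rowTail d j) f s = 0 := by
  induction k with
  | zero =>
    intro j hj
    obtain rfl : j = n - 1 := by omega
    exact hf
  | succ k ih =>
    intro j hj s hs
    have h1 := rowTail_of_lt d (⟨j, by omega⟩ : Fin n)
    have hj1 : j + 1 < n := by omega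
    have hij : (⟨j, by omega⟩ : Fin n) ≠ ⟨j + 1, hj1⟩ := by simp
    simp only at h1
    have h2 := ih (j + 1) (by omega)
    rw [h1, spinAct_mul, spinAct_yBold_of_lt _ hj1]
    split_ifs with h3
    · rw [h2 s hs, h2 _ (by rw [minusCount_upd2 hij h3.1 h3.2]; exact hs)]
      simp
    · rw [h2 s hs, mul_zero]
    · exact h2 s hs

theorem spinAct_row_support {n : ℕ} (d : ℕ → ℂˣ) (hn : 0 < n) {f : SpinIdx n → ℂ} {a : ℕ}
    (hf : ∀ s, a < minusCount s → f s = 0) (s : SpinIdx n) (hs : a + 1 < minusCount s) :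
    spinAct (rowTail d 0) f s = 0 := by
  refine spinAct_rowTail_support d (a := a + 1) ?_ (n - 1) 0 (by omega) s hs
  intro s hs
  have h1 := rowTail_of_lt d (⟨n - 1, by omega⟩ : Fin n)
  simp only at h1
  rw [h1, show n - 1 + 1 = n by omega, rowTail_self, mul_one,
    spinAct_yBold_of_last _ (by simp; omega)]
  split_ifs with h2
  · rw [hf s (by omega), mul_zero]
  · rw [hf s (by omega), hf _ ?_]
    · simp
    · have := minusCount_update_true (Bool.not_eq_true _ ▸ h2)
      omega

/-- The sign sequence whose only minus sign is the last one. -/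
def minusLast (n : ℕ) (hn : 0 < n) : SpinIdx n :=
  Function.update (minusFirst n 0) ⟨n - 1, by omega⟩ false

theorem minusCount_minusLast {n : ℕ} (hn : 0 < n) : minusCount (minusLast n hn) = 1 := by
  rw [minusLast, minusCount_update_minusFirst (by simp), minusCount_minusFirst 0 (by omega)]

/-- The support bound excludes the `d n` term of `spinAct_row_minusFirst` in every row but the last,
so the coefficient is passed on unchanged. In row `n` it is the other term that vanishes, and `c n
n` enters. -/
theorem spinAct_thetaTail {n : ℕ} (c : ℕ → ℕ → ℂˣ) (hn : 0 < n) (k : ℕ) :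
    ∀ m, m + k + 1 = n →
      spinAct (thetaTail c m) (Pi.single (minusLast n hn) 1) (minusFirst n (k + 1)) = c n n ∧
      ∀ s, k + 1 < minusCount s → spinAct (thetaTail c m) (Pi.single (minusLast n hn) 1) s = 0 := by
  induction k with
  | zero =>
    intro m hm
    rw [thetaTail_of_lt c (by omega), show m + 1 = n by omega, thetaTail_self, mul_one]
    constructor
    · have h1 := spinAct_row_minusFirst (c n) (f := Pi.single (minusLast n hn) 1) (⟨0, hn⟩ : Fin n)
        fun j _ hj => by
          have : Function.update (minusFirst n 0) j false ≠ minusLast n hn := by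
            intro e
            have h2 := congrFun e ⟨n - 1, by omega⟩
            have h3 : (⟨n - 1, by omega⟩ : Fin n) ≠ j := by
              intro e'
              have := congrArg Fin.val e'
              simp only at this
              omega
            simp [minusLast, h3, minusFirst] at h2
          simp [this]
      have h2 : minusFirst n 0 ≠ minusLast n hn := by
        intro e
        have h3 := congrFun e ⟨n - 1, by omega⟩
        simp [minusLast, minusFirst] at h3
      simp only at h1
      rw [h1, ← minusLast.eq_1 n hn]
      simp [h2]
    · refine spinAct_rowTail_support (c n) ?_ (n - 1) 0 (by omega)
      intro s hs
      have h1 := rowTail_of_lt (c n) (⟨n - 1, by omega⟩ : Fin n)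
      simp only at h1
      have h2 : s ≠ minusLast n hn := by
        rintro rfl
        rw [minusCount_minusLast] at hs
        omega
      rw [h1, show n - 1 + 1 = n by omega, rowTail_self, mul_one,
        spinAct_yBold_of_last _ (by simp; omega)]
      have h3 : Function.update s ⟨n - 1, by omega⟩ true ≠ minusLast n hn := by
        intro e
        have h4 := congrFun e ⟨n - 1, by omega⟩
        simp [minusLast] at h4
      simp [h2, h3]
  | succ k ih =>
    intro m hm
    obtain ⟨h1, h2⟩ := ih (m + 1) (by omega)
    rw [thetaTail_of_lt c (by omega)]
    simp only [spinAct_mul]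
    constructor
    · have h3 : ∀ j : Fin n, k + 1 ≤ j.val →
          spinAct (thetaTail c (m + 1)) (Pi.single (minusLast n hn) 1)
            (Function.update (minusFirst n (k + 1)) j false) = 0 := by
        intro j hj
        apply h2
        rw [minusCount_update_minusFirst hj, minusCount_minusFirst _ (by omega)]
        omega
      have h4 := spinAct_row_minusFirst (c (m + 1)) (⟨k + 1, by omega⟩ : Fin n)
        (fun j hj _ => h3 j hj)
      simp only at h4
      rw [h4, h3 _ (by simp; omega), h1]
      simp
    · exact spinAct_row_support _ hn h2

/-! ### The minor for `k = n`, and the conclusion -/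

theorem spinAct_sBar_top {n : ℕ} (i : Fin n) (hi : i.val + 1 = n) :
    spinAct (sBar i) (Pi.single (fun _ => true) 1) =
      Pi.single (minusLast n (by omega)) 1 := by
  have hi' : (⟨n - 1, by omega⟩ : Fin n) = i := Fin.ext (by simp; omega)
  have h0 : minusLast n (by omega) = Function.update (fun _ => true) i false := by
    rw [minusLast, hi']
    congr 1
  rw [h0, sBar_eq_reflElt]
  funext s
  rw [spinAct_reflElt_of_last i hi (by norm_num)]
  split_ifs with hs
  · have h1 : Function.update s i false ≠ fun _ => true := fun e => by simpa using congrFun e i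
    have h2 : s ≠ Function.update (fun _ => true) i false := fun e => by
      rw [e] at hs
      simp at hs
    simp [h1, h2]
  · have h1 : (Function.update s i true = fun _ => true) ↔
        s = Function.update (fun _ => true) i false := by
      constructor
      · intro e
        rw [← e, Function.update_idem, update_eq_self_of_eq (by simpa using hs)]
      · intro e
        rw [e, Function.update_idem]
        simp
    simp [Pi.single_apply, h1]

theorem spinCorner_thetaMinus {n : ℕ} (c : ℕ → ℕ → ℂˣ) {w : Weyl n} (hw : IsLongest w) (i : Fin n)
    (hi : i.val + 1 = n) :
    spinCorner ((weylLift w)⁻¹ * thetaMinus (wordZero n c) * weylLift (simpleRefl i)) = c n n := by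
  rw [spinCorner, spinAct_mul, spinAct_mul, spinAct_weylLift_inv hw, weylLift_simpleRefl,
    spinAct_sBar_top i hi, thetaMinus_wordZero]
  have h := (spinAct_thetaTail c (show 0 < n by omega) (n - 1) 0 (by omega)).1
  rw [← h]
  congr 1
  funext p
  simp only [minusFirst]
  exact (decide_eq_false (by omega)).symm

theorem wordZero_congr {n : ℕ} {c c' : ℕ → ℕ → ℂˣ} (h : ∀ m i, 1 ≤ i → c m i = c' m i) :
    wordZero n c = wordZero n c' := by
  simp only [wordZero, h _ _ (Nat.le_add_left 1 _)]

end TypeB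

theorem mainTheorem5 (n k : ℕ) (hk : 1 ≤ k) (hkn : k ≤ n)
    (w₀ : TypeB.Weyl n) (hw₀ : TypeB.IsLongest w₀) (c : ℕ → ℕ → ℂˣ) :
    (k < n →
      TypeB.genMinor (TypeB.fundWeight ⟨k - 1, by omega⟩) w₀ (TypeB.simpleRefl ⟨k - 1, by omega⟩)
          (TypeB.thetaMinus (TypeB.wordZero n c)) =
        (c k 1 : ℂ) + ∑ j ∈ Finset.Icc 2 (n - 1), (c k j : ℂ) / (c (k + 1) (j - 1) : ℂ)
          + (c k n : ℂ) ^ 2 / (c (k + 1) (n - 1) : ℂ)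
          + 2 * ((c k n : ℂ) / (c (k + 1) n : ℂ))
          + (c (k + 1) (n - 1) : ℂ) / (c (k + 1) n : ℂ) ^ 2
          + ∑ m ∈ Finset.Icc (k + 2) n, (c m (n + k - m) : ℂ) / (c m (n + k - m + 1) : ℂ)) ∧
    (k = n →
      TypeB.genMinor (TypeB.fundWeight ⟨k - 1, by omega⟩) w₀ (TypeB.simpleRefl ⟨k - 1, by omega⟩)
          (TypeB.thetaMinus (TypeB.wordZero n c)) = (c n n : ℂ)) := by
  constructor
  · intro hlt
    -- The row formulas want parameters equal to `1` at index zero. Neither the word nor the stated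
    -- formula involves that index, so the normalization changes nothing.
    set c' : ℕ → ℕ → ℂˣ := fun m i => if i = 0 then 1 else c m i with hc'
    have h0 : ∀ m, c' m 0 = 1 := fun m => by simp [hc']
    have h1 : ∀ m i, 1 ≤ i → c m i = c' m i := fun m i hi => by
      simp [hc', show i ≠ 0 by omega]
    have hi : (⟨k - 1, by omega⟩ : Fin n).val + 1 < n := by simp; omega
    rw [TypeB.genMinor, TypeB.principalMinor_eq (TypeB.isPrincipalMinor_leadingMinor _ hi),
      TypeB.wordZero_congr h1, TypeB.leadingMinor_thetaMinus h0 hw₀ _ hi]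
    have h2 := TypeB.vecAct_thetaTail_corner h0 k hk hlt
    simp only [show k - 1 + 1 = k by omega]
    have hs1 : ∑ j ∈ Finset.Icc 2 (n - 1), (c k j : ℂ) / (c (k + 1) (j - 1) : ℂ) =
        ∑ j ∈ Finset.Icc 2 (n - 1), (c' k j : ℂ) / (c' (k + 1) (j - 1) : ℂ) := by
      refine Finset.sum_congr rfl fun j hj => ?_
      rw [Finset.mem_Icc] at hj
      rw [h1 k j (by omega), h1 (k + 1) (j - 1) (by omega)]
    have hs2 : ∑ m ∈ Finset.Icc (k + 2) n, (c m (n + k - m) : ℂ) / (c m (n + k - m + 1) : ℂ) =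
        ∑ m ∈ Finset.Icc (k + 2) n, (c' m (n + k - m) : ℂ) / (c' m (n + k - m + 1) : ℂ) := by
      refine Finset.sum_congr rfl fun m hm => ?_
      rw [Finset.mem_Icc] at hm
      rw [h1 m (n + k - m) (by omega), h1 m (n + k - m + 1) (by omega)]
    rw [hs1, hs2, h1 k 1 le_rfl, h1 k n (by omega), h1 (k + 1) (n - 1) (by omega),
      h1 (k + 1) n (by omega), ← h2]
  · rintro rfl
    have hi : (⟨k - 1, by omega⟩ : Fin k).val + 1 = k := by simp; omega
    rw [TypeB.genMinor, TypeB.principalMinor_eq (TypeB.isPrincipalMinor_spinCorner _ hi),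
      TypeB.spinCorner_thetaMinus c hw₀ _ hi]
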